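/- Let $k$ be $\mathbb{R}$ or $\mathbb{C}$, let $G$ be a second countable compact group, let $A$ be a separable $C^*$-algebra over $k$ and $B$ a $C^*$-algebra over $k$, both with norm-continuous actions of $G$ by $*$-automorphisms, and let $J\subset A$ be a closed two-sided $G$-invariant ideal. For Hilbert $B$-modules $E,E'$ let $\mathcal{L}(E)$ be the algebra of adjointable operators on $E$, and let $\mathcal{K}(E,E')$ be the compact operators (the closed linear span of the operators $z\mapsto y\langle x,z\rangle$, $x\in E$, $y\in E'$). The category $Rep(A;B)$ has as objects the pairs $(E,\phi)$, where $E$ is a countably generated right Hilbert $B$-module with a norm-continuous $G$-action compatible with that on $B$ and $\phi:A\to\mathcal{L}(E)$ is a $G$-equivariant $*$-homomorphism. The morphisms $(E,\phi)\to(E',\phi')$ are the $G$-invariant adjointable operators $f:E\to E'$ with $f\phi(a)-\phi'(a)f\in\mathcal{K}(E,E')$ for all $a\in A$. The norm is the operator norm and the involution is the adjoint. Let $D(A,J;B)$ be the $C^*$-ideal of $Rep(A;B)$ consisting of the morphisms $\alpha:(E,\phi)\to(E',\phi')$ such that $\alpha\phi(x)$ and $\phi'(x)\alpha$ lie in $\mathcal{K}(E,E')$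 for all $x\in J$. The category $Rep(J;B)$ and its ideal $D(J,J;B)$ are defined in the same way with $J$ in place of $A$. Quotients by $C^*$-ideals have the same objects, the quotient spaces of morphisms, the quotient norms and the induced involutions. Then the restriction $*$-functor $Rep(A;B)\to Rep(J;B)$, $(E,\phi)\mapsto(E,\phi|_J)$, $f\mapsto f$, maps $D(A,J;B)$ into $D(J,J;B)$, and the induced $*$-functor $$\xi: Rep(A;B)/D(A,J;B)\to Rep(J;B)/D(J,J;B)$$ is an equivalence of $C^*$-categories: it is an isometric $*$-preserving linear bijection on every space of morphisms, and every object of $Rep(J;B)/D(J,J;B)$ is unitarily isomorphic to an object in the image of $\xi$. -/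

import Mathlib

open CategoryTheory

set_option linter.unusedSectionVars false

universe uk uG uA uB uE v u v' u'

/-! ### C*-algebras over `k = ℝ` or `k = ℂ`, and group actions on them -/

/-- The C*-axioms, in a form valid over both `ℝ` and `ℂ`: the C*-identity and
`‖a‖ ^ 2 ≤ ‖a* a + b* b‖`.  Together with completeness, for real scalars this is the usual
axiomatisation of real C*-algebras; for complex scalars the inequality follows from the
C*-identity. -/
class IsCStar (A : Type*) [NonUnitalNormedRing A] [StarRing A] : Prop extends CStarRing A where
  norm_sq_le : ∀ a b : A, ‖a‖ ^ 2 ≤ ‖star a * a + star b * b‖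

/-- The action of `G` on the (possibly non-unital) C*-algebra `A` is by `k`-linear
`*`-automorphisms, and `g ↦ g • a` is norm continuous for every `a`. -/
class IsGAlgebra (k G A : Type*) [RCLike k] [Group G] [TopologicalSpace G]
    [NonUnitalNormedRing A] [StarRing A] [NormedSpace k A] [DistribMulAction G A] : Prop where
  smul_comm : ∀ (g : G) (c : k) (a : A), g • c • a = c • g • a
  smul_mul : ∀ (g : G) (a b : A), g • (a * b) = (g • a) * (g • b)
  smul_star : ∀ (g : G) (a : A), g • star a = star (g • a)
  continuous_smul : ∀ a : A, Continuous fun g : G => g • a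

/-! ### Normed `*`-categories, `*`-functors, C*-ideals and quotients -/

/-- A norm and an involution on the morphisms of a category. -/
class NormedStarHoms (C : Type u) [Category.{v} C] where
  group : ∀ X Y : C, NormedAddCommGroup (X ⟶ Y)
  adj : ∀ {X Y : C}, (X ⟶ Y) → (Y ⟶ X)

attribute [reducible, instance] NormedStarHoms.group

open NormedStarHoms (adj)

/-- The structure carried by a C*-category over `k`: normed `k`-linear morphism spaces, bilinear
composition and a conjugate-linear contravariant involution that is the identity on objects. -/
class NormedStarCategory (k : Type*) [RCLike k] (C : Type u) [Category.{v} C]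
    [NormedStarHoms C] where
  space : ∀ X Y : C, NormedSpace k (X ⟶ Y)
  add_comp : ∀ {X Y Z : C} (f f' : X ⟶ Y) (g : Y ⟶ Z), (f + f') ≫ g = f ≫ g + f' ≫ g
  comp_add : ∀ {X Y Z : C} (f : X ⟶ Y) (g g' : Y ⟶ Z), f ≫ (g + g') = f ≫ g + f ≫ g'
  smul_comp : ∀ {X Y Z : C} (c : k) (f : X ⟶ Y) (g : Y ⟶ Z), (c • f) ≫ g = c • (f ≫ g)
  comp_smul : ∀ {X Y Z : C} (c : k) (f : X ⟶ Y) (g : Y ⟶ Z), f ≫ (c • g) = c • (f ≫ g)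
  adj_adj : ∀ {X Y : C} (f : X ⟶ Y), adj (adj f) = f
  adj_comp : ∀ {X Y Z : C} (f : X ⟶ Y) (g : Y ⟶ Z), adj (f ≫ g) = adj g ≫ adj f
  adj_add : ∀ {X Y : C} (f g : X ⟶ Y), adj (f + g) = adj f + adj g
  adj_smul : ∀ {X Y : C} (c : k) (f : X ⟶ Y), adj (c • f) = star c • adj f

attribute [reducible, instance] NormedStarCategory.space

section StarCategories

variable (k : Type uk) [RCLike k]
variable (C : Type u) [Category.{v} C] [NormedStarHoms C] [NormedStarCategory k C]
variable (D : Type u') [Category.{v'} D] [NormedStarHoms D] [NormedStarCategory k D]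

/-- A `*`-functor: a `k`-linear functor that commutes with the involutions. -/
structure StarFunctor extends C ⥤ D where
  map_add : ∀ {X Y : C} (f g : X ⟶ Y), map (f + g) = map f + map g
  map_smul : ∀ {X Y : C} (c : k) (f : X ⟶ Y), map (c • f) = c • map f
  map_adj : ∀ {X Y : C} (f : X ⟶ Y), map (adj f) = adj (map f)

/-- A C*-ideal: a two-sided ideal of morphisms, closed in the norm and under the involution. -/
structure CStarIdeal where
  hom : ∀ X Y : C, Submodule k (X ⟶ Y)
  comp_mem_right : ∀ {X Y Z : C} (f : X ⟶ Y) (g : Y ⟶ Z), f ∈ hom X Y → f ≫ g ∈ hom X Z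
  comp_mem_left : ∀ {X Y Z : C} (f : X ⟶ Y) (g : Y ⟶ Z), g ∈ hom Y Z → f ≫ g ∈ hom X Z
  adj_mem : ∀ {X Y : C} (f : X ⟶ Y), f ∈ hom X Y → adj f ∈ hom Y X
  isClosed : ∀ X Y : C, IsClosed (hom X Y : Set (X ⟶ Y))

variable {k C D}

namespace StarFunctor

/-- Equivalence of C*-categories: an isometric bijection on every morphism space, such that every
object of the target is unitarily isomorphic to one in the image. -/
structure IsCStarEquivalence (F : StarFunctor k C D) : Prop where
  bijective : ∀ X Y : C, Function.Bijective fun f : X ⟶ Y => F.map f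
  norm_map : ∀ {X Y : C} (f : X ⟶ Y), ‖F.map f‖ = ‖f‖
  exists_unitary : ∀ Y : D, ∃ (X : C) (w : F.obj X ⟶ Y),
    w ≫ adj w = 𝟙 (F.obj X) ∧ adj w ≫ w = 𝟙 Y

end StarFunctor

namespace CStarIdeal

/-- The objects of the quotient category `C / I`: those of `C`. -/
@[ext]
structure Quot (_I : CStarIdeal k C) : Type u where
  as : C

variable (I : CStarIdeal k C)

/-- The morphisms `X → Y` of `C / I` form the quotient space `Hom(X, Y) / I(X, Y)`. -/
instance Quot.category : Category.{v} I.Quot where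
  Hom X Y := (X.as ⟶ Y.as) ⧸ I.hom X.as Y.as
  id X := Submodule.Quotient.mk (𝟙 X.as)
  comp {X Y Z} := Quotient.map₂ (fun (f : X.as ⟶ Y.as) (g : Y.as ⟶ Z.as) => f ≫ g) (by
    intro f f' hf g g' hg
    have hf' := (Submodule.quotientRel_def _).1 hf
    have hg' := (Submodule.quotientRel_def _).1 hg
    refine (Submodule.quotientRel_def _).2 ?_
    have h1 := I.comp_mem_right (f - f') g hf'
    have h2 := I.comp_mem_left f' (g - g') hg'
    have e1 : (f - f') ≫ g = f ≫ g - f' ≫ g := by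
      have := NormedStarCategory.add_comp k (f - f') f' g
      rw [sub_add_cancel] at this
      rw [this, add_sub_cancel_right]
    have e2 : f' ≫ (g - g') = f' ≫ g - f' ≫ g' := by
      have := NormedStarCategory.comp_add k f' (g - g') g'
      rw [sub_add_cancel] at this
      rw [this, add_sub_cancel_right]
    have h := Submodule.add_mem _ h1 h2
    rw [e1, e2, sub_add_sub_cancel] at h
    exact h)
  id_comp {X Y} f := by
    obtain ⟨f, rfl⟩ := Submodule.Quotient.mk_surjective _ f
    exact congrArg Submodule.Quotient.mk (Category.id_comp f)
  comp_id {X Y} f := by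
    obtain ⟨f, rfl⟩ := Submodule.Quotient.mk_surjective _ f
    exact congrArg Submodule.Quotient.mk (Category.comp_id f)
  assoc f g h := by
    obtain ⟨f, rfl⟩ := Submodule.Quotient.mk_surjective _ f
    obtain ⟨g, rfl⟩ := Submodule.Quotient.mk_surjective _ g
    obtain ⟨h, rfl⟩ := Submodule.Quotient.mk_surjective _ h
    exact congrArg Submodule.Quotient.mk (Category.assoc f g h)

/-- The class in `C / I` of a morphism of `C`. -/
def cls {X Y : C} (f : X ⟶ Y) : (Quot.mk X : I.Quot) ⟶ Quot.mk Y :=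
  Submodule.Quotient.mk (p := I.hom X Y) f

theorem cls_surjective {X Y : I.Quot} (f : X ⟶ Y) : ∃ f' : X.as ⟶ Y.as, I.cls f' = f :=
  Submodule.Quotient.mk_surjective _ f

theorem cls_comp {X Y Z : C} (f : X ⟶ Y) (g : Y ⟶ Z) :
    I.cls (f ≫ g) = I.cls f ≫ I.cls g := rfl

/-- The quotient norm and the induced involution on `C / I`. -/
noncomputable instance Quot.normedStarHoms : NormedStarHoms I.Quot where
  group X Y := @Submodule.Quotient.normedAddCommGroup (X.as ⟶ Y.as) _ k _ _
    (I.hom X.as Y.as) (I.isClosed X.as Y.as)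
  adj {X Y} := Quotient.map (fun f : X.as ⟶ Y.as => adj f) (by
    intro f f' hf
    have hf' := (Submodule.quotientRel_def _).1 hf
    refine (Submodule.quotientRel_def _).2 ?_
    have h := I.adj_mem (f - f') hf'
    have e := NormedStarCategory.adj_add k (f - f') f'
    rw [sub_add_cancel] at e
    rw [e, add_sub_cancel_right]
    exact h)

theorem cls_add {X Y : C} (f g : X ⟶ Y) : I.cls (f + g) = I.cls f + I.cls g := rfl

theorem cls_adj {X Y : C} (f : X ⟶ Y) : I.cls (adj f) = adj (I.cls f) := rfl

noncomputable instance Quot.normedStarCategory : NormedStarCategory k I.Quot where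
  space X Y := @Submodule.Quotient.normedSpace (X.as ⟶ Y.as) _ k _ _ (I.hom X.as Y.as) k _ _ _ _
  add_comp {X Y Z} f f' g := by
    obtain ⟨f, rfl⟩ := I.cls_surjective f
    obtain ⟨f', rfl⟩ := I.cls_surjective f'
    obtain ⟨g, rfl⟩ := I.cls_surjective g
    exact congrArg I.cls (NormedStarCategory.add_comp k f f' g)
  comp_add {X Y Z} f g g' := by
    obtain ⟨f, rfl⟩ := I.cls_surjective f
    obtain ⟨g, rfl⟩ := I.cls_surjective g
    obtain ⟨g', rfl⟩ := I.cls_surjective g'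
    exact congrArg I.cls (NormedStarCategory.comp_add k f g g')
  smul_comp {X Y Z} c f g := by
    obtain ⟨f, rfl⟩ := I.cls_surjective f
    obtain ⟨g, rfl⟩ := I.cls_surjective g
    exact congrArg I.cls (NormedStarCategory.smul_comp c f g)
  comp_smul {X Y Z} c f g := by
    obtain ⟨f, rfl⟩ := I.cls_surjective f
    obtain ⟨g, rfl⟩ := I.cls_surjective g
    exact congrArg I.cls (NormedStarCategory.comp_smul c f g)
  adj_adj {X Y} f := by
    obtain ⟨f, rfl⟩ := I.cls_surjective f
    exact congrArg I.cls (NormedStarCategory.adj_adj k f)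
  adj_comp {X Y Z} f g := by
    obtain ⟨f, rfl⟩ := I.cls_surjective f
    obtain ⟨g, rfl⟩ := I.cls_surjective g
    exact congrArg I.cls (NormedStarCategory.adj_comp k f g)
  adj_add {X Y} f g := by
    obtain ⟨f, rfl⟩ := I.cls_surjective f
    obtain ⟨g, rfl⟩ := I.cls_surjective g
    exact congrArg I.cls (NormedStarCategory.adj_add k f g)
  adj_smul {X Y} c f := by
    obtain ⟨f, rfl⟩ := I.cls_surjective f
    exact congrArg I.cls (NormedStarCategory.adj_smul c f)

/-- The `*`-functor `C / I → D / I'` induced by a `*`-functor `F : C → D` that maps `I` to `I'`. -/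
def induced {I : CStarIdeal k C} {I' : CStarIdeal k D} (F : StarFunctor k C D)
    (h : ∀ (X Y : C) (f : X ⟶ Y), f ∈ I.hom X Y → F.map f ∈ I'.hom (F.obj X) (F.obj Y)) :
    StarFunctor k I.Quot I'.Quot where
  obj X := ⟨F.obj X.as⟩
  map {X Y} := Quotient.map (fun f : X.as ⟶ Y.as => F.map f) (by
    intro f f' hf
    have hf' := (Submodule.quotientRel_def _).1 hf
    refine (Submodule.quotientRel_def _).2 ?_
    have h := h X.as Y.as (f - f') hf'
    have e := F.map_add (f - f') f'
    rw [sub_add_cancel] at e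
    rw [e, add_sub_cancel_right]
    exact h)
  map_id X := congrArg I'.cls (F.map_id X.as)
  map_comp {X Y Z} f g := by
    obtain ⟨f, rfl⟩ := I.cls_surjective f
    obtain ⟨g, rfl⟩ := I.cls_surjective g
    exact congrArg I'.cls (F.map_comp f g)
  map_add {X Y} f g := by
    obtain ⟨f, rfl⟩ := I.cls_surjective f
    obtain ⟨g, rfl⟩ := I.cls_surjective g
    exact congrArg I'.cls (F.map_add f g)
  map_smul {X Y} c f := by
    obtain ⟨f, rfl⟩ := I.cls_surjective f
    exact congrArg I'.cls (F.map_smul c f)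
  map_adj {X Y} f := by
    obtain ⟨f, rfl⟩ := I.cls_surjective f
    exact congrArg I'.cls (F.map_adj f)

end CStarIdeal

end StarCategories

/-! ### Hilbert modules with a `G`-action -/

/-- A countably generated right Hilbert `B`-module over `k` with a norm continuous `G`-action
compatible with the action of `G` on `B`.  `act x b` is `x · b`, and `inner x y ∈ B` is the
`B`-valued inner product, linear in the second variable. -/
structure HilbertModule (k : Type uk) (G : Type uG) (B : Type uB) [RCLike k] [Group G]
    [TopologicalSpace G] [NonUnitalNormedRing B] [StarRing B] [NormedSpace k B]
    [DistribMulAction G B] where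
  carrier : Type uE
  [normedAddCommGroup : NormedAddCommGroup carrier]
  [normedSpace : NormedSpace k carrier]
  [completeSpace : CompleteSpace carrier]
  [distribMulAction : DistribMulAction G carrier]
  act : carrier →ₗ[k] B →ₗ[k] carrier
  act_mul : ∀ x b c, act x (b * c) = act (act x b) c
  inner : carrier → carrier → B
  inner_add : ∀ x y z, inner x (y + z) = inner x y + inner x z
  inner_smul : ∀ x (c : k) y, inner x (c • y) = c • inner x y
  inner_act : ∀ x y b, inner x (act y b) = inner x y * b
  star_inner : ∀ x y, star (inner x y) = inner y x
  /-- positivity of `inner x x` in `B` -/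
  inner_self : ∀ x, ∃ b, inner x x = star b * b
  norm_sq : ∀ x, ‖x‖ ^ 2 = ‖inner x x‖
  g_smul_comm : ∀ (g : G) (c : k) (x : carrier), g • c • x = c • g • x
  g_smul_act : ∀ (g : G) (x : carrier) (b : B), g • act x b = act (g • x) (g • b)
  g_smul_inner : ∀ (g : G) (x y : carrier), inner (g • x) (g • y) = g • inner x y
  continuous_g_smul : ∀ x : carrier, Continuous fun g : G => g • x
  countablyGenerated : ∃ s : Set carrier, s.Countable ∧
    Dense (Submodule.span k {z | ∃ x ∈ s, ∃ b : B, z = act x b} : Set carrier)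

namespace HilbertModule

attribute [instance] normedAddCommGroup normedSpace completeSpace distribMulAction

variable {k : Type uk} {G : Type uG} {B : Type uB} [RCLike k] [Group G]
    [TopologicalSpace G] [NonUnitalNormedRing B] [StarRing B] [NormedSpace k B]
    [DistribMulAction G B]

instance : CoeSort (HilbertModule.{uk, uG, uB, uE} k G B) (Type uE) := ⟨carrier⟩

/-- `S` is an adjoint of `T`. -/
def IsAdj {E F : HilbertModule.{uk, uG, uB, uE} k G B} (T : E →L[k] F) (S : F →L[k] E) : Prop :=
  ∀ x y, F.inner (T x) y = E.inner x (S y)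

/-- `T` commutes with the actions of `G`. -/
def IsInvariant {E F : HilbertModule.{uk, uG, uB, uE} k G B} (T : E →L[k] F) : Prop :=
  ∀ (g : G) x, T (g • x) = g • T x

/-- The compact operators `𝒦(E, F)`: the norm closed linear span of the operators
`z ↦ y · ⟨x, z⟩`. -/
def compacts (E F : HilbertModule.{uk, uG, uB, uE} k G B) : Submodule k (E →L[k] F) :=
  (Submodule.span k {T : E →L[k] F | ∃ x y, ∀ z, T z = F.act y (E.inner x z)}).topologicalClosure

section basic

variable (E F H : HilbertModule.{uk, uG, uB, uE} k G B)

theorem inner_add_left (x y z : E) : E.inner (x + y) z = E.inner x z + E.inner y z := by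
  rw [← E.star_inner, E.inner_add, star_add, E.star_inner, E.star_inner]

theorem inner_act_left (x y : E) (b : B) : E.inner (E.act x b) y = star b * E.inner x y := by
  rw [← E.star_inner, E.inner_act, star_mul, E.star_inner]

theorem inner_sub (x y z : E) : E.inner x (y - z) = E.inner x y - E.inner x z := by
  have := E.inner_add x (y - z) z
  rw [sub_add_cancel] at this
  rw [this, add_sub_cancel_right]

theorem inner_smul_left [StarModule k B] (c : k) (x y : E) :
    E.inner (c • x) y = star c • E.inner x y := by
  rw [← E.star_inner, E.inner_smul, star_smul, E.star_inner]

theorem inner_zero (x : E) : E.inner x 0 = 0 := by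
  have := E.inner_sub x 0 0
  rwa [sub_self, sub_self] at this

theorem eq_of_inner {x y : E} (h : ∀ z, E.inner z x = E.inner z y) : x = y := by
  have h1 := E.norm_sq (x - y)
  rw [E.inner_sub, h, sub_self, norm_zero] at h1
  exact sub_eq_zero.1 (norm_eq_zero.1 (pow_eq_zero_iff two_ne_zero |>.1 h1))

variable {E F H}

theorem IsAdj.symm {T : E →L[k] F} {S : F →L[k] E} (h : IsAdj T S) : IsAdj S T := fun x y => by
  rw [← E.star_inner, ← h, F.star_inner]

theorem IsAdj.unique {T : E →L[k] F} {S S' : F →L[k] E} (h : IsAdj T S) (h' : IsAdj T S') :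
    S = S' := by
  ext y
  exact E.eq_of_inner fun z => by rw [← h, ← h']

theorem IsAdj.add {T T' : E →L[k] F} {S S' : F →L[k] E} (h : IsAdj T S) (h' : IsAdj T' S') :
    IsAdj (T + T') (S + S') := fun x y => by
  change F.inner (T x + T' x) y = E.inner x (S y + S' y)
  rw [F.inner_add_left, E.inner_add, h, h']

theorem IsAdj.sub {T T' : E →L[k] F} {S S' : F →L[k] E} (h : IsAdj T S) (h' : IsAdj T' S') :
    IsAdj (T - T') (S - S') := fun x y => by
  change F.inner (T x - T' x) y = E.inner x (S y - S' y)
  rw [← F.star_inner, F.inner_sub, E.inner_sub, star_sub, F.star_inner, F.star_inner, h, h']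

theorem IsAdj.zero : IsAdj (0 : E →L[k] F) 0 := fun x y => by
  change F.inner 0 y = E.inner x 0
  rw [← F.star_inner, F.inner_zero, E.inner_zero, star_zero]

theorem IsAdj.smul [StarModule k B] {T : E →L[k] F} {S : F →L[k] E} (h : IsAdj T S) (c : k) :
    IsAdj (c • T) (star c • S) := fun x y => by
  change F.inner (c • T x) y = E.inner x (star c • S y)
  rw [F.inner_smul_left, E.inner_smul, h]

theorem IsAdj.comp {T : E →L[k] F} {S : F →L[k] E} {T' : F →L[k] H} {S' : H →L[k] F}
    (h : IsAdj T S) (h' : IsAdj T' S') : IsAdj (T' ∘L T) (S ∘L S') := fun x y => by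
  change H.inner (T' (T x)) y = E.inner x (S (S' y))
  rw [h', h]

theorem IsAdj.invariant {T : E →L[k] F} {S : F →L[k] E} (h : IsAdj T S) (hT : IsInvariant T) :
    IsInvariant S := fun g y => E.eq_of_inner fun z => by
  have hz : z = g • g⁻¹ • z := (smul_inv_smul g z).symm
  rw [← h, hz, hT, F.g_smul_inner, E.g_smul_inner, h]

end basic

section norms

variable [StarModule k B] [IsCStar B]
variable {E F H : HilbertModule.{uk, uG, uB, uE} k G B}

theorem norm_act_le (x : E) (b : B) : ‖E.act x b‖ ≤ ‖x‖ * ‖b‖ := by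
  refine le_of_sq_le_sq ?_ (by positivity)
  rw [E.norm_sq, E.inner_act, inner_act_left]
  calc ‖star b * E.inner x x * b‖ ≤ ‖star b‖ * ‖E.inner x x‖ * ‖b‖ :=
        (norm_mul_le _ _).trans (by gcongr; exact norm_mul_le _ _)
    _ = (‖x‖ * ‖b‖) ^ 2 := by rw [norm_star, ← E.norm_sq]; ring

/-- The Cauchy-Schwarz inequality. -/
theorem norm_inner_le [IsScalarTower k B B] [SMulCommClass k B B] (x y : E) :
    ‖E.inner x y‖ ≤ ‖x‖ * ‖y‖ := by
  set a := E.inner x y with ha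
  by_cases ha0 : a = 0
  · rw [ha0, norm_zero]; positivity
  by_cases hy0 : y = 0
  · exact absurd (by rw [ha, hy0, inner_zero]) ha0
  by_cases hx0 : x = 0
  · exact absurd (by rw [ha, hx0, ← E.star_inner, inner_zero, star_zero]) ha0
  have hap : 0 < ‖a‖ := norm_pos_iff.2 ha0
  have hyp : 0 < ‖y‖ := norm_pos_iff.2 hy0
  have hxp : 0 < ‖x‖ := norm_pos_iff.2 hx0
  have key : ∀ s : ℝ, 0 ≤ s → 4 * s ^ 2 * ‖a‖ ^ 2 ≤ (‖x‖ * ‖a‖ + s ^ 2 * ‖y‖) ^ 2 := by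
    intro s hs
    obtain ⟨c, hc, hcn⟩ : ∃ c : k, star c = c ∧ ‖c‖ = s :=
      ⟨(s : k), RCLike.conj_ofReal s, by rw [RCLike.norm_ofReal, abs_of_nonneg hs]⟩
    set z := E.act x a with hz
    have hzy : E.inner z y = star a * a := by rw [hz, inner_act_left, ← ha]
    have hyz : E.inner y z = star a * a := by
      rw [hz, E.inner_act, ← E.star_inner, ← ha]
    obtain ⟨p, hp⟩ := E.inner_self (z - (c * c) • y)
    have hw : E.inner (z + (c * c) • y) (z + (c * c) • y)
        = star ((2 * c) • a) * ((2 * c) • a) + star p * p := by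
      rw [← hp, sub_eq_add_neg, ← neg_smul]
      simp only [E.inner_add, inner_add_left, E.inner_smul, inner_smul_left, hzy, hyz, star_smul,
        star_mul', star_neg, hc, smul_mul_smul_comm, star_ofNat]
      module
    have h1 := IsCStar.norm_sq_le ((2 * c) • a) p
    rw [← hw, ← E.norm_sq, norm_smul, norm_mul, hcn] at h1
    have h2 : ‖z + (c * c) • y‖ ≤ ‖x‖ * ‖a‖ + s ^ 2 * ‖y‖ := by
      refine (norm_add_le _ _).trans (add_le_add (norm_act_le x a) ?_)
      rw [norm_smul, norm_mul, hcn, sq]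
    have h3 := pow_le_pow_left₀ (norm_nonneg _) h2 2
    have h4 : ‖(2 : k)‖ = 2 := RCLike.norm_ofNat 2
    rw [h4] at h1
    nlinarith
  have h := key (√(‖x‖ * ‖a‖ / ‖y‖)) (Real.sqrt_nonneg _)
  rw [Real.sq_sqrt (by positivity), div_mul_cancel₀ _ hyp.ne'] at h
  have h5 : ‖x‖ * ‖a‖ ^ 2 * ‖a‖ ≤ ‖x‖ * ‖a‖ ^ 2 * (‖x‖ * ‖y‖) := by
    have : 4 * (‖x‖ * ‖a‖ / ‖y‖) * ‖a‖ ^ 2 * ‖y‖ ≤ (‖x‖ * ‖a‖ + ‖x‖ * ‖a‖) ^ 2 * ‖y‖ := by gcongr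
    have e : 4 * (‖x‖ * ‖a‖ / ‖y‖) * ‖a‖ ^ 2 * ‖y‖ = 4 * (‖x‖ * ‖a‖ ^ 2 * ‖a‖) := by
      field_simp
    rw [e] at this
    nlinarith
  exact le_of_mul_le_mul_left h5 (by positivity)

variable [IsScalarTower k B B] [SMulCommClass k B B]

theorem IsAdj.norm_le {T : E →L[k] F} {S : F →L[k] E} (h : IsAdj T S) : ‖S‖ ≤ ‖T‖ := by
  refine S.opNorm_le_bound (norm_nonneg _) fun y => ?_
  by_cases h0 : ‖S y‖ = 0
  · rw [h0]; positivity
  have h1 : ‖S y‖ ^ 2 ≤ ‖T‖ * ‖S y‖ * ‖y‖ := by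
    rw [E.norm_sq, ← h]
    exact (norm_inner_le _ _).trans (by gcongr; exact T.le_opNorm _)
  have h2 : 0 < ‖S y‖ := lt_of_le_of_ne (norm_nonneg _) (Ne.symm h0)
  exact le_of_mul_le_mul_left (by nlinarith) h2

/-- The rank one operator `z ↦ y · ⟨x, z⟩`. -/
theorem exists_rankOne (x : E) (y : F) :
    ∃ T : E →L[k] F, ∀ z, T z = F.act y (E.inner x z) := by
  refine ⟨LinearMap.mkContinuous
    { toFun := fun z => F.act y (E.inner x z)
      map_add' := fun z z' => by rw [E.inner_add, map_add]
      map_smul' := fun c z => by rw [E.inner_smul, map_smul]; rfl } (‖y‖ * ‖x‖) fun z => ?_,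
    fun z => rfl⟩
  refine (norm_act_le y _).trans ?_
  rw [mul_assoc]
  gcongr
  exact norm_inner_le x z

theorem compacts_adj {T : E →L[k] F} {S : F →L[k] E} (h : IsAdj T S) (hT : T ∈ compacts E F) :
    S ∈ compacts F E := by
  have fin : ∀ T' ∈ Submodule.span k
      {T : E →L[k] F | ∃ x y, ∀ z, T z = F.act y (E.inner x z)},
      ∃ S' ∈ Submodule.span k {T : F →L[k] E | ∃ x y, ∀ z, T z = E.act y (F.inner x z)},
        IsAdj T' S' := by
    intro T' hT'
    induction hT' using Submodule.span_induction with
    | mem T' hT' =>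
      obtain ⟨x, y, hxy⟩ := hT'
      obtain ⟨S', hS'⟩ := exists_rankOne (E := F) (F := E) y x
      refine ⟨S', Submodule.subset_span ⟨y, x, hS'⟩, fun z w => ?_⟩
      rw [hxy, hS', inner_act_left, E.inner_act, E.star_inner]
    | zero => exact ⟨0, Submodule.zero_mem _, IsAdj.zero⟩
    | add T₁ T₂ _ _ h₁ h₂ =>
      obtain ⟨S₁, m₁, a₁⟩ := h₁
      obtain ⟨S₂, m₂, a₂⟩ := h₂
      exact ⟨S₁ + S₂, Submodule.add_mem _ m₁ m₂, a₁.add a₂⟩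
    | smul c T₁ _ h₁ =>
      obtain ⟨S₁, m₁, a₁⟩ := h₁
      exact ⟨star c • S₁, Submodule.smul_mem _ _ m₁, a₁.smul c⟩
  refine Metric.mem_closure_iff.2 fun ε hε => ?_
  obtain ⟨T', hT', hd⟩ := Metric.mem_closure_iff.1 hT ε hε
  obtain ⟨S', hS', ha⟩ := fin T' hT'
  refine ⟨S', hS', ?_⟩
  rw [dist_eq_norm] at hd ⊢
  exact (h.sub ha).norm_le.trans_lt hd

theorem comp_mem_compacts {T : E →L[k] F} (hT : T ∈ compacts E F) (R : F →L[k] H)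
    (hR : ∀ y b, R (F.act y b) = H.act (R y) b) : R ∘L T ∈ compacts E H := by
  have hc : Continuous fun T : E →L[k] F => R ∘L T := (ContinuousLinearMap.compL k E F H R).continuous
  refine map_mem_closure hc hT fun T' hT' => ?_
  induction hT' using Submodule.span_induction with
  | mem T' hT' =>
    obtain ⟨x, y, hxy⟩ := hT'
    refine Submodule.subset_span ⟨x, R y, fun z => ?_⟩
    change R (T' z) = _
    rw [hxy, hR]
  | zero => simp
  | add T₁ T₂ _ _ h₁ h₂ =>
    rw [ContinuousLinearMap.comp_add]
    exact Submodule.add_mem _ h₁ h₂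
  | smul c T₁ _ h₁ =>
    rw [ContinuousLinearMap.comp_smul]
    exact Submodule.smul_mem _ _ h₁

theorem IsAdj.map_act {T : E →L[k] F} {S : F →L[k] E} (h : IsAdj T S) (x : E) (b : B) :
    T (E.act x b) = F.act (T x) b :=
  F.eq_of_inner fun z => by rw [← h.symm, E.inner_act, F.inner_act, h.symm]

theorem IsAdj.comp_mem {R : F →L[k] H} {R' : H →L[k] F} (h : IsAdj R R') {T : E →L[k] F}
    (hT : T ∈ compacts E F) : R ∘L T ∈ compacts E H :=
  comp_mem_compacts hT R h.map_act

theorem IsAdj.mem_comp {R : E →L[k] F} {R' : F →L[k] E} (h : IsAdj R R') {T : F →L[k] H}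
    (hT : T ∈ compacts F H) : T ∘L R ∈ compacts E H := by
  have hc : Continuous fun T : F →L[k] H => T ∘L R :=
    ((ContinuousLinearMap.compL k E F H).flip R).continuous
  refine map_mem_closure (f := fun T : F →L[k] H => T ∘L R) hc hT fun T' hT' => ?_
  induction hT' using Submodule.span_induction with
  | mem T' hT' =>
    obtain ⟨x, y, hxy⟩ := hT'
    refine Submodule.subset_span ⟨R' x, y, fun z => ?_⟩
    change T' (R z) = _
    rw [hxy, h.symm]
  | zero => simp
  | add T₁ T₂ _ _ h₁ h₂ =>
    beta_reduce at h₁ h₂ ⊢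
    rw [ContinuousLinearMap.add_comp]
    exact Submodule.add_mem _ h₁ h₂
  | smul c T₁ _ h₁ =>
    beta_reduce at h₁ ⊢
    rw [ContinuousLinearMap.smul_comp]
    exact Submodule.smul_mem _ _ h₁

end norms

end HilbertModule

/-! ### The category `Rep(A; B)` -/

/-- The objects of `Rep(A; B)`: a Hilbert `B`-module `E` and a `G`-equivariant `*`-homomorphism
`φ : A → ℒ(E)` into the adjointable operators (`φ (a*)` is the adjoint of `φ a`). -/
structure RepCat (k : Type uk) (G : Type uG) (A : Type uA) (B : Type uB) [RCLike k] [Group G]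
    [TopologicalSpace G] [NonUnitalRing A] [StarRing A] [Module k A] [SMul G A]
    [NonUnitalNormedRing B] [StarRing B] [NormedSpace k B] [DistribMulAction G B] where
  E : HilbertModule.{uk, uG, uB, uE} k G B
  φ : A →ₙₐ[k] (E →L[k] E)
  isAdj : ∀ a, HilbertModule.IsAdj (φ a) (φ (star a))
  equivariant : ∀ (g : G) (a : A) (x : E), φ (g • a) (g • x) = g • φ a x

namespace RepCat

open HilbertModule

variable {k : Type uk} {G : Type uG} {A : Type uA} {B : Type uB} [RCLike k] [Group G]
    [TopologicalSpace G] [NonUnitalRing A] [StarRing A] [Module k A] [SMul G A]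
    [NonUnitalNormedRing B] [StarRing B] [NormedSpace k B] [DistribMulAction G B]
    [StarModule k B]

/-- The morphisms of `Rep(A; B)`: the `G`-invariant adjointable operators `f : E → E'` with
`f φ(a) - φ'(a) f` compact for all `a ∈ A`. -/
def homs (X Y : RepCat.{uk, uG, uA, uB, uE} k G A B) : Submodule k (X.E →L[k] Y.E) where
  carrier := {f | (∃ f', IsAdj f f') ∧ IsInvariant f ∧
    ∀ a, f ∘L X.φ a - Y.φ a ∘L f ∈ compacts X.E Y.E}
  zero_mem' := ⟨⟨0, IsAdj.zero⟩, fun g x => (smul_zero g).symm, fun a => by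
    rw [ContinuousLinearMap.zero_comp, ContinuousLinearMap.comp_zero, sub_zero]
    exact Submodule.zero_mem _⟩
  add_mem' := by
    rintro f f' ⟨⟨s, hs⟩, h1, h2⟩ ⟨⟨s', hs'⟩, h1', h2'⟩
    refine ⟨⟨s + s', hs.add hs'⟩, fun g x => ?_, fun a => ?_⟩
    · change f (g • x) + f' (g • x) = g • (f x + f' x)
      rw [h1, h1', smul_add]
    · have := Submodule.add_mem _ (h2 a) (h2' a)
      rw [ContinuousLinearMap.add_comp, ContinuousLinearMap.comp_add]
      convert this using 1
      abel
  smul_mem' := by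
    rintro c f ⟨⟨s, hs⟩, h1, h2⟩
    refine ⟨⟨star c • s, hs.smul c⟩, fun g x => ?_, fun a => ?_⟩
    · change c • f (g • x) = g • c • f x
      rw [h1, Y.E.g_smul_comm]
    · have := Submodule.smul_mem _ c (h2 a)
      rwa [smul_sub, ← ContinuousLinearMap.smul_comp, ← ContinuousLinearMap.comp_smul] at this

variable [IsCStar B] [IsScalarTower k B B] [SMulCommClass k B B]

theorem comp_mem_homs {X Y Z : RepCat.{uk, uG, uA, uB, uE} k G A B} {f : X.E →L[k] Y.E}
    {g : Y.E →L[k] Z.E} (hf : f ∈ homs X Y) (hg : g ∈ homs Y Z) : g ∘L f ∈ homs X Z := by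
  obtain ⟨⟨s, hs⟩, h1, h2⟩ := hf
  obtain ⟨⟨s', hs'⟩, h1', h2'⟩ := hg
  refine ⟨⟨s ∘L s', hs.comp hs'⟩, fun γ x => ?_, fun a => ?_⟩
  · change g (f (γ • x)) = γ • g (f x)
    rw [h1, h1']
  · have := Submodule.add_mem _ (hs'.comp_mem (h2 a)) (hs.mem_comp (h2' a))
    convert this using 1
    ext x
    simp

theorem adj_mem_homs {X Y : RepCat.{uk, uG, uA, uB, uE} k G A B} {f : X.E →L[k] Y.E}
    {s : Y.E →L[k] X.E} (hf : f ∈ homs X Y) (hs : IsAdj f s) : s ∈ homs Y X := by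
  obtain ⟨-, h1, h2⟩ := hf
  refine ⟨⟨f, hs.symm⟩, hs.invariant h1, fun a => ?_⟩
  have h3 : IsAdj (f ∘L X.φ (star a) - Y.φ (star a) ∘L f) (X.φ a ∘L s - s ∘L Y.φ a) := by
    have hX := X.isAdj (star a)
    have hY := Y.isAdj (star a)
    rw [star_star] at hX hY
    exact (hX.comp hs).sub (hs.comp hY)
  have := Submodule.neg_mem _ (compacts_adj h3 (h2 (star a)))
  rwa [neg_sub] at this

theorem id_mem_homs (X : RepCat.{uk, uG, uA, uB, uE} k G A B) :
    ContinuousLinearMap.id k X.E ∈ homs X X :=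
  ⟨⟨ContinuousLinearMap.id k X.E, fun _ _ => rfl⟩, fun _ _ => rfl, fun a => by
    rw [ContinuousLinearMap.id_comp, ContinuousLinearMap.comp_id, sub_self]
    exact Submodule.zero_mem _⟩

instance category : Category (RepCat.{uk, uG, uA, uB, uE} k G A B) where
  Hom X Y := homs X Y
  id X := ⟨ContinuousLinearMap.id k X.E, id_mem_homs X⟩
  comp f g := ⟨g.1 ∘L f.1, comp_mem_homs f.2 g.2⟩

/-- The operator underlying a morphism. -/
def op {X Y : RepCat.{uk, uG, uA, uB, uE} k G A B} (f : X ⟶ Y) : X.E →L[k] Y.E :=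
  Subtype.val (p := fun f => f ∈ homs X Y) f

/-- The operator norm, and the adjoint of operators. -/
noncomputable instance normedStarHoms : NormedStarHoms (RepCat.{uk, uG, uA, uB, uE} k G A B) where
  group X Y := inferInstanceAs (NormedAddCommGroup (homs X Y))
  adj f := ⟨f.2.1.choose, adj_mem_homs f.2 f.2.1.choose_spec⟩

theorem hom_ext {X Y : RepCat.{uk, uG, uA, uB, uE} k G A B} {f g : X ⟶ Y} (h : op f = op g) :
    f = g := Subtype.ext h

theorem op_mem {X Y : RepCat.{uk, uG, uA, uB, uE} k G A B} (f : X ⟶ Y) : op f ∈ homs X Y := f.2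

theorem isAdj_adj {X Y : RepCat.{uk, uG, uA, uB, uE} k G A B} (f : X ⟶ Y) :
    IsAdj (op f) (op (NormedStarHoms.adj f)) := f.2.1.choose_spec

theorem adj_eq {X Y : RepCat.{uk, uG, uA, uB, uE} k G A B} {f : X ⟶ Y} {g : Y ⟶ X}
    (h : IsAdj (op f) (op g)) : NormedStarHoms.adj f = g :=
  hom_ext ((isAdj_adj f).unique h)

noncomputable instance normedStarCategory :
    NormedStarCategory k (RepCat.{uk, uG, uA, uB, uE} k G A B) where
  space X Y := inferInstanceAs (NormedSpace k (homs X Y))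
  add_comp f f' g := hom_ext (ContinuousLinearMap.comp_add (op g) (op f) (op f'))
  comp_add f g g' := hom_ext (ContinuousLinearMap.add_comp (op g) (op g') (op f))
  smul_comp c f g := hom_ext (ContinuousLinearMap.comp_smul (op g) c (op f))
  comp_smul c f g := hom_ext (ContinuousLinearMap.smul_comp c (op g) (op f))
  adj_adj f := adj_eq (isAdj_adj f).symm
  adj_comp f g := adj_eq ((isAdj_adj f).comp (isAdj_adj g))
  adj_add f g := adj_eq ((isAdj_adj f).add (isAdj_adj g))
  adj_smul c f := adj_eq ((isAdj_adj f).smul c)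

/-- The C*-ideal `D(A, J; B)` of `Rep(A; B)`: the morphisms `α : (E, φ) → (E', φ')` such that
`α φ(x)` and `φ'(x) α` are compact for all `x ∈ J`. -/
def D [IsScalarTower k A A] [SMulCommClass k A A] [StarModule k A]
    (J : NonUnitalStarSubalgebra k A) : CStarIdeal k (RepCat.{uk, uG, uA, uB, uE} k G A B) where
  hom X Y :=
    { carrier := {α | ∀ x ∈ J, op α ∘L X.φ x ∈ compacts X.E Y.E ∧
        Y.φ x ∘L op α ∈ compacts X.E Y.E}
      zero_mem' := fun x _ => by
        have e : op (0 : X ⟶ Y) = 0 := rfl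
        rw [e, ContinuousLinearMap.zero_comp, ContinuousLinearMap.comp_zero]
        exact ⟨Submodule.zero_mem _, Submodule.zero_mem _⟩
      add_mem' := fun {f g} hf hg x hx => by
        have e : op (f + g) = op f + op g := rfl
        rw [e, ContinuousLinearMap.add_comp, ContinuousLinearMap.comp_add]
        exact ⟨Submodule.add_mem _ (hf x hx).1 (hg x hx).1,
          Submodule.add_mem _ (hf x hx).2 (hg x hx).2⟩
      smul_mem' := fun c f hf x hx => by
        have e : op (c • f) = c • op f := rfl
        rw [e, ContinuousLinearMap.smul_comp, ContinuousLinearMap.comp_smul]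
        exact ⟨Submodule.smul_mem _ _ (hf x hx).1, Submodule.smul_mem _ _ (hf x hx).2⟩ }
  comp_mem_right {X Y Z} f g hf x hx := by
    have h1 := (isAdj_adj g).comp_mem (hf x hx).1
    have h2 := (isAdj_adj g).comp_mem (hf x hx).2
    have h3 := (isAdj_adj f).mem_comp ((op_mem g).2.2 x)
    refine ⟨h1, ?_⟩
    have := Submodule.sub_mem _ h2 h3
    convert this using 1
    ext z
    change Z.φ x (op g (op f z)) = op g (Y.φ x (op f z)) -
      (op g (Y.φ x (op f z)) - Z.φ x (op g (op f z)))
    abel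
  comp_mem_left {X Y Z} f g hg x hx := by
    have h1 := (isAdj_adj f).mem_comp (hg x hx).1
    have h2 := (isAdj_adj f).mem_comp (hg x hx).2
    have h3 := (isAdj_adj g).comp_mem ((op_mem f).2.2 x)
    refine ⟨?_, h2⟩
    have := Submodule.add_mem _ h1 h3
    convert this using 1
    ext z
    change op g (op f (X.φ x z)) = op g (Y.φ x (op f z)) +
      op g (op f (X.φ x z) - Y.φ x (op f z))
    rw [map_sub]
    abel
  adj_mem {X Y} f hf x hx := by
    obtain ⟨h1, h2⟩ := hf (star x) (star_mem hx)
    have hX := X.isAdj (star x)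
    have hY := Y.isAdj (star x)
    rw [star_star] at hX hY
    exact ⟨compacts_adj ((isAdj_adj f).comp hY) h2, compacts_adj (hX.comp (isAdj_adj f)) h1⟩
  isClosed X Y := by
    have hc : Continuous fun α : X ⟶ Y => op α := continuous_subtype_val
    have h1 : ∀ x, IsClosed {α : X ⟶ Y | op α ∘L X.φ x ∈ compacts X.E Y.E} := fun x =>
      (Submodule.isClosed_topologicalClosure _).preimage
        (((ContinuousLinearMap.compL k X.E X.E Y.E).flip (X.φ x)).continuous.comp hc)
    have h2 : ∀ x, IsClosed {α : X ⟶ Y | Y.φ x ∘L op α ∈ compacts X.E Y.E} := fun x =>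
      (Submodule.isClosed_topologicalClosure _).preimage
        ((ContinuousLinearMap.compL k X.E Y.E Y.E (Y.φ x)).continuous.comp hc)
    have h3 := isClosed_iInter fun x => isClosed_iInter fun _ : x ∈ J => (h1 x).inter (h2 x)
    convert h3 using 1
    ext α
    simp only [Set.mem_iInter]
    rfl

end RepCat

/-! ### Invariant ideals and restriction -/

/-- A closed two-sided `G`-invariant ideal of `A`. -/
structure InvariantIdeal (k : Type uk) (G : Type uG) (A : Type uA) [RCLike k]
    [NonUnitalNormedRing A] [StarRing A] [NormedSpace k A] [SMul G A]
    extends NonUnitalStarSubalgebra k A where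
  mul_mem_left : ∀ a, ∀ x ∈ carrier, a * x ∈ carrier
  mul_mem_right : ∀ a, ∀ x ∈ carrier, x * a ∈ carrier
  g_smul_mem : ∀ (g : G), ∀ x ∈ carrier, g • x ∈ carrier
  isClosed : IsClosed carrier

namespace InvariantIdeal

variable {k : Type uk} {G : Type uG} {A : Type uA} [RCLike k]
    [NonUnitalNormedRing A] [StarRing A] [NormedSpace k A] [SMul G A]

/-- The ideal `J`, as a C*-algebra in its own right. -/
abbrev Alg (J : InvariantIdeal k G A) : Type uA := J.toNonUnitalStarSubalgebra

instance (J : InvariantIdeal k G A) : SMul G J.Alg := ⟨fun g x => ⟨g • x.1, J.g_smul_mem g x.1 x.2⟩⟩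

end InvariantIdeal

namespace RepCat

open HilbertModule

variable {k : Type uk} {G : Type uG} {A : Type uA} {B : Type uB} [RCLike k] [Group G]
    [TopologicalSpace G] [NonUnitalNormedRing A] [StarRing A] [NormedSpace k A] [SMul G A]
    [NonUnitalNormedRing B] [StarRing B] [NormedSpace k B] [DistribMulAction G B]
    [StarModule k B] [IsCStar B] [IsScalarTower k B B] [SMulCommClass k B B]

/-- Restriction of an object of `Rep(A; B)` along the inclusion `J → A`. -/
def restrictObj (J : InvariantIdeal k G A) (X : RepCat.{uk, uG, uA, uB, uE} k G A B) :
    RepCat.{uk, uG, uA, uB, uE} k G J.Alg B where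
  E := X.E
  φ := X.φ.comp (NonUnitalSubalgebraClass.subtype J.toNonUnitalStarSubalgebra)
  isAdj a := X.isAdj a.1
  equivariant g a x := X.equivariant g a.1 x

/-- Restriction of a morphism: the same operator. -/
def restrictMap (J : InvariantIdeal k G A) {X Y : RepCat.{uk, uG, uA, uB, uE} k G A B}
    (f : X ⟶ Y) : restrictObj J X ⟶ restrictObj J Y :=
  ⟨op (X := X) (Y := Y) f, (op_mem f).1, (op_mem f).2.1, fun a => (op_mem f).2.2 a.1⟩

/-- The `*`-functor `Rep(A; B) → Rep(J; B)`, `(E, φ) ↦ (E, φ|_J)` and `f ↦ f`. -/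
noncomputable def restrict (J : InvariantIdeal k G A) :
    StarFunctor k (RepCat.{uk, uG, uA, uB, uE} k G A B) (RepCat.{uk, uG, uA, uB, uE} k G J.Alg B) where
  obj X := restrictObj J X
  map f := restrictMap J f
  map_id X := rfl
  map_comp f g := rfl
  map_add f g := rfl
  map_smul c f := rfl
  map_adj f := (adj_eq (f := restrictMap J f) (g := restrictMap J (NormedStarHoms.adj f))
    (isAdj_adj f)).symm

end RepCat

/-! Membership in either ideal is the same condition on an operator, so restriction induces a
well-defined and faithful functor on the quotients. Fullness, equality of norms and essential
surjectivity all rest on Kasparov's technical theorem (`exists_technical_operator`): invariant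
self-adjoint contractions v_n with good asymptotic behaviour are assembled into one operator N = ∑
p_n* v_n² p_n, where ∑ p_n* p_n = 1 is a partition of unity by invariant compact operators that
almost commute with the given data (`exists_compact_partition`). In the applications v_n = φ(e_n)
for an invariant approximate unit (e_n) of J, taken quasicentral in A when A acts.

Fullness (`exists_lift`): let T be a morphism of Rep(J; B) between restricted objects and write [T,
b] = Tφ(b) - φ'(b)T. For x in J and b in A the operator φ'(x)[T, b] = [T, xb] - [T, x]φ(b) is
compact. Hence N can be chosen so that, modulo compact operators, it acts as 1 on φ'(J), commutes
with φ'(A) and kills every [T, b]. Then NT is a morphism of Rep(A; B), it differs from T by an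
element of D(J, J; B), and ‖NT‖ ≤ ‖T‖, which gives the equality of quotient norms.

Essential surjectivity (`exists_restrict_unitary`): on the closed span of φ(J)E the action of J
extends to A by a · φ(x)z = φ(ax)z (`exists_extension`). This submodule need not be complemented, so
its inclusion ι need not be adjointable. A compact perturbation of N has its range in the submodule,
however; composing it with ι gives an adjointable operator that is unitary modulo D(J, J; B).

The tools avoid spectral theory, so that they work over ℝ and ℂ alike. Square roots come from the
contraction principle (`exists_add_sub_sq_eq`), positivity of T means ‖t - T‖ ≤ t for some t ≥ 0,
and the inequality ‖a‖² ≤ ‖a*a + b*b‖ carries the order comparisons. Approximate units become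
invariant by averaging over Haar measure (`exists_invariant_approx_unit`) and quasicentral by convex
combinations (`exists_quasicentral`). -/

/-! ### Square roots near the identity -/

section SquareRoot

variable {R : Type*} [NonUnitalNormedRing R] [NormedSpace ℝ R] [IsScalarTower ℝ R R]
  [SMulCommClass ℝ R R]

/-- If `b` and `b'` solve `2b - b² = y` in a ball of radius less than `1`, they agree. -/
theorem eq_of_add_sub_sq_eq {r : ℝ} (hr : r < 1) {b b' : R} (hb : ‖b‖ ≤ r) (hb' : ‖b'‖ ≤ r)
    (h : b + b - b * b = b' + b' - b' * b') : b = b' := by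
  -- Subtracting the equations and splitting b² - b'² noncommutatively leads to 2‖b - b'‖ ≤ 2r‖b -
  -- b'‖.
  have h1 : (b - b') + (b - b') = b * (b - b') + (b - b') * b' := by
    have h2 : b + b - (b' + b') = b * b - b' * b' := by
      rw [sub_eq_sub_iff_add_eq_add] at h ⊢
      rw [h]; abel
    rw [mul_sub, sub_mul]
    calc b - b' + (b - b') = b + b - (b' + b') := by abel
      _ = b * b - b' * b' := h2
      _ = _ := by abel
  have h2 : 2 * ‖b - b'‖ ≤ 2 * r * ‖b - b'‖ := by
    calc 2 * ‖b - b'‖ = ‖(b - b') + (b - b')‖ := by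
          rw [← two_smul ℝ (b - b'), norm_smul]; norm_num
      _ ≤ ‖b‖ * ‖b - b'‖ + ‖b - b'‖ * ‖b'‖ := by
          rw [h1]
          exact (norm_add_le _ _).trans (add_le_add (norm_mul_le _ _) (norm_mul_le _ _))
      _ ≤ r * ‖b - b'‖ + ‖b - b'‖ * r := by gcongr
      _ = _ := by ring
  have h3 : ‖b - b'‖ = 0 := by
    have := norm_nonneg (b - b')
    nlinarith
  exact sub_eq_zero.1 (norm_eq_zero.1 h3)

variable [CompleteSpace R]

/-- For `‖y‖ < 1` the equation `(1 - b)² = 1 - y` has a solution in every closed subalgebra that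
contains `y`. -/
theorem exists_add_sub_sq_eq (I : NonUnitalSubalgebra ℝ R) (hI : IsClosed (I : Set R)) {y : R}
    (hy : y ∈ I) (hy1 : ‖y‖ < 1) :
    ∃ b ∈ I, b + b - b * b = y ∧ ‖b‖ ≤ 1 - √(1 - ‖y‖) := by
  -- `r` is the smaller root of ‖y‖ + r² = 2r, so b ↦ (y + b²)/2 maps the ball of radius `r` to
  -- itself and is `r`-Lipschitz there.
  set r : ℝ := 1 - √(1 - ‖y‖) with hr
  have hs : 0 < √(1 - ‖y‖) := Real.sqrt_pos.2 (by linarith)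
  have hs1 : √(1 - ‖y‖) ≤ 1 := Real.sqrt_le_one.2 (by linarith [norm_nonneg y])
  have hr0 : 0 ≤ r := by linarith
  have hr2 : ‖y‖ + r * r = 2 * r := by
    have := Real.mul_self_sqrt (by linarith : 0 ≤ 1 - ‖y‖)
    rw [hr]; linarith
  set s : Set R := (I : Set R) ∩ Metric.closedBall 0 r with hsdef
  have hsc : IsComplete s := (hI.inter Metric.isClosed_closedBall).isComplete
  let f : R → R := fun b => (1 / 2 : ℝ) • (y + b * b)
  have hm : Set.MapsTo f s s := by
    rintro b ⟨hbI, hb⟩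
    rw [mem_closedBall_zero_iff] at hb
    refine ⟨I.toSubmodule.smul_mem _ (I.add_mem hy (I.mul_mem hbI hbI)), ?_⟩
    rw [mem_closedBall_zero_iff, norm_smul]
    have : ‖y + b * b‖ ≤ ‖y‖ + r * r :=
      (norm_add_le _ _).trans (by gcongr; exact (norm_mul_le _ _).trans (by gcongr))
    norm_num
    linarith
  have hc : ContractingWith r.toNNReal (hm.restrict f s s) := by
    refine ⟨by rw [Real.toNNReal_lt_one]; linarith, LipschitzWith.of_dist_le_mul ?_⟩
    rintro ⟨b, -, hb⟩ ⟨b', -, hb'⟩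
    rw [mem_closedBall_zero_iff] at hb hb'
    change dist ((1 / 2 : ℝ) • (y + b * b)) ((1 / 2 : ℝ) • (y + b' * b')) ≤ r.toNNReal * dist b b'
    rw [Real.coe_toNNReal _ hr0, dist_eq_norm, dist_eq_norm, ← smul_sub, norm_smul]
    have e : y + b * b - (y + b' * b') = b * (b - b') + (b - b') * b' := by
      rw [mul_sub, sub_mul]; abel
    have : ‖y + b * b - (y + b' * b')‖ ≤ r * ‖b - b'‖ + ‖b - b'‖ * r := by
      rw [e]
      refine (norm_add_le _ _).trans (add_le_add ?_ ?_)
      · exact (norm_mul_le _ _).trans (by gcongr)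
      · exact (norm_mul_le _ _).trans (by gcongr)
    rw [Real.norm_of_nonneg (by norm_num)]
    linarith
  have h0 : (0 : R) ∈ s := ⟨I.zero_mem, by simpa using hr0⟩
  obtain ⟨b, ⟨hbI, hb⟩, hfix, -⟩ := hc.exists_fixedPoint' hsc hm h0 (edist_ne_top _ _)
  refine ⟨b, hbI, ?_, by simpa using hb⟩
  have h2 : y + b * b = b + b := by
    have h3 : (1 / 2 : ℝ) • (y + b * b) = b := hfix
    calc y + b * b = (2 : ℝ) • (1 / 2 : ℝ) • (y + b * b) := by rw [smul_smul]; norm_num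
      _ = b + b := by rw [h3, two_smul]
  rw [← h2, add_sub_cancel_right]

/-- Applying the derivation [·, m] to 2b - b² = y gives 2[b, m] = [y, m] + b[b, m] + [b, m]b, and
the last two terms are absorbed on the left. Thus the square root 1 - b almost commutes with
whatever `y` almost commutes with. -/
theorem norm_commutator_le_of_add_sub_sq_eq {y b : R} {r : ℝ} (hb : b + b - b * b = y)
    (hbr : ‖b‖ ≤ 1 - r) (m : R) : r * ‖b * m - m * b‖ ≤ ‖y * m - m * y‖ := by
  have e : (b * m - m * b) + (b * m - m * b) =
      (y * m - m * y) + (b * (b * m - m * b) + (b * m - m * b) * b) := by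
    rw [← hb]; noncomm_ring
  have h1 : 2 * ‖b * m - m * b‖ ≤ ‖y * m - m * y‖ + 2 * ((1 - r) * ‖b * m - m * b‖) := by
    calc 2 * ‖b * m - m * b‖ = ‖(b * m - m * b) + (b * m - m * b)‖ := by
          rw [← two_smul ℝ (b * m - m * b), norm_smul]; norm_num
      _ ≤ ‖y * m - m * y‖ + (‖b‖ * ‖b * m - m * b‖ + ‖b * m - m * b‖ * ‖b‖) := by
          rw [e]
          exact (norm_add_le _ _).trans (add_le_add le_rfl ((norm_add_le _ _).trans
            (add_le_add (norm_mul_le _ _) (norm_mul_le _ _))))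
      _ ≤ ‖y * m - m * y‖ + ((1 - r) * ‖b * m - m * b‖ + ‖b * m - m * b‖ * (1 - r)) := by gcongr
      _ = _ := by ring
  have := norm_nonneg (y * m - m * y)
  linarith

/-- The adjoint of `b` solves the same equation in the same ball, where solutions are unique. -/
theorem star_eq_of_add_sub_sq_eq [StarRing R] [NormedStarGroup R] {y b : R} {r : ℝ} (hr : r < 1)
    (hb : b + b - b * b = y) (hbr : ‖b‖ ≤ r) (hy : star y = y) : star b = b :=
  eq_of_add_sub_sq_eq hr (by rwa [norm_star]) hbr (by
    rw [hb, ← hy, ← hb, star_sub, star_add, star_mul])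

end SquareRoot

/-! ### Positive elements of unital C*-algebras over `ℝ` -/

section Positive

variable {M : Type*} [NormedRing M] [StarRing M] [IsCStar M] [NormedAlgebra ℝ M] [StarModule ℝ M]

/-- Positivity, expressed by the norm of `t - T` for a large scalar `t`. -/
def IsPosElt (T : M) : Prop := star T = T ∧ ∃ t : ℝ, 0 ≤ t ∧ ‖t • (1 : M) - T‖ ≤ t

/-- Equality fails in the zero ring, which occurs as the operators on a zero module. -/
theorem norm_one_le_one : ‖(1 : M)‖ ≤ 1 := by
  have h := CStarRing.norm_star_mul_self (x := (1 : M))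
  rw [star_one, one_mul] at h
  by_contra h1
  push Not at h1
  nlinarith

theorem norm_sq_star_self {x : M} (hx : star x = x) : ‖x * x‖ = ‖x‖ ^ 2 := by
  have h := CStarRing.norm_star_mul_self (x := x)
  rw [hx] at h
  rw [h, sq]

theorem IsPosElt.add {S T : M} (hS : IsPosElt S) (hT : IsPosElt T) : IsPosElt (S + T) := by
  obtain ⟨hS, s, hs, hs'⟩ := hS
  obtain ⟨hT, t, ht, ht'⟩ := hT
  refine ⟨by rw [star_add, hS, hT], s + t, add_nonneg hs ht, ?_⟩
  have e : (s + t) • (1 : M) - (S + T) = (s • (1 : M) - S) + (t • (1 : M) - T) := by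
    rw [add_smul]; abel
  rw [e]
  exact (norm_add_le _ _).trans (add_le_add hs' ht')

theorem IsPosElt.zero : IsPosElt (0 : M) := ⟨star_zero M, 0, le_rfl, by simp⟩

theorem IsPosElt.sum {ι : Type*} {s : Finset ι} {f : ι → M} (h : ∀ i ∈ s, IsPosElt (f i)) :
    IsPosElt (∑ i ∈ s, f i) :=
  Finset.sum_induction f IsPosElt (fun _ _ => IsPosElt.add) IsPosElt.zero h

theorem IsPosElt.smul {T : M} (hT : IsPosElt T) {c : ℝ} (hc : 0 ≤ c) : IsPosElt (c • T) := by
  obtain ⟨hT, t, ht, ht'⟩ := hT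
  refine ⟨by rw [star_smul, hT, star_trivial], c * t, mul_nonneg hc ht, ?_⟩
  rw [mul_smul, ← smul_sub, norm_smul, Real.norm_of_nonneg hc]
  gcongr

variable [CompleteSpace M]

/-- If `y` is self-adjoint of norm less than `1`, then `1 - y` has a self-adjoint square root. -/
theorem exists_sqrt_one_sub {y : M} (hy : star y = y) (hy1 : ‖y‖ < 1) :
    ∃ s : M, star s = s ∧ s * s = 1 - y := by
  obtain ⟨b, -, hb, hbr⟩ := exists_add_sub_sq_eq (R := M) ⊤ isClosed_univ trivial hy1
  have hs : 0 < √(1 - ‖y‖) := Real.sqrt_pos.2 (by linarith)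
  have hbs := star_eq_of_add_sub_sq_eq (by linarith) hb hbr hy
  refine ⟨1 - b, by rw [star_sub, hbs, star_one], ?_⟩
  rw [← hb]; noncomm_ring

/-- After rescaling to ‖a‖ < 1 there is a self-adjoint r with r² = 1 - a*a. Since r*r + a*a = 1, the
C*-inequality bounds ‖r‖, hence ‖1 - a*a‖. The boundary case t = ‖s‖² follows by a limit. -/
theorem norm_smul_one_sub_star_mul_self_le (s : M) {t : ℝ} (ht : ‖s‖ ^ 2 ≤ t) :
    ‖t • (1 : M) - star s * s‖ ≤ t := by
  have main : ∀ t : ℝ, ‖s‖ ^ 2 < t → ‖t • (1 : M) - star s * s‖ ≤ t := by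
    intro t ht
    have ht0 : 0 < t := (sq_nonneg _).trans_lt ht
    have hst : √t⁻¹ * √t⁻¹ = t⁻¹ := Real.mul_self_sqrt (inv_nonneg.2 ht0.le)
    set a := √t⁻¹ • s with ha
    have haa : star a * a = t⁻¹ • (star s * s) := by
      rw [ha, star_smul, star_trivial, smul_mul_smul_comm, hst]
    have hy1 : ‖star a * a‖ < 1 := by
      rw [haa, norm_smul, CStarRing.norm_star_mul_self, Real.norm_of_nonneg (inv_nonneg.2 ht0.le),
        ← sq, inv_mul_lt_iff₀ ht0, mul_one]
      exact ht
    obtain ⟨r, hr, hrr⟩ := exists_sqrt_one_sub (y := star a * a) (by simp) hy1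
    have h1 := IsCStar.norm_sq_le r a
    rw [hr, hrr, sub_add_cancel] at h1
    have h2 : ‖1 - star a * a‖ ≤ 1 := by
      rw [← hrr]
      exact (norm_mul_le _ _).trans (by rw [← sq]; exact h1.trans norm_one_le_one)
    have e : t • (1 : M) - star s * s = t • (1 - star a * a) := by
      rw [haa, smul_sub, smul_smul, mul_inv_cancel₀ ht0.ne', one_smul]
    rw [e, norm_smul, Real.norm_of_nonneg ht0.le]
    nlinarith
  refine le_of_forall_pos_le_add fun ε hε => ?_
  have h := main (t + ε / 2) (by linarith)
  have e : t • (1 : M) - star s * s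
      = ((t + ε / 2) • (1 : M) - star s * s) - (ε / 2) • (1 : M) := by
    rw [add_smul]; abel
  rw [e]
  refine (norm_sub_le _ _).trans ?_
  rw [norm_smul, Real.norm_of_nonneg (by linarith)]
  have := norm_one_le_one (M := M)
  nlinarith

theorem IsPosElt.star_mul_self (s : M) : IsPosElt (star s * s) :=
  ⟨by simp, ‖s‖ ^ 2, sq_nonneg _, norm_smul_one_sub_star_mul_self_le s le_rfl⟩

theorem IsPosElt.mul_self {s : M} (hs : star s = s) : IsPosElt (s * s) := by
  have := IsPosElt.star_mul_self s
  rwa [hs] at this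

/-- T + ε = (t + ε)(1 - y) with y = (t + ε)⁻¹(t - T). The shift by `ε` makes ‖y‖ < 1, where the
fixed point construction of roots applies. -/
theorem IsPosElt.exists_sqrt {T : M} (hT : IsPosElt T) {ε : ℝ} (hε : 0 < ε) :
    ∃ s : M, star s = s ∧ s * s = T + ε • (1 : M) := by
  obtain ⟨hT, t, ht, ht'⟩ := hT
  have hte : 0 < t + ε := by linarith
  obtain ⟨s, hs, hss⟩ := exists_sqrt_one_sub (y := (t + ε)⁻¹ • (t • (1 : M) - T))
    (by simp [hT]) (by
      rw [norm_smul, Real.norm_of_nonneg (inv_nonneg.2 hte.le), inv_mul_lt_iff₀ hte]; linarith)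
  refine ⟨√(t + ε) • s, by rw [star_smul, star_trivial, hs], ?_⟩
  rw [smul_mul_smul_comm, Real.mul_self_sqrt hte.le, hss, smul_sub, smul_smul,
    mul_inv_cancel₀ hte.ne', one_smul, add_smul]
  abel

/-- The witness in `IsPosElt` is immaterial: T + ε is a square s², so the bound for squares applies
at every scalar above ‖s‖². -/
theorem IsPosElt.norm_smul_one_sub_le {T : M} (hT : IsPosElt T) {t : ℝ} (ht : ‖T‖ ≤ t) :
    ‖t • (1 : M) - T‖ ≤ t := by
  refine le_of_forall_pos_le_add fun ε hε => ?_
  obtain ⟨s, hs, hss⟩ := hT.exists_sqrt hε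
  have h1 : ‖s‖ ^ 2 ≤ t + ε := by
    rw [← norm_sq_star_self hs, hss]
    refine (norm_add_le _ _).trans (add_le_add ht ?_)
    rw [norm_smul, Real.norm_of_nonneg hε.le]
    have := norm_one_le_one (M := M)
    nlinarith
  have h2 := norm_smul_one_sub_star_mul_self_le s h1
  rw [hs, hss] at h2
  have e : (t + ε) • (1 : M) - (T + ε • (1 : M)) = t • (1 : M) - T := by
    rw [add_smul]; abel
  rwa [e] at h2

/-- Up to small multiples of 1, both T and U - T are squares of self-adjoint elements, so
monotonicity of the norm is the C*-inequality. -/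
theorem IsPosElt.norm_le {T U : M} (hT : IsPosElt T) (hU : IsPosElt (U - T)) : ‖T‖ ≤ ‖U‖ := by
  refine le_of_forall_pos_le_add fun ε hε => ?_
  obtain ⟨s, hs, hss⟩ := hT.exists_sqrt (ε := ε / 3) (by linarith)
  obtain ⟨r, hr, hrr⟩ := hU.exists_sqrt (ε := ε / 3) (by linarith)
  have h := IsCStar.norm_sq_le s r
  rw [hs, hr, hss, hrr, ← norm_sq_star_self hs, hss] at h
  have h1 : ‖(ε / 3) • (1 : M)‖ ≤ ε / 3 := by
    rw [norm_smul, Real.norm_of_nonneg (by linarith)]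
    have := norm_one_le_one (M := M)
    nlinarith
  have h2 : ‖T‖ ≤ ‖T + (ε / 3) • (1 : M)‖ + ‖(ε / 3) • (1 : M)‖ := by
    conv_lhs => rw [← add_sub_cancel_right T ((ε / 3) • (1 : M))]
    exact norm_sub_le _ _
  have h3 : T + (ε / 3) • (1 : M) + (U - T + (ε / 3) • (1 : M))
      = U + ((ε / 3) • (1 : M) + (ε / 3) • (1 : M)) := by abel
  rw [h3] at h
  have h4 := (norm_add_le U ((ε / 3) • (1 : M) + (ε / 3) • (1 : M)))
  have h5 := norm_add_le ((ε / 3) • (1 : M)) ((ε / 3) • (1 : M))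
  linarith

/-- With s² = T + δ one has c*Tc = (sc)*(sc) - δc*c. Both squares obey the norm bound for squares,
and the second is negligible. -/
theorem IsPosElt.conj {T : M} (hT : IsPosElt T) (c : M) : IsPosElt (star c * T * c) := by
  refine ⟨by simp [hT.1, mul_assoc], ‖c‖ ^ 2 * ‖T‖, by positivity, ?_⟩
  refine le_of_forall_pos_le_add fun ε hε => ?_
  set δ : ℝ := ε / (2 * (‖c‖ ^ 2 + 1)) with hδ
  have hδ0 : 0 < δ := by positivity
  have hδ1 : δ * ‖c‖ ^ 2 ≤ ε / 2 := by
    rw [hδ, div_mul_eq_mul_div, div_le_div_iff₀ (by positivity) (by norm_num)]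
    nlinarith
  obtain ⟨s, hs, hss⟩ := hT.exists_sqrt hδ0
  have h1 : ‖s * c‖ ^ 2 ≤ ‖c‖ ^ 2 * ‖T‖ + ε / 2 := by
    have h2 : ‖s‖ ^ 2 ≤ ‖T‖ + δ := by
      rw [← norm_sq_star_self hs, hss]
      refine (norm_add_le _ _).trans (add_le_add le_rfl ?_)
      rw [norm_smul, Real.norm_of_nonneg hδ0.le]
      have := norm_one_le_one (M := M)
      nlinarith
    calc ‖s * c‖ ^ 2 ≤ (‖s‖ * ‖c‖) ^ 2 := by gcongr; exact norm_mul_le _ _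
      _ = ‖s‖ ^ 2 * ‖c‖ ^ 2 := by ring
      _ ≤ (‖T‖ + δ) * ‖c‖ ^ 2 := by gcongr
      _ ≤ _ := by linarith
  have h3 := norm_smul_one_sub_star_mul_self_le (s * c) h1
  have e1 : star (s * c) * (s * c) = star c * T * c + δ • (star c * c) := by
    rw [star_mul, hs, mul_assoc, ← mul_assoc s s c, hss, add_mul, mul_add, smul_mul_assoc, one_mul,
      mul_smul_comm, mul_assoc]
  have e2 : (‖c‖ ^ 2 * ‖T‖) • (1 : M) - star c * T * c
      = ((‖c‖ ^ 2 * ‖T‖ + ε / 2) • (1 : M) - star (s * c) * (s * c))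
        - ((ε / 2) • (1 : M) - star (√δ • c) * (√δ • c)) := by
    rw [e1, add_smul, star_smul, star_trivial √δ, smul_mul_smul_comm, Real.mul_self_sqrt hδ0.le]
    abel
  have h4 : ‖√δ • c‖ ^ 2 ≤ ε / 2 := by
    rw [norm_smul, mul_pow, Real.norm_of_nonneg (Real.sqrt_nonneg _), Real.sq_sqrt hδ0.le]
    exact hδ1
  rw [e2]
  refine (norm_sub_le _ _).trans ((add_le_add h3 (norm_smul_one_sub_star_mul_self_le _ h4)).trans ?_)
  linarith

theorem norm_le_one_of_isPosElt {T : M} (hT : IsPosElt T) (hT' : IsPosElt (1 - T)) : ‖T‖ ≤ 1 :=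
  (hT.norm_le hT').trans norm_one_le_one

theorem isPosElt_one_sub_mul_self {s : M} (hs : star s = s) (h1 : ‖s‖ ≤ 1) :
    IsPosElt (1 - s * s) := by
  refine ⟨by simp [hs], 1, zero_le_one, ?_⟩
  rw [one_smul, sub_sub_cancel]
  exact (norm_mul_le _ _).trans (mul_le_one₀ h1 (norm_nonneg _) h1)

/-- Approximate units: a closed `*`-subalgebra `I` contains, for finitely many `x ∈ I`, a
self-adjoint contraction that almost fixes them. -/
theorem exists_approx_unit (I : NonUnitalSubalgebra ℝ M) (hI : IsClosed (I : Set M))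
    (hstar : ∀ x ∈ I, star x ∈ I) (s : Finset M) (hs : ∀ x ∈ s, x ∈ I) {ε : ℝ} (hε : 0 < ε) :
    ∃ e ∈ I, star e = e ∧ ‖e‖ ≤ 1 ∧ ∀ x ∈ s, ‖x - e * x‖ ≤ ε := by
  set h : M := ∑ x ∈ s, x * star x with hh
  have hhI : h ∈ I := sum_mem fun x hx => I.mul_mem (hs x hx) (hstar x (hs x hx))
  have hxx : ∀ x : M, IsPosElt (x * star x) := fun x => by
    simpa using IsPosElt.star_mul_self (star x)
  have hhp : IsPosElt h := IsPosElt.sum fun x _ => hxx x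
  set l : ℝ := (ε ^ 2)⁻¹ with hl
  have hl0 : 0 < l := by positivity
  set t : ℝ := ‖h‖ with ht
  have ht0 : 0 ≤ t := norm_nonneg h
  have hlt : 0 < 1 + l * t := by positivity
  have hth : ‖t • (1 : M) - h‖ ≤ t := hhp.norm_smul_one_sub_le le_rfl
  -- The desired unit is e = (1 + lh)⁻¹lh, that is e + lhe = lh. Adding lte to both sides makes e a
  -- fixed point of `f`; because ‖t - h‖ ≤ t the Lipschitz constant is lt/(1 + lt) < 1. The fixed
  -- point lies in `I` because `f` preserves the closed set `I`.
  let f : M → M := fun e => (1 + l * t)⁻¹ • (l • h + (l * t) • e - l • (h * e))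
  have hm : Set.MapsTo f I I := fun e he =>
    I.toSubmodule.smul_mem _ (I.toSubmodule.sub_mem (I.add_mem (I.toSubmodule.smul_mem _ hhI)
      (I.toSubmodule.smul_mem _ he)) (I.toSubmodule.smul_mem _ (I.mul_mem hhI he)))
  have hK : (1 + l * t)⁻¹ * (l * t) < 1 := by
    rw [inv_mul_lt_iff₀ hlt]; linarith
  have hK0 : 0 ≤ (1 + l * t)⁻¹ * (l * t) := by positivity
  have hc : ContractingWith ((1 + l * t)⁻¹ * (l * t)).toNNReal (hm.restrict f I I) := by
    refine ⟨by rwa [Real.toNNReal_lt_one], LipschitzWith.of_dist_le_mul ?_⟩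
    rintro ⟨e, -⟩ ⟨e', -⟩
    change dist (f e) (f e') ≤ ((1 + l * t)⁻¹ * (l * t)).toNNReal * dist e e'
    rw [Real.coe_toNNReal _ hK0]
    have e1 : f e - f e' = ((1 + l * t)⁻¹ * l) • ((t • (1 : M) - h) * (e - e')) := by
      simp only [f, sub_mul, smul_mul_assoc, one_mul, mul_sub]
      module
    rw [dist_eq_norm, dist_eq_norm, e1, norm_smul, Real.norm_of_nonneg (by positivity)]
    calc (1 + l * t)⁻¹ * l * ‖(t • (1 : M) - h) * (e - e')‖
        ≤ (1 + l * t)⁻¹ * l * (t * ‖e - e'‖) := by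
          gcongr
          exact (norm_mul_le _ _).trans (by gcongr)
      _ = _ := by ring
  obtain ⟨e, heI, hfix, -⟩ :=
    hc.exists_fixedPoint' hI.isComplete hm (x := 0) I.zero_mem (edist_ne_top _ _)
  have he : e + l • (h * e) = l • h := by
    have h1 : (1 + l * t)⁻¹ • (l • h + (l * t) • e - l • (h * e)) = e := hfix
    have h2 : l • h + (l * t) • e - l • (h * e) = (1 + l * t) • e := by
      conv_rhs => rw [← h1]
      rw [smul_smul, mul_inv_cancel₀ hlt.ne', one_smul]
    rw [add_smul, one_smul, sub_eq_iff_eq_add] at h2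
    have h3 : l • h + (l * t) • e = (e + l • (h * e)) + (l * t) • e := by rw [h2]; abel
    exact (add_right_cancel h3).symm
  set r : M := 1 - e with hr
  have hright : (1 + l • h) * r = 1 := by
    rw [hr, mul_sub, mul_one, add_mul, one_mul, smul_mul_assoc, he]; abel
  have hleft : star r * (1 + l • h) = 1 := by
    have := congrArg star hright
    rwa [star_mul, star_add, star_one, star_smul, star_trivial l, hhp.1] at this
  have hrs : star r = r := by
    calc star r = star r * ((1 + l • h) * r) := by rw [hright, mul_one]
      _ = r := by rw [← mul_assoc, hleft, one_mul]
  -- Here r = (1 + lh)⁻¹. The identity shows r ≥ 0 and r² ≤ r, hence ‖r‖ ≤ 1.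
  have hrr : r = r * r + l • (r * h * r) := by
    calc r = r * ((1 + l • h) * r) := by rw [hright, mul_one]
      _ = _ := by rw [add_mul, one_mul, mul_add, smul_mul_assoc, mul_smul_comm, mul_assoc]
  have hp1 : IsPosElt (r * r) := IsPosElt.mul_self hrs
  have hp2 : IsPosElt (r * h * r) := by
    have := hhp.conj r
    rwa [hrs] at this
  have hp : IsPosElt r := by
    rw [hrr]; exact hp1.add (hp2.smul hl0.le)
  have hr1 : ‖r‖ ≤ 1 := by
    have h1 : ‖r * r‖ ≤ ‖r‖ := hp1.norm_le (by
      conv => enter [1, 1]; rw [hrr]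
      rw [add_sub_cancel_left]; exact hp2.smul hl0.le)
    rw [norm_sq_star_self hrs] at h1
    by_contra h2
    push Not at h2
    nlinarith
  have her : e = 1 - r := by rw [hr, sub_sub_cancel]
  refine ⟨e, heI, by rw [her, star_sub, star_one, hrs], ?_, fun x hx => ?_⟩
  · have := hp.norm_smul_one_sub_le hr1
    rwa [one_smul, ← her] at this
  · have e1 : x - e * x = r * x := by rw [her, sub_mul, one_mul, sub_sub_cancel]
    rw [e1]
    have hxh : IsPosElt (h - x * star x) := by
      classical
      rw [hh, ← Finset.add_sum_erase s _ hx, add_sub_cancel_left]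
      exact IsPosElt.sum fun x _ => hxx x
    have h1 : IsPosElt (r * (x * star x) * r) := by
      have := (hxx x).conj r
      rwa [hrs] at this
    -- Since xx* ≤ h, also l·r xx* r ≤ l·r h r ≤ r. As l = ε⁻², this says ‖rx‖² ≤ ε².
    have h2 : ‖l • (r * (x * star x) * r)‖ ≤ ‖r‖ := by
      refine (h1.smul hl0.le).norm_le ?_
      have e2 : r - l • (r * (x * star x) * r) = r * r + l • (r * (h - x * star x) * r) := by
        have e4 : r * (h - x * star x) * r = r * h * r - r * (x * star x) * r := by
          rw [mul_sub r, sub_mul _ _ r]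
        rw [e4, smul_sub, add_sub, ← hrr]
      rw [e2]
      have := hxh.conj r
      rw [hrs] at this
      exact hp1.add (this.smul hl0.le)
    have e3 : r * (x * star x) * r = (r * x) * star (r * x) := by
      rw [star_mul, hrs]; noncomm_ring
    rw [norm_smul, Real.norm_of_nonneg hl0.le, e3, CStarRing.norm_self_mul_star, hl,
      inv_mul_le_iff₀ (by positivity)] at h2
    have h3 : ‖r * x‖ * ‖r * x‖ ≤ ε ^ 2 := by nlinarith [sq_nonneg ε]
    exact le_of_sq_le_sq (by rw [sq]; exact h3) hε.le

end Positive

/-! ### Quasicentral and invariant approximate units -/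

section ApproxUnit

variable {R : Type*} [NonUnitalNormedRing R] [StarRing R] [NormedSpace ℝ R]
  [IsScalarTower ℝ R R] [SMulCommClass ℝ R R]

/-- If `u` and `c` are almost orthogonal, squares of norms almost add. A sum of n almost orthogonal
bounded terms therefore grows only like √n. -/
theorem norm_add_sq_le_of_star_mul [CStarRing R] (u c : R) :
    ‖u + c‖ ^ 2 ≤ ‖u‖ ^ 2 + 2 * ‖star u * c‖ + ‖c‖ ^ 2 := by
  have h1 : ‖star c * u‖ = ‖star u * c‖ := by
    rw [← norm_star (star c * u), star_mul, star_star]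
  have e : star (u + c) * (u + c) = star u * u + star u * c + star c * u + star c * c := by
    rw [star_add]; noncomm_ring
  have h2 : ‖star (u + c) * (u + c)‖ ≤
      ‖star u * u‖ + ‖star u * c‖ + ‖star c * u‖ + ‖star c * c‖ := by
    rw [e]
    exact norm_add₄_le
  rw [CStarRing.norm_star_mul_self, CStarRing.norm_star_mul_self, CStarRing.norm_star_mul_self,
    h1] at h2
  nlinarith

/-- If a convex set `P` of self-adjoint contractions in an ideal `I` contains an approximate unit of
`I`, then it contains one that is quasicentral. -/
theorem exists_quasicentral [CStarRing R] [StarModule ℝ R] (I : NonUnitalSubalgebra ℝ R)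
    (hl : ∀ a, ∀ x ∈ I, a * x ∈ I) (hr : ∀ a, ∀ x ∈ I, x * a ∈ I)
    {P : Set R} (hP : Convex ℝ P) (hPI : P ⊆ I) (hP1 : ∀ e ∈ P, star e = e ∧ ‖e‖ ≤ 1)
    (hAU : ∀ s : Finset R, (∀ x ∈ s, x ∈ I) → ∀ ε : ℝ, 0 < ε → ∃ e ∈ P, ∀ x ∈ s, ‖x - e * x‖ ≤ ε)
    (s m : Finset R) (hs : ∀ x ∈ s, x ∈ I) {ε : ℝ} (hε : 0 < ε) :
    ∃ e ∈ P, (∀ x ∈ s, ‖x - e * x‖ ≤ ε) ∧ ∀ a ∈ m, ‖e * a - a * e‖ ≤ ε := by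
  classical
  obtain ⟨B, hB0, hB⟩ : ∃ B : ℝ, 0 ≤ B ∧ ∀ a ∈ m, ‖a‖ ≤ B :=
    ⟨∑ a ∈ m, ‖a‖, Finset.sum_nonneg fun _ _ => norm_nonneg _,
      fun a ha => Finset.single_le_sum (f := fun a => ‖a‖) (fun _ _ => norm_nonneg _) ha⟩
  -- 4B² bounds the square of a single commutator, and the 2 absorbs the cross term in each
  -- averaging step.
  set D : ℝ := 4 * B ^ 2 + 2 with hD
  have hcomm : ∀ e ∈ P, ∀ a ∈ m, ‖e * a - a * e‖ ≤ 2 * B := by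
    intro e he a ha
    have h1 := (hP1 e he).2
    have h2 := hB a ha
    refine (norm_sub_le _ _).trans ((add_le_add (norm_mul_le _ _) (norm_mul_le _ _)).trans ?_)
    nlinarith [norm_nonneg e, norm_nonneg a]
  -- Elements of `P` are averaged one at a time. Each new `f` is such that [f, a] is almost
  -- orthogonal to the commutator of the previous average, so the squared norm of the sum grows
  -- linearly and that of the average decays like 1/n.
  have key : ∀ n : ℕ, ∃ e ∈ P, (∀ x ∈ s, ‖x - e * x‖ ≤ ε) ∧
      ∀ a ∈ m, (n + 1) * ‖e * a - a * e‖ ^ 2 ≤ D := by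
    intro n
    induction n with
    | zero =>
      obtain ⟨e, he, hes⟩ := hAU s hs ε hε
      refine ⟨e, he, hes, fun a ha => ?_⟩
      have h1 := pow_le_pow_left₀ (norm_nonneg _) (hcomm e he a ha) 2
      push_cast
      rw [hD]; nlinarith
    | succ n ih =>
      obtain ⟨e, he, hes, hem⟩ := ih
      -- Chosen so that δ + δB = 1/(n + 1), the tolerance for the cross term.
      set δ : ℝ := ((B + 1) * (n + 1))⁻¹ with hδ
      have hδ0 : 0 < δ := by positivity
      have heI := hPI he
      have hcI : ∀ a, e * a - a * e ∈ I := fun a =>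
        I.toSubmodule.sub_mem (hr a e heI) (hl a e heI)
      -- With C = [e, a], the product C*[f, a] equals (a*C - fa*C)* - (C - fC)*a. It is small once
      -- `f` almost fixes both C and a*C, and these lie in the ideal.
      obtain ⟨f, hf, hfs⟩ := hAU (s ∪ (m.image (fun a => e * a - a * e) ∪
          m.image (fun a => star a * (e * a - a * e)))) (by
        intro x hx
        rcases Finset.mem_union.1 hx with hx | hx
        · exact hs x hx
        rcases Finset.mem_union.1 hx with hx | hx
        · obtain ⟨a, -, rfl⟩ := Finset.mem_image.1 hx
          exact hcI a
        · obtain ⟨a, -, rfl⟩ := Finset.mem_image.1 hx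
          exact hl _ _ (hcI a)) (min ε δ) (lt_min hε hδ0)
      have hn : (0 : ℝ) < n + 1 + 1 := by positivity
      have hn1 : (0 : ℝ) < n + 1 := by positivity
      set θ : ℝ := (n + 1 + 1 : ℝ)⁻¹ with hθ
      have hθ0 : 0 < θ := inv_pos.2 hn
      have hθ1 : θ * (n + 1 + 1) = 1 := inv_mul_cancel₀ hn.ne'
      have hθ2 : θ * (n + 1) + θ = 1 := by linarith
      refine ⟨(θ * (n + 1)) • e + θ • f, hP he hf (by positivity) hθ0.le hθ2, fun x hx => ?_,
        fun a ha => ?_⟩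
      · have h1 := hes x hx
        have h2 := (hfs x (Finset.mem_union_left _ hx)).trans (min_le_left _ _)
        have e1 : x - ((θ * (n + 1)) • e + θ • f) * x
            = (θ * (n + 1)) • (x - e * x) + θ • (x - f * x) := by
          rw [add_mul, smul_mul_assoc, smul_mul_assoc]
          conv_lhs => enter [1]; rw [← one_smul ℝ x, ← hθ2]
          module
        rw [e1]
        refine (norm_add_le _ _).trans ?_
        rw [norm_smul, norm_smul, Real.norm_of_nonneg hθ0.le, Real.norm_of_nonneg (by positivity)]
        calc θ * (n + 1) * ‖x - e * x‖ + θ * ‖x - f * x‖ ≤ θ * (n + 1) * ε + θ * ε := by gcongr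
          _ = ε := by rw [← add_mul, hθ2, one_mul]
      · set C := e * a - a * e with hC
        set c := f * a - a * f with hc
        have e1 : ((θ * (n + 1)) • e + θ • f) * a - a * ((θ * (n + 1)) • e + θ • f)
            = θ • ((n + 1 : ℝ) • C + c) := by
          rw [hC, hc, add_mul, mul_add a, smul_mul_assoc, smul_mul_assoc, mul_smul_comm,
            mul_smul_comm]
          module
        have hf1 : ‖C - f * C‖ ≤ δ := (hfs C (by
          refine Finset.mem_union_right _ (Finset.mem_union_left _ ?_)
          exact Finset.mem_image.2 ⟨a, ha, rfl⟩)).trans (min_le_right _ _)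
        have hf2 : ‖star a * C - f * (star a * C)‖ ≤ δ := (hfs _ (by
          refine Finset.mem_union_right _ (Finset.mem_union_right _ ?_)
          exact Finset.mem_image.2 ⟨a, ha, rfl⟩)).trans (min_le_right _ _)
        have hfstar := (hP1 f hf).1
        have e2 : ∀ C : R, star C * (f * a - a * f)
            = star (star a * C - f * (star a * C)) - star (C - f * C) * a := by
          intro C
          simp only [star_sub, star_mul, star_star, hfstar]
          noncomm_ring
        have h3 : ‖star C * c‖ ≤ (n + 1 : ℝ)⁻¹ := by
          rw [hc, e2]
          calc _ ≤ δ + δ * B := by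
                refine (norm_sub_le _ _).trans (add_le_add (by rwa [norm_star]) ?_)
                refine (norm_mul_le _ _).trans ?_
                rw [norm_star]
                exact mul_le_mul hf1 (hB a ha) (norm_nonneg _) hδ0.le
            _ = (n + 1 : ℝ)⁻¹ := by rw [hδ]; field_simp; ring
        have h4 := norm_add_sq_le_of_star_mul ((n + 1 : ℝ) • C) c
        rw [star_smul, star_trivial (n + 1 : ℝ), smul_mul_assoc, norm_smul, norm_smul,
          Real.norm_of_nonneg hn1.le] at h4
        have h5 : (n + 1 : ℝ) * ‖star C * c‖ ≤ 1 := by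
          calc _ ≤ (n + 1 : ℝ) * (n + 1 : ℝ)⁻¹ := by gcongr
            _ = 1 := mul_inv_cancel₀ hn1.ne'
        have h6 := pow_le_pow_left₀ (norm_nonneg _) (hcomm f hf a ha) 2
        rw [← hc] at h6
        have h7 := mul_le_mul_of_nonneg_left (hem a ha) hn1.le
        rw [e1, norm_smul, Real.norm_of_nonneg hθ0.le, mul_pow]
        have h8 : ‖(n + 1 : ℝ) • C + c‖ ^ 2 ≤ (n + 1 + 1) * D := by
          rw [hD] at h7 ⊢
          nlinarith
        push_cast
        calc (n + 1 + 1 : ℝ) * (θ ^ 2 * ‖(n + 1 : ℝ) • C + c‖ ^ 2)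
            = θ * (θ * (n + 1 + 1)) * ‖(n + 1 : ℝ) • C + c‖ ^ 2 := by ring
          _ = θ * ‖(n + 1 : ℝ) • C + c‖ ^ 2 := by rw [hθ1, mul_one]
          _ ≤ θ * ((n + 1 + 1) * D) := by gcongr
          _ = (θ * (n + 1 + 1)) * D := by ring
          _ = D := by rw [hθ1, one_mul]
  obtain ⟨n, hn⟩ := exists_nat_gt (D / ε ^ 2)
  obtain ⟨e, he, hes, hem⟩ := key n
  refine ⟨e, he, hes, fun a ha => ?_⟩
  have h1 := hem a ha
  rw [div_lt_iff₀ (by positivity)] at hn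
  refine le_of_sq_le_sq ?_ hε.le
  by_contra h2
  push Not at h2
  have h3 : (0 : ℝ) < n + 1 := by positivity
  have := mul_lt_mul_of_pos_left h2 h3
  nlinarith [sq_nonneg ε]

variable {G : Type*} [Group G] [TopologicalSpace G] [IsTopologicalGroup G] [CompactSpace G]

/-- Averaging over a compact group makes an approximate unit invariant. -/
theorem exists_invariant_approx_unit [NormedStarGroup R] [StarModule ℝ R] [CompleteSpace R]
    (I : NonUnitalSubalgebra ℝ R) (hI : IsClosed (I : Set R)) (α : G → R →L[ℝ] R)
    (hα1 : ∀ x, α 1 x = x) (hαmul : ∀ g h x, α (g * h) x = α g (α h x))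
    (hm : ∀ g x y, α g (x * y) = α g x * α g y) (hst : ∀ g x, α g (star x) = star (α g x))
    (hn : ∀ g x, ‖α g x‖ ≤ ‖x‖) (hαI : ∀ g, ∀ x ∈ I, α g x ∈ I)
    (hc : ∀ x ∈ I, Continuous fun g => α g x)
    (hAU : ∀ s : Finset R, (∀ x ∈ s, x ∈ I) → ∀ ε : ℝ, 0 < ε →
      ∃ e ∈ I, star e = e ∧ ‖e‖ ≤ 1 ∧ ∀ x ∈ s, ‖x - e * x‖ ≤ ε)
    (s : Finset R) (hs : ∀ x ∈ s, x ∈ I) {ε : ℝ} (hε : 0 < ε) :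
    ∃ e ∈ {e | e ∈ I ∧ star e = e ∧ ‖e‖ ≤ 1 ∧ ∀ g, α g e = e}, ∀ x ∈ s, ‖x - e * x‖ ≤ ε := by
  classical
  -- The element to be averaged has to almost fix whole orbits. These are compact, so a finite
  -- ε/3-net suffices.
  have hX : IsCompact (⋃ x ∈ s, Set.range fun g => α g x) :=
    s.isCompact_biUnion fun x hx => isCompact_range (hc x (hs x hx))
  obtain ⟨t, htX, htf, ht⟩ := hX.finite_cover_balls (e := ε / 3) (by linarith)
  have htI : ∀ x ∈ htf.toFinset, x ∈ I := by
    intro x hx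
    obtain ⟨y, hy, g, rfl⟩ := Set.mem_iUnion₂.1 (htX (htf.mem_toFinset.1 hx))
    exact hαI g y (hs y hy)
  obtain ⟨e, heI, hes, he1, het⟩ := hAU htf.toFinset htI (ε / 3) (by linarith)
  have horb : ∀ x ∈ s, ∀ g, ‖α g x - e * α g x‖ ≤ ε := by
    intro x hx g
    obtain ⟨y, hy, hxy⟩ := Set.mem_iUnion₂.1 (ht (Set.mem_biUnion hx ⟨g, rfl⟩))
    rw [Metric.mem_ball, dist_eq_norm] at hxy
    beta_reduce at hxy
    have h1 := het y (htf.mem_toFinset.2 hy)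
    have e1 : α g x - e * α g x = (α g x - y) + (y - e * y) - e * (α g x - y) := by
      rw [mul_sub]; abel
    have h2 : ‖e * (α g x - y)‖ ≤ ε / 3 :=
      (norm_mul_le _ _).trans ((mul_le_of_le_one_left (norm_nonneg _) he1).trans hxy.le)
    rw [e1]
    have h3 := norm_sub_le ((α g x - y) + (y - e * y)) (e * (α g x - y))
    have h4 := norm_add_le (α g x - y) (y - e * y)
    linarith
  let : MeasurableSpace G := borel G
  have : BorelSpace G := ⟨rfl⟩
  let μ : MeasureTheory.Measure G := MeasureTheory.Measure.haarMeasure ⊤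
  have : MeasureTheory.IsProbabilityMeasure μ := ⟨by
    have := MeasureTheory.Measure.haarMeasure_self (G := G) (K₀ := ⊤)
    simpa using this⟩
  have hint : ∀ f : G → R, Continuous f → MeasureTheory.Integrable f μ := fun f hf =>
    hf.integrable_of_hasCompactSupport (HasCompactSupport.of_compactSpace f)
  have hce := hc e heI
  have hi := hint _ hce
  set E : R := ∫ g, α g e ∂μ with hE
  refine ⟨E, ⟨?_, ?_, ?_, fun h => ?_⟩, fun x hx => ?_⟩
  · exact I.toSubmodule.convex.integral_mem hI (Filter.Eventually.of_forall fun g => hαI g e heI) hi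
  · have h1 := (starL' ℝ (A := R)).toContinuousLinearMap.integral_comp_comm hi
    change ∫ g, star (α g e) ∂μ = star E at h1
    rw [← h1]
    simp_rw [← hst, hes]
    rfl
  · refine (MeasureTheory.norm_integral_le_of_norm_le_const
      (Filter.Eventually.of_forall fun g => (hn g e).trans he1)).trans ?_
    simp
  · rw [hE, ← (α h).integral_comp_comm hi]
    simp_rw [← hαmul]
    exact MeasureTheory.integral_mul_left_eq_self (fun g => α g e) h
  · have h1 : x - E * x = ∫ g, (x - α g e * x) ∂μ := by
      have h3 : MeasureTheory.Integrable (fun g => α g e * x) μ :=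
        hint _ (hce.mul continuous_const)
      rw [MeasureTheory.integral_sub (MeasureTheory.integrable_const x) h3]
      have h2 := ((ContinuousLinearMap.mul ℝ R).flip x).integral_comp_comm hi
      change ∫ g, α g e * x ∂μ = E * x at h2
      rw [h2]; simp
    rw [h1]
    refine (MeasureTheory.norm_integral_le_of_norm_le_const (C := ε)
      (Filter.Eventually.of_forall fun g => ?_)).trans (by simp)
    -- Translation by g turns the error of α_g(e) at x into that of e at g⁻¹x, a point of the orbit.
    have e1 : x - α g e * x = α g (α g⁻¹ x - e * α g⁻¹ x) := by
      rw [map_sub, hm, ← hαmul, mul_inv_cancel, hα1]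
    rw [e1]
    exact (hn _ _).trans (horb x hx g⁻¹)

theorem convex_invariant_contractions [NormedStarGroup R] [StarModule ℝ R]
    (I : NonUnitalSubalgebra ℝ R) (α : G → R →L[ℝ] R) :
    Convex ℝ {e | e ∈ I ∧ star e = e ∧ ‖e‖ ≤ 1 ∧ ∀ g, α g e = e} := by
  rintro e ⟨heI, hes, he1, heg⟩ f ⟨hfI, hfs, hf1, hfg⟩ a b ha hb hab
  refine ⟨I.add_mem (I.toSubmodule.smul_mem _ heI) (I.toSubmodule.smul_mem _ hfI), ?_, ?_,
    fun g => ?_⟩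
  · rw [star_add, star_smul, star_smul, hes, hfs, star_trivial a, star_trivial b]
  · refine (norm_add_le _ _).trans ?_
    rw [norm_smul, norm_smul, Real.norm_of_nonneg ha, Real.norm_of_nonneg hb]
    nlinarith
  · rw [map_add, map_smul, map_smul, heg, hfg]

end ApproxUnit

/-! ### Automatic contractivity -/

section Contractive

/-- Formally b = 1 - √(1 - a*a), but b lies in the non-unital algebra. The relation 2b - b² = a*a
survives every `*`-homomorphism and yields contractivity without spectra. -/
theorem exists_add_sub_sq_eq_star_mul_self (k : Type*) [RCLike k] {A : Type*}
    [NonUnitalNormedRing A] [StarRing A] [NormedSpace k A] [IsScalarTower k A A]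
    [SMulCommClass k A A] [CompleteSpace A] [CStarRing A] {a : A} (ha : ‖a‖ < 1) :
    ∃ b : A, star b = b ∧ b + b - b * b = star a * a := by
  let : NormedSpace ℝ A := NormedSpace.restrictScalars ℝ k A
  have : IsScalarTower ℝ A A := ⟨fun c x y => smul_mul_assoc (c : k) x y⟩
  have : SMulCommClass ℝ A A := ⟨fun c x y => (mul_smul_comm (c : k) x y).symm⟩
  have h1 : ‖star a * a‖ < 1 := by
    rw [CStarRing.norm_star_mul_self]; nlinarith [norm_nonneg a]
  obtain ⟨b, -, hb, hbr⟩ := exists_add_sub_sq_eq (R := A) ⊤ isClosed_univ trivial h1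
  have hs : 0 < √(1 - ‖star a * a‖) := Real.sqrt_pos.2 (by linarith)
  exact ⟨b, star_eq_of_add_sub_sq_eq (by linarith) hb hbr (by simp), hb⟩

theorem norm_le_of_forall_lt_scale {k : Type*} [RCLike k] {A : Type*} [NormedAddCommGroup A]
    [NormedSpace k A] {f : A → ℝ} (hf : ∀ (t : ℝ) a, 0 < t → f ((t : k) • a) = t * f a)
    (h1 : ∀ a, ‖a‖ < 1 → f a ≤ 1) (a : A) : f a ≤ ‖a‖ := by
  refine le_of_forall_pos_le_add fun ε hε => ?_
  have ht : 0 < ‖a‖ + ε := by positivity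
  have h2 := h1 ((((‖a‖ + ε)⁻¹ : ℝ) : k) • a) (by
    rw [norm_smul, RCLike.norm_ofReal, abs_of_pos (inv_pos.2 ht), inv_mul_lt_iff₀ ht]; linarith)
  rw [hf _ _ (inv_pos.2 ht), inv_mul_le_iff₀ ht, mul_one] at h2
  exact h2

variable {k : Type uk} {G : Type uG} {B : Type uB} [RCLike k] [Group G]
    [TopologicalSpace G] [NonUnitalNormedRing B] [StarRing B] [NormedSpace k B]
    [DistribMulAction G B] [IsScalarTower k B B] [SMulCommClass k B B] [CompleteSpace B]
    [IsCStar B]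

/-- For ‖a‖ < 1 put c = ga and d = gb with 2b - b² = a*a. Then c(c*c)c* + c(1 - d)²c* = cc*, so the
C*-inequality gives ‖c‖⁴ ≤ ‖c‖² and hence ‖c‖ ≤ 1. -/
theorem IsGAlgebra.norm_smul_le (k : Type uk) {G : Type uG} {B : Type uB} [RCLike k] [Group G]
    [TopologicalSpace G] [NonUnitalNormedRing B] [StarRing B] [NormedSpace k B]
    [DistribMulAction G B] [IsScalarTower k B B] [SMulCommClass k B B] [CompleteSpace B]
    [IsCStar B] [IsGAlgebra k G B] (g : G) (b : B) : ‖g • b‖ ≤ ‖b‖ := by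
  refine norm_le_of_forall_lt_scale (k := k) (f := fun b : B => ‖g • b‖) (fun t a ht => ?_)
    (fun a ha => ?_) b
  · change ‖g • (t : k) • a‖ = t * ‖g • a‖
    rw [IsGAlgebra.smul_comm, norm_smul, RCLike.norm_ofReal, abs_of_pos ht]
  · obtain ⟨b, hb, hba⟩ := exists_add_sub_sq_eq_star_mul_self k ha
    set c := g • a with hc
    set d := g • b with hd
    have hdd : star d = d := by rw [hd, ← IsGAlgebra.smul_star k, hb]
    have hdc : d + d - d * d = star c * c := by
      rw [hc, ← IsGAlgebra.smul_star k, ← IsGAlgebra.smul_mul k g (star a) a, ← hba, smul_sub, smul_add,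
        IsGAlgebra.smul_mul k]
    have h1 := IsCStar.norm_sq_le (c * star c) (star c - d * star c)
    have h2 : star (c * star c) * (c * star c) +
        star (star c - d * star c) * (star c - d * star c) = star (star c) * star c := by
      have e : star (c * star c) * (c * star c) = c * (star c * c) * star c := by
        rw [star_mul, star_star]; noncomm_ring
      rw [e, ← hdc, star_sub, star_mul, hdd, star_star]
      noncomm_ring
    rw [h2, CStarRing.norm_star_mul_self, CStarRing.norm_self_mul_star, norm_star] at h1
    by_contra h3
    push Not at h3
    have h4 : 1 < ‖c‖ * ‖c‖ := by nlinarith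
    nlinarith

namespace HilbertModule

variable [StarModule k B]

theorem inner_sub_left (E : HilbertModule.{uk, uG, uB, uE} k G B) (x y z : E) :
    E.inner (x - y) z = E.inner x z - E.inner y z := by
  rw [← E.star_inner, E.inner_sub, star_sub, E.star_inner, E.star_inner]

theorem norm_sq_le_add {E F : HilbertModule.{uk, uG, uB, uE} k G B} (x : E) (y : F) :
    ‖x‖ ^ 2 ≤ ‖E.inner x x + F.inner y y‖ := by
  obtain ⟨p, hp⟩ := E.inner_self x
  obtain ⟨q, hq⟩ := F.inner_self y
  rw [E.norm_sq, hp, hq, CStarRing.norm_star_mul_self, ← sq]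
  exact IsCStar.norm_sq_le p q

/-- A `*`-homomorphism from a C*-algebra to adjointable operators is contractive. -/
theorem norm_hom_le {A : Type uA} [NonUnitalNormedRing A] [StarRing A] [NormedSpace k A]
    [IsScalarTower k A A] [SMulCommClass k A A] [CompleteSpace A] [CStarRing A]
    {E : HilbertModule.{uk, uG, uB, uE} k G B} (φ : A →ₙₐ[k] (E →L[k] E))
    (hφ : ∀ a, IsAdj (φ a) (φ (star a))) (a : A) : ‖φ a‖ ≤ ‖a‖ := by
  refine norm_le_of_forall_lt_scale (k := k) (f := fun a : A => ‖φ a‖) (fun t a ht => ?_)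
    (fun a ha => ?_) a
  · change ‖φ ((t : k) • a)‖ = t * ‖φ a‖
    rw [map_smul, norm_smul, RCLike.norm_ofReal, abs_of_pos ht]
  · obtain ⟨b, hb, hba⟩ := exists_add_sub_sq_eq_star_mul_self k ha
    refine ContinuousLinearMap.opNorm_le_bound _ zero_le_one fun x => ?_
    rw [one_mul]
    have h1 := norm_sq_le_add (φ a x) (x - φ b x)
    have h2 : E.inner (φ a x) (φ a x) = E.inner x (φ b x) + E.inner x (φ b x)
        - E.inner x (φ b (φ b x)) := by
      rw [hφ, ← mul_apply_eq_comp, ← map_mul, ← hba, map_sub, map_add, map_mul,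
        sub_apply, add_apply, E.inner_sub, E.inner_add]
      rfl
    have h3 : ∀ y, E.inner (φ b x) y = E.inner x (φ b y) := fun y => by rw [hφ, hb]
    -- This is φ(a*a) + (1 - φ(b))² = 1, evaluated at the vector x.
    have h4 : E.inner (φ a x) (φ a x) + E.inner (x - φ b x) (x - φ b x) = E.inner x x := by
      rw [h2, inner_sub_left, E.inner_sub, E.inner_sub, h3, h3]
      abel
    rw [h4, ← E.norm_sq] at h1
    exact le_of_sq_le_sq h1 (norm_nonneg _)

/-! ### The C*-algebra of adjointable operators -/

theorem continuous_inner_left (E : HilbertModule.{uk, uG, uB, uE} k G B) (y : E) :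
    Continuous fun x => E.inner x y := by
  refine (LipschitzWith.of_dist_le_mul (K := ‖y‖₊) fun x x' => ?_).continuous
  rw [dist_eq_norm, dist_eq_norm, ← inner_sub_left, mul_comm]
  exact norm_inner_le _ _

theorem continuous_inner_right (E : HilbertModule.{uk, uG, uB, uE} k G B) (x : E) :
    Continuous fun y => E.inner x y := by
  refine (LipschitzWith.of_dist_le_mul (K := ‖x‖₊) fun y y' => ?_).continuous
  rw [dist_eq_norm, dist_eq_norm, ← inner_sub]
  exact norm_inner_le _ _

variable (E F : HilbertModule.{uk, uG, uB, uE} k G B)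

/-- The adjointable operators on `E`. -/
def adjointable : Subalgebra k (E →L[k] E) where
  carrier := {T | ∃ S, IsAdj T S}
  mul_mem' := by
    rintro T T' ⟨S, h⟩ ⟨S', h'⟩
    exact ⟨S' ∘L S, h'.comp h⟩
  add_mem' := by
    rintro T T' ⟨S, h⟩ ⟨S', h'⟩
    exact ⟨S + S', h.add h'⟩
  algebraMap_mem' c := by
    refine ⟨star c • ContinuousLinearMap.id k E, ?_⟩
    have h : IsAdj (ContinuousLinearMap.id k E) (ContinuousLinearMap.id k E) := fun _ _ => rfl
    exact h.smul c

/-- The adjointable operators on `E`, as a C*-algebra. -/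
def Adj : Type _ := adjointable E

variable {E F}

noncomputable instance : NormedRing (Adj E) := inferInstanceAs (NormedRing (adjointable E))

noncomputable instance : NormedAlgebra k (Adj E) :=
  inferInstanceAs (NormedAlgebra k (adjointable E))

noncomputable instance : NormedAlgebra ℝ (Adj E) := NormedAlgebra.restrictScalars ℝ k (Adj E)

theorem Adj.norm_def (T : Adj E) : ‖T‖ = ‖T.1‖ := rfl

noncomputable instance : Star (Adj E) := ⟨fun T => ⟨T.2.choose, T.1, T.2.choose_spec.symm⟩⟩

theorem Adj.isAdj_star (T : Adj E) : IsAdj T.1 (star T).1 := T.2.choose_spec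

theorem Adj.inner_star (T : Adj E) (x y : E) : E.inner (T.1 x) y = E.inner x ((star T).1 y) :=
  T.isAdj_star x y

theorem Adj.star_eq {T S : Adj E} (h : IsAdj T.1 S.1) : star T = S :=
  Subtype.ext (T.isAdj_star.unique h)

noncomputable instance : StarRing (Adj E) where
  star_involutive T := Adj.star_eq T.isAdj_star.symm
  star_mul T S := Adj.star_eq (S.isAdj_star.comp T.isAdj_star)
  star_add T S := Adj.star_eq (T.isAdj_star.add S.isAdj_star)

instance : StarModule k (Adj E) := ⟨fun c T => Adj.star_eq (T.isAdj_star.smul c)⟩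

/-- Pointwise, ‖Sx‖² is at most the norm of ⟨Sx, Sx⟩ + ⟨Tx, Tx⟩ = ⟨x, (S*S + T*T)x⟩, to which
Cauchy-Schwarz applies. -/
theorem Adj.norm_sq_le (S T : Adj E) : ‖S‖ ^ 2 ≤ ‖star S * S + star T * T‖ := by
  have h : ‖S‖ ≤ √‖star S * S + star T * T‖ := by
    rw [Adj.norm_def S]
    refine ContinuousLinearMap.opNorm_le_bound _ (Real.sqrt_nonneg _) fun x => ?_
    refine le_of_sq_le_sq ?_ (by positivity)
    rw [mul_pow, Real.sq_sqrt (norm_nonneg (star S * S + star T * T))]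
    refine (norm_sq_le_add (S.1 x) (T.1 x)).trans ?_
    rw [Adj.inner_star, Adj.inner_star, ← E.inner_add]
    refine (norm_inner_le _ _).trans ?_
    have h2 := (star S * S + star T * T).1.le_opNorm x
    calc ‖x‖ * ‖(star S * S + star T * T).1 x‖ ≤ ‖x‖ * (‖(star S * S + star T * T).1‖ * ‖x‖) := by
          gcongr
      _ = ‖star S * S + star T * T‖ * ‖x‖ ^ 2 := by rw [sq, Adj.norm_def]; ring
  calc ‖S‖ ^ 2 ≤ √‖star S * S + star T * T‖ ^ 2 := by gcongr
    _ = _ := Real.sq_sqrt (norm_nonneg _)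

instance : IsCStar (Adj E) where
  norm_mul_self_le T := by
    have := Adj.norm_sq_le T 0
    rwa [mul_zero, add_zero, sq] at this
  norm_sq_le := Adj.norm_sq_le

/-- Passing to adjoints does not increase norms, so the adjoints of a Cauchy sequence converge, to
an adjoint of the limit. -/
theorem isClosed_adjointable : IsClosed (adjointable E : Set (E →L[k] E)) := by
  refine isClosed_of_closure_subset fun T hT => ?_
  obtain ⟨u, hu, hlim⟩ := mem_closure_iff_seq_limit.1 hT
  choose w hw using hu
  have hc : CauchySeq w := by
    refine Metric.cauchySeq_iff.2 fun ε hε => ?_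
    obtain ⟨N, hN⟩ := Metric.cauchySeq_iff.1 hlim.cauchySeq ε hε
    refine ⟨N, fun m hm n hn => lt_of_le_of_lt ?_ (hN m hm n hn)⟩
    rw [dist_eq_norm, dist_eq_norm]
    exact ((hw m).sub (hw n)).norm_le
  obtain ⟨S, hS⟩ := cauchySeq_tendsto_of_complete hc
  refine ⟨S, fun x y => ?_⟩
  have h1 : Filter.Tendsto (fun n => E.inner (u n x) y) Filter.atTop (nhds (E.inner (T x) y)) :=
    ((continuous_inner_left E y).tendsto _).comp
      (((ContinuousLinearMap.apply k E x).continuous.tendsto T).comp hlim)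
  have h2 : Filter.Tendsto (fun n => E.inner x (w n y)) Filter.atTop (nhds (E.inner x (S y))) :=
    ((continuous_inner_right E x).tendsto _).comp
      (((ContinuousLinearMap.apply k E y).continuous.tendsto S).comp hS)
  refine tendsto_nhds_unique h1 (h2.congr fun n => (hw n x y).symm)

instance : CompleteSpace (Adj E) := isClosed_adjointable.completeSpace_coe

theorem Adj.real_smul_eq (c : ℝ) (T : Adj E) : c • T = (c : k) • T := rfl

instance : StarModule ℝ (Adj E) := ⟨fun c T => by
  rw [Adj.real_smul_eq, Adj.real_smul_eq, star_smul, RCLike.star_def, RCLike.conj_ofReal]; rfl⟩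

theorem Adj.ext_iff_apply {S T : Adj E} : S = T ↔ ∀ x, S.1 x = T.1 x :=
  ⟨fun h x => by rw [h], fun h => Subtype.ext (ContinuousLinearMap.ext h)⟩

theorem Adj.mem_compacts_mul_left (T : Adj E) {S : F →L[k] E} (hS : S ∈ compacts F E) :
    T.1 ∘L S ∈ compacts F E := T.isAdj_star.comp_mem hS

theorem Adj.mem_compacts_mul_right (T : Adj E) {S : E →L[k] F} (hS : S ∈ compacts E F) :
    S ∘L T.1 ∈ compacts E F := T.isAdj_star.mem_comp hS

variable (E) in
/-- The compact operators as an ideal of the algebra of adjointable operators. -/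
def compactIdeal : NonUnitalSubalgebra ℝ (Adj E) where
  carrier := {T | T.1 ∈ compacts E E}
  zero_mem' := (compacts E E).zero_mem
  add_mem' := (compacts E E).add_mem
  mul_mem' {S _} _ hT := S.mem_compacts_mul_left hT
  smul_mem' c _ hT := (compacts E E).smul_mem (c : k) hT

theorem mem_compactIdeal {T : Adj E} : T ∈ compactIdeal E ↔ T.1 ∈ compacts E E := Iff.rfl

theorem isClosed_compactIdeal : IsClosed (compactIdeal E : Set (Adj E)) :=
  (Submodule.isClosed_topologicalClosure _).preimage continuous_subtype_val

theorem compactIdeal_mul_left (S : Adj E) {T : Adj E} (hT : T ∈ compactIdeal E) :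
    S * T ∈ compactIdeal E := S.mem_compacts_mul_left hT

theorem compactIdeal_mul_right {T : Adj E} (hT : T ∈ compactIdeal E) (S : Adj E) :
    T * S ∈ compactIdeal E := S.mem_compacts_mul_right hT

theorem compactIdeal_star {T : Adj E} (hT : T ∈ compactIdeal E) : star T ∈ compactIdeal E :=
  compacts_adj T.isAdj_star hT

/-! ### The action of `G` on the adjointable operators -/

variable [IsGAlgebra k G B]

theorem norm_g_smul_le (g : G) (x : E) : ‖g • x‖ ≤ ‖x‖ := by
  refine le_of_sq_le_sq ?_ (norm_nonneg _)
  rw [E.norm_sq, E.norm_sq, E.g_smul_inner]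
  exact IsGAlgebra.norm_smul_le k g _

variable (E) in
/-- The operator `x ↦ g • x`. -/
noncomputable def gOp (g : G) : E →L[k] E :=
  LinearMap.mkContinuous
    { toFun := fun x => g • x
      map_add' := smul_add g
      map_smul' := fun c x => E.g_smul_comm g c x } 1 fun x => by
    rw [one_mul]; exact norm_g_smul_le g x

theorem gOp_apply (g : G) (x : E) : gOp E g x = g • x := rfl

theorem IsAdj.conj {T S : E →L[k] E} (h : IsAdj T S) (g : G) :
    IsAdj (gOp E g ∘L T ∘L gOp E g⁻¹) (gOp E g ∘L S ∘L gOp E g⁻¹) := fun x y => by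
  change E.inner (g • T (g⁻¹ • x)) y = E.inner x (g • S (g⁻¹ • y))
  conv_lhs => rw [← smul_inv_smul g y, E.g_smul_inner, h]
  conv_rhs => rw [← smul_inv_smul g x, E.g_smul_inner]

theorem norm_conj_le (T : E →L[k] E) (g : G) : ‖gOp E g ∘L T ∘L gOp E g⁻¹‖ ≤ ‖T‖ := by
  refine ContinuousLinearMap.opNorm_le_bound _ (norm_nonneg _) fun x => ?_
  refine (norm_g_smul_le g _).trans ((T.le_opNorm _).trans ?_)
  gcongr
  exact norm_g_smul_le _ x

variable (E) in
/-- The action of `G` on adjointable operators by conjugation. -/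
noncomputable def conjAct (g : G) : Adj E →L[ℝ] Adj E :=
  LinearMap.mkContinuous
    { toFun := fun T => ⟨gOp E g ∘L T.1 ∘L gOp E g⁻¹, _, T.isAdj_star.conj g⟩
      map_add' := fun S T => Adj.ext_iff_apply.2 fun x => smul_add g _ _
      map_smul' := fun c T => Adj.ext_iff_apply.2 fun x => E.g_smul_comm g (c : k) _ } 1 fun T => by
    rw [one_mul]; exact norm_conj_le T.1 g

theorem conjAct_apply (g : G) (T : Adj E) (x : E) : (conjAct E g T).1 x = g • T.1 (g⁻¹ • x) := rfl

theorem conjAct_eq_iff {T : Adj E} : (∀ g, conjAct E g T = T) ↔ IsInvariant T.1 := by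
  constructor
  · intro h g x
    have := Adj.ext_iff_apply.1 (h g) (g • x)
    rw [conjAct_apply, inv_smul_smul] at this
    exact this.symm
  · intro h g
    refine Adj.ext_iff_apply.2 fun x => ?_
    rw [conjAct_apply, ← h, smul_inv_smul]

theorem compacts_le_of_rankOne {p : Submodule k (E →L[k] F)} (hp : IsClosed (p : Set (E →L[k] F)))
    (h : ∀ (T : E →L[k] F) x y, (∀ z, T z = F.act y (E.inner x z)) → T ∈ p) : compacts E F ≤ p :=
  Submodule.topologicalClosure_minimal _
    (Submodule.span_le.2 fun T ⟨x, y, hxy⟩ => h T x y hxy) hp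

theorem conjAct_mem_compactIdeal (g : G) {T : Adj E} (hT : T ∈ compactIdeal E) :
    conjAct E g T ∈ compactIdeal E := by
  have hc : Continuous fun T : E →L[k] E => gOp E g ∘L T ∘L gOp E g⁻¹ := by fun_prop
  let L : (E →L[k] E) →ₗ[k] (E →L[k] E) :=
    { toFun := fun T => gOp E g ∘L T ∘L gOp E g⁻¹
      map_add' := fun S T => by ext x; exact smul_add g _ _
      map_smul' := fun c T => by ext x; exact E.g_smul_comm g c _ }
  refine compacts_le_of_rankOne (p := (compacts E E).comap L)
    ((Submodule.isClosed_topologicalClosure _).preimage hc) (fun T x y hT => ?_) hT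
  refine Submodule.le_topologicalClosure _ (Submodule.subset_span ⟨g • x, g • y, fun z => ?_⟩)
  change g • T (g⁻¹ • z) = _
  rw [hT, E.g_smul_act, ← E.g_smul_inner, smul_inv_smul]

/-- Conjugation need not be norm continuous on all adjointable operators. It moves y⟨x, ·⟩ to gy⟨gx,
·⟩, which depends continuously on g, and since conjugation is contractive the operators with
continuous orbit map form a closed subspace. -/
theorem continuous_conjAct {T : Adj E} (hT : T ∈ compactIdeal E) :
    Continuous fun g => conjAct E g T := by
  let β : G → (E →L[k] E) → (E →L[k] E) := fun g T => gOp E g ∘L T ∘L gOp E g⁻¹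
  have hadd : ∀ g S T, β g (S + T) = β g S + β g T := fun g S T => by
    ext x; exact smul_add g _ _
  have hsmul : ∀ g (c : k) T, β g (c • T) = c • β g T := fun g c T => by
    ext x; exact E.g_smul_comm g c _
  have hsub : ∀ g S T, β g (S - T) = β g S - β g T := fun g S T => by
    ext x; exact smul_sub g _ _
  let p : Submodule k (E →L[k] E) :=
    { carrier := {T | Continuous fun g => β g T}
      zero_mem' := by
        have : (fun g => β g 0) = fun _ => 0 := by
          funext g; ext x; exact smul_zero g
        change Continuous fun g => β g 0
        rw [this]; exact continuous_const
      add_mem' := fun {S T} hS hT => by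
        change Continuous fun g => β g (S + T)
        simp_rw [hadd]; exact Continuous.add hS hT
      smul_mem' := fun c T hT => by
        change Continuous fun g => β g (c • T)
        simp_rw [hsmul]; exact Continuous.const_smul hT c }
  have hp : IsClosed (p : Set (E →L[k] E)) := by
    refine isClosed_of_closure_subset fun T hT => ?_
    obtain ⟨u, hu, hlim⟩ := mem_closure_iff_seq_limit.1 hT
    refine TendstoUniformly.continuous (F := fun n g => β g (u n)) (p := Filter.atTop) ?_
      (Filter.Eventually.of_forall fun n => hu n).frequently
    refine Metric.tendstoUniformly_iff.2 fun ε hε => ?_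
    filter_upwards [Metric.tendsto_nhds.1 hlim ε hε] with n hn g
    rw [dist_eq_norm, ← hsub]
    refine (norm_conj_le _ g).trans_lt ?_
    rwa [← dist_eq_norm, dist_comm]
  refine Continuous.subtype_mk (compacts_le_of_rankOne hp (fun T x y hT => ?_) hT) _
  change Continuous fun g => β g T
  have hβ : ∀ g z, β g T z = E.act (g • y) (E.inner (g • x) z) := fun g z => by
    change g • T (g⁻¹ • z) = _
    rw [hT, E.g_smul_act, ← E.g_smul_inner, smul_inv_smul]
  refine continuous_iff_continuousAt.2 fun g₀ => tendsto_iff_norm_sub_tendsto_zero.2 ?_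
  refine squeeze_zero (g := fun g => ‖g • y - g₀ • y‖ * ‖x‖ + ‖y‖ * ‖g • x - g₀ • x‖)
    (fun _ => norm_nonneg _) (fun g => ?_) ?_
  · refine ContinuousLinearMap.opNorm_le_bound _ (by positivity) fun z => ?_
    have e : (β g T - β g₀ T) z = E.act (g • y - g₀ • y) (E.inner (g • x) z)
        + E.act (g₀ • y) (E.inner (g • x - g₀ • x) z) := by
      rw [sub_apply, hβ, hβ, inner_sub_left, map_sub, map_sub,
        LinearMap.sub_apply]
      abel
    rw [e, add_mul]
    refine (norm_add_le _ _).trans (add_le_add ?_ ?_)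
    · refine (norm_act_le _ _).trans ?_
      rw [mul_assoc]
      gcongr
      exact (norm_inner_le _ _).trans (by gcongr; exact norm_g_smul_le g x)
    · refine (norm_act_le _ _).trans ?_
      rw [mul_assoc]
      gcongr
      · exact norm_g_smul_le g₀ y
      · exact norm_inner_le _ _
  · have h1 := tendsto_iff_norm_sub_tendsto_zero.1 ((E.continuous_g_smul y).tendsto g₀)
    have h2 := tendsto_iff_norm_sub_tendsto_zero.1 ((E.continuous_g_smul x).tendsto g₀)
    simpa using (h1.mul_const ‖x‖).add (h2.const_mul ‖y‖)

/-- The compact operators have invariant approximate units that are quasicentral in the adjointable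
operators. -/
theorem exists_compact_quasicentral [IsTopologicalGroup G] [CompactSpace G]
    (s m : Finset (Adj E)) (hs : ∀ T ∈ s, T ∈ compactIdeal E) {ε : ℝ} (hε : 0 < ε) :
    ∃ e : Adj E, e ∈ compactIdeal E ∧ star e = e ∧ ‖e‖ ≤ 1 ∧ (∀ g, conjAct E g e = e) ∧
      (∀ T ∈ s, ‖T - e * T‖ ≤ ε) ∧ ∀ T ∈ m, ‖e * T - T * e‖ ≤ ε := by
  obtain ⟨e, ⟨h1, h2, h3, h4⟩, h5, h6⟩ := exists_quasicentral (compactIdeal E)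
    (fun a x hx => compactIdeal_mul_left a hx) (fun a x hx => compactIdeal_mul_right hx a)
    (convex_invariant_contractions (compactIdeal E) (conjAct E)) (fun e he => he.1)
    (fun e he => ⟨he.2.1, he.2.2.1⟩)
    (fun s hs ε hε => exists_invariant_approx_unit (compactIdeal E) isClosed_compactIdeal
      (conjAct E)
      (fun T => Adj.ext_iff_apply.2 fun x => by rw [conjAct_apply, inv_one, one_smul, one_smul])
      (fun g h T => Adj.ext_iff_apply.2 fun x => by
        simp only [conjAct_apply, mul_smul, mul_inv_rev])
      (fun g S T => Adj.ext_iff_apply.2 fun x => by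
        change g • S.1 (T.1 (g⁻¹ • x)) = g • S.1 (g⁻¹ • g • T.1 (g⁻¹ • x))
        rw [inv_smul_smul])
      (fun g T => (Adj.star_eq (T.isAdj_star.conj g)).symm)
      (fun g T => norm_conj_le T.1 g)
      (fun g T hT => conjAct_mem_compactIdeal g hT)
      (fun T hT => continuous_conjAct hT)
      (fun s hs ε hε => exists_approx_unit (compactIdeal E) isClosed_compactIdeal
        (fun T hT => compactIdeal_star hT) s hs hε) s hs hε) s m hs hε
  exact ⟨e, h1, h2, h3, h4, h5, h6⟩

end HilbertModule

end Contractive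

/-! ### Partitions of unity by compact operators -/

namespace HilbertModule

variable {k : Type uk} {G : Type uG} {B : Type uB} [RCLike k] [Group G]
    [TopologicalSpace G] [NonUnitalNormedRing B] [StarRing B] [NormedSpace k B]
    [DistribMulAction G B] [IsScalarTower k B B] [SMulCommClass k B B] [CompleteSpace B]
    [IsCStar B] [StarModule k B] [IsGAlgebra k G B]

variable {E F : HilbertModule.{uk, uG, uB, uE} k G B}

theorem conjAct_mul (g : G) (S T : Adj E) :
    conjAct E g (S * T) = conjAct E g S * conjAct E g T :=
  Adj.ext_iff_apply.2 fun x => by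
    change g • S.1 (T.1 (g⁻¹ • x)) = g • S.1 (g⁻¹ • g • T.1 (g⁻¹ • x))
    rw [inv_smul_smul]

theorem conjAct_one (g : G) : conjAct E g 1 = 1 :=
  Adj.ext_iff_apply.2 fun x => smul_inv_smul g x

theorem conjAct_star (g : G) (T : Adj E) : conjAct E g (star T) = star (conjAct E g T) :=
  (Adj.star_eq (T.isAdj_star.conj g)).symm

theorem norm_mul_le_left {R : Type*} [NonUnitalNormedRing R] {c x : R} (hc : ‖c‖ ≤ 1) :
    ‖c * x‖ ≤ ‖x‖ :=
  (norm_mul_le _ _).trans (mul_le_of_le_one_left (norm_nonneg _) hc)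

theorem norm_mul_le_right {R : Type*} [NonUnitalNormedRing R] {c x : R} (hc : ‖c‖ ≤ 1) :
    ‖x * c‖ ≤ ‖x‖ :=
  (norm_mul_le _ _).trans (mul_le_of_le_one_right (norm_nonneg _) hc)

theorem norm_le_one_of_sq_add_sq {M : Type*} [NormedRing M] [StarRing M] [IsCStar M]
    [NormedAlgebra ℝ M] [StarModule ℝ M] {c s : M} (h : star c * c + star s * s = 1) : ‖c‖ ≤ 1 := by
  have h1 := IsCStar.norm_sq_le c s
  have h2 := norm_one_le_one (M := M)
  rw [h] at h1
  nlinarith [norm_nonneg c]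

variable [IsTopologicalGroup G] [CompactSpace G]

/-- An invariant pair `c, s` with `c² + s² = 1`, `c` compact, such that `s` is small on given compact
operators and `c` and `s` almost commute with given adjointable operators. -/
theorem exists_cutoff_pair (t m : Finset (Adj E)) (ht : ∀ T ∈ t, T ∈ compactIdeal E) {ε : ℝ}
    (hε : 0 < ε) :
    ∃ c s : Adj E, c ∈ compactIdeal E ∧ 1 - s ∈ compactIdeal E ∧ star c = c ∧ star s = s ∧
      c * c + s * s = 1 ∧ (∀ g, conjAct E g c = c) ∧ (∀ g, conjAct E g s = s) ∧
      (∀ T ∈ t, ‖s * T‖ ≤ ε) ∧ ∀ a ∈ m, ‖c * a - a * c‖ ≤ ε ∧ ‖s * a - a * s‖ ≤ ε := by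
  obtain ⟨b₀, hb0, hb₀⟩ : ∃ b : ℝ, 0 ≤ b ∧ ∀ T ∈ t, ‖T‖ ≤ b :=
    ⟨∑ a ∈ t, ‖a‖, Finset.sum_nonneg fun _ _ => norm_nonneg _,
      fun a ha => Finset.single_le_sum (f := fun a => ‖a‖) (fun _ _ => norm_nonneg _) ha⟩
  -- `η` is the spectral gap left below 1 - c². It keeps the root s away from singularity and costs
  -- only ηb₀² ≤ ε²/2 in ‖sT‖².
  set η : ℝ := min (1 / 2) (ε ^ 2 / (2 * (b₀ ^ 2 + 1))) with hη
  have hη0 : 0 < η := lt_min (by norm_num) (by positivity)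
  have hη1 : η ≤ 1 / 2 := min_le_left _ _
  have hη2 : η * b₀ ^ 2 ≤ ε ^ 2 / 2 := by
    calc η * b₀ ^ 2 ≤ ε ^ 2 / (2 * (b₀ ^ 2 + 1)) * b₀ ^ 2 := by
          gcongr; exact min_le_right _ _
      _ ≤ ε ^ 2 / 2 := by
          rw [div_mul_eq_mul_div, div_le_div_iff₀ (by positivity) (by norm_num)]
          nlinarith [sq_nonneg ε]
  have hsη : 0 < √η := Real.sqrt_pos.2 hη0
  have hsη1 : √η ≤ 1 := Real.sqrt_le_one.2 (by linarith)
  -- The first bound serves the commutators with s, where extracting the root costs a factor 1/√η.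
  -- The second serves ‖sT‖² ≤ b₀(ηb₀ + 2δ).
  set δ : ℝ := min (ε * √η / 2) (ε ^ 2 / (4 * (b₀ + 1))) with hδ
  have hδ0 : 0 < δ := lt_min (by positivity) (by positivity)
  have hδ1 : 2 * δ ≤ ε * √η := by linarith [min_le_left (ε * √η / 2) (ε ^ 2 / (4 * (b₀ + 1)))]
  have hδε : δ ≤ ε := by nlinarith
  have hδ2 : b₀ * (2 * δ) ≤ ε ^ 2 / 2 := by
    calc b₀ * (2 * δ) ≤ b₀ * (2 * (ε ^ 2 / (4 * (b₀ + 1)))) := by gcongr; exact min_le_right _ _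
      _ ≤ ε ^ 2 / 2 := by
          rw [← mul_assoc, mul_div_assoc', div_le_div_iff₀ (by positivity) (by norm_num)]
          nlinarith [sq_nonneg ε]
  obtain ⟨e, heK, hes, he1, heg, het, hem⟩ := exists_compact_quasicentral t m ht hδ0
  -- Scaling e by `ρ` gives ‖c²‖ ≤ 1 - η, so s = √(1 - c²) = 1 - b with b compact and ‖b‖ ≤ 1 - √η.
  set ρ : ℝ := √(1 - η) with hρ
  have hρ2 : ρ * ρ = 1 - η := Real.mul_self_sqrt (by linarith)
  have hρ0 : 0 ≤ ρ := Real.sqrt_nonneg _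
  have hρ1 : ρ ≤ 1 := Real.sqrt_le_one.2 (by linarith)
  set c : Adj E := ρ • e with hc
  have hcs : star c = c := by rw [hc, star_smul, star_trivial ρ, hes]
  have hcK : c ∈ compactIdeal E := (compactIdeal E).toSubmodule.smul_mem _ heK
  have hcc : c * c = (1 - η) • (e * e) := by rw [hc, smul_mul_smul_comm, hρ2]
  have hee : ‖e * e‖ ≤ 1 := (norm_mul_le_left he1).trans he1
  have hy : ‖c * c‖ ≤ 1 - η := by
    rw [hcc, norm_smul, Real.norm_of_nonneg (by linarith)]
    exact mul_le_of_le_one_right (by linarith) hee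
  obtain ⟨b, hbK, hb, hbn⟩ := exists_add_sub_sq_eq (compactIdeal E) isClosed_compactIdeal
    ((compactIdeal E).mul_mem hcK hcK) (by linarith)
  have hbη : ‖b‖ ≤ 1 - √η := by
    refine hbn.trans (sub_le_sub_left (Real.sqrt_le_sqrt ?_) 1)
    linarith
  have hbs : star b = b := star_eq_of_add_sub_sq_eq (by linarith) hb hbη (by rw [star_mul, hcs])
  have hcg : ∀ g, conjAct E g c = c := fun g => by rw [hc, map_smul, heg]
  -- The conjugate of b solves the same equation in the same ball, so uniqueness gives invariance.
  have hbg : ∀ g, conjAct E g b = b := fun g =>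
    eq_of_add_sub_sq_eq (r := 1 - √η) (by linarith) ((norm_conj_le b.1 g).trans hbη) hbη (by
      rw [← conjAct_mul, ← map_add, ← map_sub, hb, conjAct_mul, hcg])
  have hss : (1 - b) * (1 - b) = 1 - c * c := by rw [← hb]; noncomm_ring
  have hbs' : star (1 - b) = 1 - b := by rw [star_sub, star_one, hbs]
  refine ⟨c, 1 - b, hcK, by rwa [sub_sub_cancel], hcs, hbs', by rw [hss]; abel, hcg, fun g => ?_,
    fun T hT => ?_, fun a ha => ⟨?_, ?_⟩⟩
  · rw [map_sub, conjAct_one, hbg]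
  · have h1 : ‖T - e * e * T‖ ≤ 2 * δ := by
      have h2 : T - e * e * T = (T - e * T) + e * (T - e * T) := by noncomm_ring
      rw [h2]
      refine (norm_add_le _ _).trans ?_
      have := (norm_mul_le_left (x := T - e * T) he1).trans (het T hT)
      linarith [het T hT]
    have h2 : star ((1 - b) * T) * ((1 - b) * T)
        = star T * (η • T + (1 - η) • (T - e * e * T)) := by
      have h3 : η • T + (1 - η) • (T - e * e * T) = (1 - b) * (1 - b) * T := by
        rw [hss, hcc, sub_mul, one_mul, smul_mul_assoc]
        module
      rw [h3, star_mul, hbs']; noncomm_ring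
    have hTb := hb₀ T hT
    have h3 : ‖star ((1 - b) * T) * ((1 - b) * T)‖ ≤ b₀ * (η * b₀ + 2 * δ) := by
      rw [h2]
      refine (norm_mul_le _ _).trans ?_
      rw [norm_star]
      gcongr
      refine (norm_add_le _ _).trans ?_
      rw [norm_smul, norm_smul, Real.norm_of_nonneg hη0.le, Real.norm_of_nonneg (by linarith)]
      refine add_le_add (by gcongr) ?_
      nlinarith [norm_nonneg (T - e * e * T)]
    rw [CStarRing.norm_star_mul_self] at h3
    refine le_of_sq_le_sq ?_ hε.le
    nlinarith
  · have h1 : c * a - a * c = ρ • (e * a - a * e) := by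
      rw [hc, smul_mul_assoc, mul_smul_comm, smul_sub]
    rw [h1, norm_smul, Real.norm_of_nonneg hρ0]
    have := hem a ha
    nlinarith [norm_nonneg (e * a - a * e)]
  · have h1 : (1 - b) * a - a * (1 - b) = -(b * a - a * b) := by noncomm_ring
    have h2 := norm_commutator_le_of_add_sub_sq_eq hb hbη a
    have h3 : c * c * a - a * (c * c) = (1 - η) • (e * (e * a - a * e) + (e * a - a * e) * e) := by
      rw [hcc, smul_mul_assoc, mul_smul_comm, ← smul_sub]
      congr 1
      noncomm_ring
    have h4 : ‖c * c * a - a * (c * c)‖ ≤ 2 * δ := by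
      rw [h3, norm_smul, Real.norm_of_nonneg (by linarith)]
      have h5 := hem a ha
      have h6 := norm_add_le (e * (e * a - a * e)) ((e * a - a * e) * e)
      have h7 := norm_mul_le_left (x := e * a - a * e) he1
      have h8 := norm_mul_le_right (x := e * a - a * e) he1
      nlinarith [norm_nonneg (e * (e * a - a * e) + (e * a - a * e) * e)]
    rw [h1, norm_neg]
    have h5 : √η * ‖b * a - a * b‖ ≤ √η * ε := by linarith
    exact le_of_mul_le_mul_left h5 hsη

/-- A sequence of invariant compact operators `p n` with `∑ pₙ* pₙ = 1`, the remainders being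
`qₙ* qₙ`, which asymptotically commutes with prescribed operators and kills prescribed compact
operators. -/
theorem exists_compact_partition (S T : ℕ → Finset (Adj E))
    (hT : ∀ n, ∀ x ∈ T n, x ∈ compactIdeal E) (hT0 : T 0 = ∅) (δ : ℕ → ℝ) (hδ : ∀ n, 0 < δ n) :
    ∃ p q : ℕ → Adj E, q 0 = 1 ∧ ∀ n, p n ∈ compactIdeal E ∧ (∀ g, conjAct E g (p n) = p n) ∧
      ‖p n‖ ≤ 1 ∧ ‖q n‖ ≤ 1 ∧
      star (p n) * p n + star (q (n + 1)) * q (n + 1) = star (q n) * q n ∧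
      (∀ a ∈ S n, ‖p n * a - a * p n‖ ≤ δ n) ∧
      (∀ x ∈ T n, ‖p n * x‖ ≤ δ n ∧ ‖q n * x‖ ≤ δ n) := by
  classical
  -- The induction hypothesis on the remainder. Compactness of 1 - q makes every commutator [q, a]
  -- compact, hence available to the next cutoff pair.
  let Q : ℕ → Adj E → Prop := fun n q => (∀ g, conjAct E g q = q) ∧ ‖q‖ ≤ 1 ∧
    1 - q ∈ compactIdeal E ∧ (∀ a ∈ S n, ‖q * a - a * q‖ ≤ δ n / 2) ∧ ∀ x ∈ T n, ‖q * x‖ ≤ δ n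
  have step : ∀ n q, Q n q → ∃ p q', (p ∈ compactIdeal E ∧ (∀ g, conjAct E g p = p) ∧ ‖p‖ ≤ 1 ∧
      star p * p + star q' * q' = star q * q ∧ (∀ a ∈ S n, ‖p * a - a * p‖ ≤ δ n) ∧
      ∀ x ∈ T n, ‖p * x‖ ≤ δ n) ∧ Q (n + 1) q' := by
    rintro n q ⟨hqg, hq1, hqK, hqS, hqT⟩
    have hcomm : ∀ a, q * a - a * q ∈ compactIdeal E := fun a => by
      have e : q * a - a * q = a * (1 - q) - (1 - q) * a := by noncomm_ring
      rw [e]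
      exact (compactIdeal E).toSubmodule.sub_mem (compactIdeal_mul_left _ hqK)
        (compactIdeal_mul_right hqK _)
    set ε := min (δ n / 2) (δ (n + 1) / 4) with hε
    have hε0 : 0 < ε := lt_min (by linarith [hδ n]) (by linarith [hδ (n + 1)])
    have hε1 : ε ≤ δ n / 2 := min_le_left _ _
    have hε2 : ε ≤ δ (n + 1) / 4 := min_le_right _ _
    -- The new terms are p = cq and q' = sq, so that p*p + q'*q' = q*(c² + s²)q = q*q. The factor s
    -- has to be small on qx for x in T(n + 1), and on [q, a] for a in S(n + 1), which makes sq
    -- almost commute with a.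
    obtain ⟨c, s, hcK, hsK, hcs, hss, hcc, hcg, hsg, hst, hm⟩ := exists_cutoff_pair
      ((T (n + 1)).image (fun x => q * x) ∪ (S (n + 1)).image (fun a => q * a - a * q))
      (S n ∪ S (n + 1)) (by
        intro x hx
        rcases Finset.mem_union.1 hx with hx | hx
        · obtain ⟨a, ha, rfl⟩ := Finset.mem_image.1 hx
          exact compactIdeal_mul_left _ (hT _ a ha)
        · obtain ⟨a, ha, rfl⟩ := Finset.mem_image.1 hx
          exact hcomm a) hε0
    have hc1 : ‖c‖ ≤ 1 := norm_le_one_of_sq_add_sq (s := s) (by rw [hcs, hss, hcc])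
    have hs1 : ‖s‖ ≤ 1 := norm_le_one_of_sq_add_sq (s := c) (by rw [hcs, hss, add_comm, hcc])
    refine ⟨c * q, s * q, ⟨compactIdeal_mul_right hcK q, fun g => by rw [conjAct_mul, hcg, hqg],
      (norm_mul_le_left hc1).trans hq1, ?_, fun a ha => ?_, fun x hx => ?_⟩,
      fun g => by rw [conjAct_mul, hsg, hqg], (norm_mul_le_left hs1).trans hq1, ?_, fun a ha => ?_,
      fun x hx => ?_⟩
    · rw [star_mul, star_mul, hcs, hss]
      calc _ = star q * (c * c + s * s) * q := by noncomm_ring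
        _ = _ := by rw [hcc, mul_one]
    · have e : c * q * a - a * (c * q) = (c * a - a * c) * q + c * (q * a - a * q) := by
        noncomm_ring
      rw [e]
      have h1 := norm_mul_le_right (x := c * a - a * c) hq1
      have h2 := norm_mul_le_left (x := q * a - a * q) hc1
      have h3 := (hm a (Finset.mem_union_left _ ha)).1
      have h4 := hqS a ha
      linarith [norm_add_le ((c * a - a * c) * q) (c * (q * a - a * q))]
    · rw [mul_assoc]
      exact (norm_mul_le_left hc1).trans (hqT x hx)
    · have e : 1 - s * q = (1 - s) * q + (1 - q) := by noncomm_ring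
      rw [e]
      exact (compactIdeal E).add_mem (compactIdeal_mul_right hsK q) hqK
    · have e : s * q * a - a * (s * q) = (s * a - a * s) * q + s * (q * a - a * q) := by
        noncomm_ring
      rw [e]
      have h1 := norm_mul_le_right (x := s * a - a * s) hq1
      have h3 := (hm a (Finset.mem_union_right _ ha)).2
      have h4 := hst (q * a - a * q)
        (Finset.mem_union_right _ (Finset.mem_image.2 ⟨a, ha, rfl⟩))
      linarith [norm_add_le ((s * a - a * s) * q) (s * (q * a - a * q))]
    · rw [mul_assoc]
      have h4 := hst (q * x) (Finset.mem_union_left _ (Finset.mem_image.2 ⟨x, hx, rfl⟩))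
      linarith [hδ (n + 1)]
  choose! P N hPN using step
  let q : ℕ → Adj E := fun n => Nat.rec 1 (fun n q => N n q) n
  have hQ : ∀ n, Q n (q n) := by
    intro n
    induction n with
    | zero =>
      refine ⟨conjAct_one, norm_one_le_one, ?_, fun a ha => ?_, fun x hx => ?_⟩
      · change (1 : Adj E) - 1 ∈ _
        rw [sub_self]; exact zero_mem _
      · change ‖1 * a - a * 1‖ ≤ _
        rw [one_mul, mul_one, sub_self, norm_zero]
        linarith [hδ 0]
      -- The initial remainder is 1, which is small on nothing nonzero; this is why T 0 must be
      -- empty.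
      · rw [hT0] at hx
        exact absurd hx (Finset.notMem_empty x)
    | succ n ih => exact (hPN n (q n) ih).2
  refine ⟨fun n => P n (q n), q, rfl, fun n => ?_⟩
  obtain ⟨h1, h2, h3, h4, h5, h6⟩ := (hPN n (q n) (hQ n)).1
  exact ⟨h1, h2, h3, (hQ n).2.1, h4, h5, fun x hx => ⟨h6 x hx, (hQ n).2.2.2.2 x hx⟩⟩

end HilbertModule

/-! ### Strong limits -/

section StrongLimit

open Filter Topology

variable {k V W : Type*} [RCLike k] [NormedAddCommGroup V] [NormedSpace k V] [CompleteSpace V]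
  [NormedAddCommGroup W] [NormedSpace k W] [CompleteSpace W]

/-- A bounded sequence of operators that converges on a set with dense span converges strongly. -/
theorem exists_strong_limit {T : ℕ → V →L[k] W} {C : ℝ} (hC : ∀ n, ‖T n‖ ≤ C) {D : Set V}
    (hD : Dense (Submodule.span k D : Set V)) (hT : ∀ x ∈ D, CauchySeq fun n => T n x) :
    ∃ S : V →L[k] W, ‖S‖ ≤ C ∧ ∀ x, Tendsto (fun n => T n x) atTop (𝓝 (S x)) := by
  have hC0 : 0 ≤ C := (norm_nonneg _).trans (hC 0)
  have hspan : ∀ x ∈ Submodule.span k D, CauchySeq fun n => T n x := by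
    intro x hx
    induction hx using Submodule.span_induction with
    | mem x hx => exact hT x hx
    | zero => simpa using cauchySeq_const (0 : W)
    | add x y _ _ hx hy =>
      simp only [map_add]
      exact hx.add hy
    | smul c x _ hx =>
      simp only [map_smul]
      exact (uniformContinuous_const_smul c).comp_cauchySeq hx
  have hall : ∀ x, CauchySeq fun n => T n x := by
    intro x
    refine Metric.cauchySeq_iff'.2 fun ε hε => ?_
    have hδ : 0 < ε / (3 * (C + 1)) := by positivity
    obtain ⟨y, hy, hxy⟩ := Metric.mem_closure_iff.1 (hD x) _ hδ
    obtain ⟨N, hN⟩ := Metric.cauchySeq_iff'.1 (hspan y hy) (ε / 3) (by linarith)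
    refine ⟨N, fun n hn => ?_⟩
    have h1 := hN n hn
    rw [dist_eq_norm] at h1 hxy ⊢
    have h2 : ∀ m, ‖T m (x - y)‖ ≤ ε / 3 := fun m => by
      refine ((T m).le_opNorm _).trans ?_
      calc ‖T m‖ * ‖x - y‖ ≤ (C + 1) * (ε / (3 * (C + 1))) := by
            gcongr
            linarith [hC m]
        _ = ε / 3 := by field_simp
    have e : T n x - T N x = T n (x - y) + (T n y - T N y) - T N (x - y) := by
      rw [map_sub, map_sub]; abel
    rw [e]
    have h3 := norm_sub_le (T n (x - y) + (T n y - T N y)) (T N (x - y))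
    have h4 := norm_add_le (T n (x - y)) (T n y - T N y)
    linarith [h2 n, h2 N]
  choose f hf using fun x => cauchySeq_tendsto_of_complete (hall x)
  have hf' : Tendsto (fun n x => T n x) atTop (𝓝 f) := tendsto_pi_nhds.2 hf
  refine ⟨continuousLinearMapOfTendsto T hf', ?_, hf⟩
  refine ContinuousLinearMap.opNorm_le_bound _ hC0 fun x => ?_
  exact le_of_tendsto (hf x).norm (Eventually.of_forall fun n =>
    ((T n).le_opNorm x).trans (by gcongr; exact hC n))

end StrongLimit

/-! ### Compactness of strong sums, and norms detected by compact operators -/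

namespace HilbertModule

open Filter Topology

variable {k : Type uk} {G : Type uG} {B : Type uB} [RCLike k] [Group G]
    [TopologicalSpace G] [NonUnitalNormedRing B] [StarRing B] [NormedSpace k B]
    [DistribMulAction G B] [IsScalarTower k B B] [SMulCommClass k B B] [CompleteSpace B]
    [IsCStar B] [StarModule k B]

variable {E F : HilbertModule.{uk, uG, uB, uE} k G B}

/-- A strong limit of norm summable compact operators is compact. -/
theorem mem_compacts_of_tendsto_sum {R : ℕ → E →L[k] F} (hR : ∀ n, R n ∈ compacts E F)
    (hs : Summable fun n => ‖R n‖) {S : E →L[k] F}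
    (h : ∀ x, Tendsto (fun n => ∑ i ∈ Finset.range n, R i x) atTop (𝓝 (S x))) :
    S ∈ compacts E F := by
  have h1 := hs.of_norm.hasSum.tendsto_sum_nat
  have h2 : S = ∑' n, R n := by
    ext x
    refine tendsto_nhds_unique (h x) ?_
    have := ((ContinuousLinearMap.apply k F x).continuous.tendsto _).comp h1
    refine this.congr fun n => ?_
    simp
  rw [h2]
  exact (Submodule.isClosed_topologicalClosure _).mem_of_tendsto h1
    (Eventually.of_forall fun n => Submodule.sum_mem _ fun i _ => hR i)

/-- `T T*` as an adjointable operator. -/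
def mulAdjoint {T : E →L[k] F} {S : F →L[k] E} (h : IsAdj T S) : Adj F :=
  ⟨T ∘L S, T ∘L S, h.symm.comp h⟩

/-- ‖pT‖² is the norm of pTT*p*, at most ‖pTT*‖. Smallness of p on an operator between different
modules is thereby a condition on the element TT* of `Adj F`. -/
theorem norm_comp_sq_le {T : E →L[k] F} {S : F →L[k] E} (h : IsAdj T S) (p : Adj F)
    (hp : ‖p‖ ≤ 1) : ‖p.1 ∘L T‖ ^ 2 ≤ ‖p * mulAdjoint h‖ := by
  have h1 : IsAdj (p.1 ∘L T) (S ∘L (star p).1) := h.comp p.isAdj_star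
  have h2 : ‖p.1 ∘L T‖ ≤ √‖p * mulAdjoint h‖ := by
    refine h1.symm.norm_le.trans ?_
    refine ContinuousLinearMap.opNorm_le_bound _ (Real.sqrt_nonneg _) fun y => ?_
    refine le_of_sq_le_sq ?_ (by positivity)
    rw [mul_pow, Real.sq_sqrt (norm_nonneg (p * mulAdjoint h)), E.norm_sq, ← h1]
    refine (norm_inner_le _ _).trans ?_
    have h3 : (p.1 ∘L T) ((S ∘L (star p).1) y) = (p * mulAdjoint h).1 ((star p).1 y) := rfl
    have h4 : ‖(star p).1 y‖ ≤ ‖y‖ := ((star p).1.le_opNorm y).trans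
      (mul_le_of_le_one_left (norm_nonneg _) (by rw [← Adj.norm_def, norm_star]; exact hp))
    rw [h3, sq, ← mul_assoc, Adj.norm_def]
    gcongr
    exact ((p * mulAdjoint h).1.le_opNorm _).trans (by gcongr)
  calc ‖p.1 ∘L T‖ ^ 2 ≤ √‖p * mulAdjoint h‖ ^ 2 := by gcongr
    _ = _ := Real.sq_sqrt (norm_nonneg _)

variable (E) in
/-- The operator `z ↦ x ⟨x, z⟩`. -/
noncomputable def selfRankOne (x : E) : Adj E :=
  ⟨(exists_rankOne x x).choose, (exists_rankOne x x).choose, fun y z => by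
    rw [(exists_rankOne x x).choose_spec, (exists_rankOne x x).choose_spec, inner_act_left,
      E.inner_act, E.star_inner]⟩

theorem selfRankOne_apply (x z : E) : (selfRankOne E x).1 z = E.act x (E.inner x z) :=
  (exists_rankOne x x).choose_spec z

theorem selfRankOne_mem (x : E) : selfRankOne E x ∈ compactIdeal E :=
  Submodule.le_topologicalClosure _ (Submodule.subset_span ⟨x, x, selfRankOne_apply x⟩)

/-- Conjugating x⟨x, ·⟩ by p gives y⟨y, ·⟩ with y = px, of norm at least ‖y‖². Strong convergence on
given vectors is thus encoded in products with compact operators. -/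
theorem norm_apply_sq_le (p : Adj E) (hp : ‖p‖ ≤ 1) (x : E) :
    ‖p.1 x‖ ^ 2 ≤ ‖p * selfRankOne E x‖ := by
  set y := p.1 x with hy
  set T := p * selfRankOne E x * star p with hT
  have h1 : ∀ z, T.1 z = E.act y (E.inner y z) := fun z => by
    change p.1 ((selfRankOne E x).1 ((star p).1 z)) = _
    rw [selfRankOne_apply, p.isAdj_star.map_act, ← p.inner_star]
  have h2 : ‖T‖ ≤ ‖p * selfRankOne E x‖ := norm_mul_le_right (by rwa [norm_star])
  refine le_trans ?_ h2
  by_cases h0 : ‖y‖ = 0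
  · rw [h0]; simp
  have h3 := T.1.le_opNorm y
  have hpos : 0 < ‖y‖ := lt_of_le_of_ne (norm_nonneg _) (Ne.symm h0)
  set b := E.inner y y with hb
  have hbs : star b = b := E.star_inner y y
  have hbn : ‖b‖ = ‖y‖ ^ 2 := (E.norm_sq y).symm
  have hbb : ‖b * b‖ = ‖b‖ * ‖b‖ := by
    have := CStarRing.norm_star_mul_self (x := b)
    rwa [hbs] at this
  have hbbb : ‖b * b * (b * b)‖ = ‖b * b‖ * ‖b * b‖ := by
    have := CStarRing.norm_star_mul_self (x := b * b)
    rwa [star_mul, hbs] at this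
  -- The rank one operator is tested on y itself: y⟨y, y⟩ has square norm ‖b³‖ with b = ⟨y, y⟩, and
  -- ‖b³‖‖b‖ ≥ ‖b⁴‖ = ‖b‖⁴.
  have h4 : ‖y‖ ^ 3 ≤ ‖T.1 y‖ := by
    rw [h1]
    have h5 : ‖E.act y b‖ ^ 2 * ‖b‖ ≥ ‖b‖ ^ 4 := by
      rw [E.norm_sq, E.inner_act, inner_act_left, hbs, ← hb]
      calc ‖b‖ ^ 4 = ‖b * b * (b * b)‖ := by rw [hbbb, hbb]; ring
        _ = ‖b * b * b * b‖ := by rw [mul_assoc (b * b) b b]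
        _ ≤ _ := norm_mul_le _ _
    rw [hbn] at h5
    have h6 : (‖y‖ ^ 3) ^ 2 ≤ ‖E.act y b‖ ^ 2 := by
      have h7 : (‖y‖ ^ 3) ^ 2 * ‖y‖ ^ 2 ≤ ‖E.act y b‖ ^ 2 * ‖y‖ ^ 2 := by nlinarith
      exact le_of_mul_le_mul_right h7 (by positivity)
    exact le_of_sq_le_sq h6 (norm_nonneg _)
  rw [← Adj.norm_def] at h3
  have h8 : ‖y‖ ^ 2 * ‖y‖ ≤ ‖T‖ * ‖y‖ := by nlinarith
  exact le_of_mul_le_mul_right h8 hpos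

theorem exists_generating_sequence (E : HilbertModule.{uk, uG, uB, uE} k G B) :
    ∃ x : ℕ → E, Dense (Submodule.span k {z | ∃ n, ∃ b : B, z = E.act (x n) b} : Set E) := by
  obtain ⟨s, hs, hd⟩ := E.countablyGenerated
  -- Inserting 0 covers an empty generating set, which is not the range of a sequence.
  obtain ⟨x, hx⟩ := (hs.insert 0).exists_eq_range (Set.insert_nonempty 0 s)
  refine ⟨x, hd.mono (Submodule.span_mono ?_)⟩
  rintro z ⟨y, hy, b, rfl⟩
  obtain ⟨n, rfl⟩ : y ∈ Set.range x := hx ▸ Set.mem_insert_of_mem 0 hy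
  exact ⟨n, b, rfl⟩

end HilbertModule

/-! ### Kasparov's technical theorem -/

namespace HilbertModule

open Filter Topology

variable {k : Type uk} {G : Type uG} {B : Type uB} [RCLike k] [Group G]
    [TopologicalSpace G] [NonUnitalNormedRing B] [StarRing B] [NormedSpace k B]
    [DistribMulAction G B] [IsScalarTower k B B] [SMulCommClass k B B] [CompleteSpace B]
    [IsCStar B] [StarModule k B] [IsGAlgebra k G B]

variable {E F : HilbertModule.{uk, uG, uB, uE} k G B}

theorem Adj.sum_apply (r : ℕ → Adj E) (s : Finset ℕ) (x : E) :
    (∑ i ∈ s, r i).1 x = ∑ i ∈ s, (r i).1 x := by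
  have h1 : (∑ i ∈ s, r i).1 = ∑ i ∈ s, (r i).1 :=
    map_sum ((adjointable E).val : adjointable E →ₐ[k] (E →L[k] E)) r s
  rw [h1]
  simp

theorem exists_adj_strong_limit {T : ℕ → Adj E} (hs : ∀ n, star (T n) = T n)
    (hg : ∀ n g, conjAct E g (T n) = T n) (hT : ∀ n, ‖T n‖ ≤ 1) {D : Set E}
    (hD : Dense (Submodule.span k D : Set E)) (hc : ∀ x ∈ D, CauchySeq fun n => (T n).1 x) :
    ∃ N : Adj E, star N = N ∧ (∀ g, conjAct E g N = N) ∧ ‖N‖ ≤ 1 ∧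
      ∀ x, Tendsto (fun n => (T n).1 x) atTop (𝓝 (N.1 x)) := by
  obtain ⟨N, hN1, hN⟩ := exists_strong_limit (T := fun n => (T n).1) hT hD hc
  have hadj : IsAdj N N := fun x y => by
    have h1 := ((continuous_inner_left E y).tendsto _).comp (hN x)
    have h2 := ((continuous_inner_right E x).tendsto _).comp (hN y)
    refine tendsto_nhds_unique h1 (h2.congr fun n => ?_)
    have := (T n).inner_star x y
    rw [hs] at this
    exact this.symm
  refine ⟨⟨N, N, hadj⟩, Adj.star_eq hadj, conjAct_eq_iff.2 fun g x => ?_, hN1, hN⟩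
  have h1 := ((gOp E g).continuous.tendsto _).comp (hN x)
  refine tendsto_nhds_unique (hN (g • x)) (h1.congr fun n => ?_)
  exact (conjAct_eq_iff.1 (hg n) g x).symm

theorem summable_norm_of_le_half_pow {V : Type*} [SeminormedAddCommGroup V] {R : ℕ → V} (C : ℝ)
    (j : ℕ) (h : ∀ n, j ≤ n → ‖R n‖ ≤ C * (1 / 2) ^ n) : Summable fun n => ‖R n‖ := by
  refine Summable.of_norm_bounded_eventually_nat (g := fun n => C * (1 / 2 : ℝ) ^ n)
    (summable_geometric_two.mul_left C) ?_
  filter_upwards [eventually_ge_atTop j] with n hn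
  rw [norm_norm]
  exact h n hn

variable [IsTopologicalGroup G] [CompactSpace G]

/-- Kasparov's technical theorem, in the following form: if the self-adjoint invariant contractions
`vₙ` asymptotically fix the `yⱼ`, asymptotically commute with the `mⱼ` and multiply the `fⱼ` to
compact operators, then there is an invariant self-adjoint contraction `N` that, modulo compact
operators, fixes the `yⱼ`, commutes with the `mⱼ` and annihilates the `fⱼ`.  A compact perturbation
`N'` of `N` maps into any closed subspace that contains the ranges of the `vₙ`. -/
theorem exists_technical_operator {v : ℕ → Adj E} (hvs : ∀ n, star (v n) = v n)
    (hvg : ∀ n g, conjAct E g (v n) = v n) (hv1 : ∀ n, ‖v n‖ ≤ 1) (y m : ℕ → Adj E)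
    {f : ℕ → F →L[k] E} {f' : ℕ → E →L[k] F} (hf : ∀ j, IsAdj (f j) (f' j))
    (hy : ∀ n, ∀ j ≤ n, ‖y j - v n * y j‖ ≤ (1 / 2) ^ n)
    (hm : ∀ n, ∀ j ≤ n, ‖v n * m j - m j * v n‖ ≤ (1 / 2) ^ n)
    (hvf : ∀ n j, (v n).1 ∘L f j ∈ compacts F E)
    (W : Submodule k E) (hW : IsClosed (W : Set E)) (hvW : ∀ n x, (v n).1 x ∈ W) :
    ∃ N N' : Adj E, (star N = N ∧ (∀ g, conjAct E g N = N) ∧ ‖N‖ ≤ 1 ∧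
        (∀ j, y j - N * y j ∈ compactIdeal E) ∧ (∀ j, N * m j - m j * N ∈ compactIdeal E) ∧
        ∀ j, N.1 ∘L f j ∈ compacts F E) ∧
      star N' = N' ∧ (∀ g, conjAct E g N' = N') ∧ N' - N ∈ compactIdeal E ∧ ∀ x, N'.1 x ∈ W := by
  classical
  obtain ⟨e, he⟩ := exists_generating_sequence E
  -- Squaring makes u_n and 1 - u_n positive, so the partial sums of ∑ p_n* u_n p_n stay between 0
  -- and 1.
  set u : ℕ → Adj E := fun n => v n * v n with hu
  have hus : ∀ n, star (u n) = u n := fun n => by rw [hu, star_mul, hvs]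
  have hu1 : ∀ n, ‖u n‖ ≤ 1 := fun n => (norm_mul_le_left (hv1 n)).trans (hv1 n)
  have hufa : ∀ n j, IsAdj ((u n).1 ∘L f j) (f' j ∘L (u n).1) := fun n j => by
    have := (u n).isAdj_star
    rw [hus] at this
    exact (hf j).comp this
  have huf : ∀ n j, (u n).1 ∘L f j ∈ compacts F E := fun n j =>
    (v n).mem_compacts_mul_left (hvf n j)
  -- The p_n are not self-adjoint; the adjoints of the m_j are included to control commutators of
  -- p_n* with m_j.
  let S : ℕ → Finset (Adj E) := fun n => {v n} ∪ ((Finset.range (n + 1)).image y ∪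
    ((Finset.range (n + 1)).image m ∪ (Finset.range (n + 1)).image fun j => star (m j)))
  -- The rank one operators make p_n and q_n small on the generators, and the operators u_n f_j f_j*
  -- u_n make p_n u_n f_j small.
  let T : ℕ → Finset (Adj E) := fun n => if n = 0 then ∅ else
    (Finset.range (n + 1)).image (fun j => selfRankOne E (e j)) ∪
      (Finset.range (n + 1)).image fun j => mulAdjoint (hufa n j)
  have hTK : ∀ n, ∀ x ∈ T n, x ∈ compactIdeal E := by
    intro n x hx
    by_cases h0 : n = 0
    · simp [T, h0] at hx
    simp only [T, h0, if_false, Finset.mem_union, Finset.mem_image] at hx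
    rcases hx with ⟨j, -, rfl⟩ | ⟨j, -, rfl⟩
    · exact selfRankOne_mem _
    · exact (hufa n j).symm.mem_comp (huf n j)
  -- The estimates through T bound squares of norms, so tolerance 4⁻ⁿ there yields 2⁻ⁿ.
  obtain ⟨p, q, hq0, hpq⟩ := exists_compact_partition S T hTK (by simp [T])
    (fun n => (1 / 4) ^ n) (fun n => by positivity)
  have hpK := fun n => (hpq n).1
  have hpg := fun n => (hpq n).2.1
  have hp1 := fun n => (hpq n).2.2.1
  have hq1 := fun n => (hpq n).2.2.2.1
  have hsum := fun n => (hpq n).2.2.2.2.1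
  have hps1 : ∀ n, ‖star (p n)‖ ≤ 1 := fun n => (norm_star (p n)).trans_le (hp1 n)
  have h42 : ∀ n : ℕ, ((1 : ℝ) / 4) ^ n ≤ (1 / 2) ^ n := fun n =>
    pow_le_pow_left₀ (by norm_num) (by norm_num) n
  have hS : ∀ n, ∀ a ∈ S n, ‖p n * a - a * p n‖ ≤ (1 / 2) ^ n := fun n a ha =>
    ((hpq n).2.2.2.2.2.1 a ha).trans (h42 n)
  have hpv : ∀ n, ‖p n * v n - v n * p n‖ ≤ (1 / 2) ^ n := fun n => hS n _ (by simp [S])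
  have hpy : ∀ n, ∀ j ≤ n, ‖p n * y j - y j * p n‖ ≤ (1 / 2) ^ n := fun n j hj => hS n _ (by
    simp only [S, Finset.mem_union, Finset.mem_image, Finset.mem_range]
    exact Or.inr (Or.inl ⟨j, by omega, rfl⟩))
  have hpm : ∀ n, ∀ j ≤ n, ‖p n * m j - m j * p n‖ ≤ (1 / 2) ^ n := fun n j hj => hS n _ (by
    simp only [S, Finset.mem_union, Finset.mem_image, Finset.mem_range]
    exact Or.inr (Or.inr (Or.inl ⟨j, by omega, rfl⟩)))
  have hpm' : ∀ n, ∀ j ≤ n, ‖star (p n) * m j - m j * star (p n)‖ ≤ (1 / 2) ^ n := fun n j hj => by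
    have h1 := hS n (star (m j)) (by
      simp only [S, Finset.mem_union, Finset.mem_image, Finset.mem_range]
      exact Or.inr (Or.inr (Or.inr ⟨j, by omega, rfl⟩)))
    rw [← norm_star, star_sub, star_mul, star_mul, star_star, norm_sub_rev] at h1
    exact h1
  have hsq : ∀ (n : ℕ) {t : ℝ}, t ^ 2 ≤ (1 / 4) ^ n → t ≤ (1 / 2) ^ n := fun n t ht => by
    refine le_of_sq_le_sq (ht.trans (le_of_eq ?_)) (by positivity)
    rw [← pow_mul, mul_comm, pow_mul]; norm_num
  have hTe : ∀ j n, j + 1 ≤ n → selfRankOne E (e j) ∈ T n := fun j n hj => by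
    have h0 : n ≠ 0 := by omega
    simp only [T, h0, if_false, Finset.mem_union, Finset.mem_image, Finset.mem_range]
    exact Or.inl ⟨j, by omega, rfl⟩
  have hpe : ∀ j n, j + 1 ≤ n → ‖(p n).1 (e j)‖ ≤ (1 / 2) ^ n := fun j n hj =>
    hsq n ((norm_apply_sq_le (p n) (hp1 n) (e j)).trans
      ((hpq n).2.2.2.2.2.2 _ (hTe j n hj)).1)
  have hqe : ∀ j n, j + 1 ≤ n → ‖(q n).1 (e j)‖ ≤ (1 / 2) ^ n := fun j n hj =>
    hsq n ((norm_apply_sq_le (q n) (hq1 n) (e j)).trans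
      ((hpq n).2.2.2.2.2.2 _ (hTe j n hj)).2)
  have hpf : ∀ j n, j + 1 ≤ n → ‖(p n).1 ∘L (u n).1 ∘L f j‖ ≤ (1 / 2) ^ n := fun j n hj =>
    hsq n ((norm_comp_sq_le (hufa n j) (p n) (hp1 n)).trans
      ((hpq n).2.2.2.2.2.2 _ (by
        have h0 : n ≠ 0 := by omega
        simp only [T, h0, if_false, Finset.mem_union, Finset.mem_image, Finset.mem_range]
        exact Or.inr ⟨j, by omega, rfl⟩)).1)
  set D : Set E := {z | ∃ n, ∃ b : B, z = E.act (e n) b} with hD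
  -- the remainders tend strongly to zero
  have hq : ∀ x, Tendsto (fun n => (q n).1 x) atTop (𝓝 0) := by
    have hqD : ∀ x ∈ D, Tendsto (fun n => (q n).1 x) atTop (𝓝 0) := by
      rintro x ⟨j, b, rfl⟩
      refine squeeze_zero_norm' (a := fun n => (1 / 2 : ℝ) ^ n * ‖b‖) ?_ ?_
      · filter_upwards [eventually_ge_atTop (j + 1)] with n hn
        rw [(q n).isAdj_star.map_act]
        exact (norm_act_le _ _).trans (by gcongr; exact hqe j n hn)
      · simpa using (tendsto_pow_atTop_nhds_zero_of_lt_one (r := (1 / 2 : ℝ)) (by norm_num)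
          (by norm_num)).mul_const ‖b‖
    obtain ⟨Q, -, hQ⟩ := exists_strong_limit (T := fun n => (q n).1) hq1 he
      fun x hx => (hqD x hx).cauchySeq
    have hQ0 : Q = 0 := ContinuousLinearMap.ext_on he fun x hx =>
      tendsto_nhds_unique (hQ x) (hqD x hx)
    intro x
    simpa [hQ0] using hQ x
  set r : ℕ → Adj E := fun n => star (p n) * u n * p n with hr
  have hrs : ∀ n, star (r n) = r n := fun n => by
    simp only [hr, star_mul, star_star, hus, mul_assoc]
  have hug : ∀ n g, conjAct E g (u n) = u n := fun n g => by rw [hu, conjAct_mul, hvg]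
  have hrg : ∀ n g, conjAct E g (r n) = r n := fun n g => by
    simp only [hr, conjAct_mul, conjAct_star, hpg, hug]
  have hrK : ∀ n, r n ∈ compactIdeal E := fun n => compactIdeal_mul_left _ (hpK n)
  -- The identity is used twice: positivity of its right side bounds the partial sums, and since q_n
  -- tends strongly to 0 it shows 1 - N = ∑ p_i*(1 - u_i)p_i strongly.
  have hremainder : ∀ n, 1 - ∑ i ∈ Finset.range n, r i =
      star (q n) * q n + ∑ i ∈ Finset.range n, star (p i) * (1 - u i) * p i := by
    intro n
    induction n with
    | zero => simp [hq0]
    | succ n ih =>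
      rw [Finset.sum_range_succ, Finset.sum_range_succ, ← sub_sub, ih, ← hsum n]
      simp only [hr]
      noncomm_ring
  have hbound : ∀ n, ‖∑ i ∈ Finset.range n, r i‖ ≤ 1 := by
    intro n
    refine norm_le_one_of_isPosElt (IsPosElt.sum fun i _ => ?_) ?_
    · have := (IsPosElt.mul_self (hvs i)).conj (p i)
      exact this
    · rw [hremainder]
      exact (IsPosElt.star_mul_self _).add (IsPosElt.sum fun i _ =>
        (isPosElt_one_sub_mul_self (hvs i) (hv1 i)).conj (p i))
  have hrD : ∀ x ∈ D, CauchySeq fun n => (∑ i ∈ Finset.range n, r i).1 x := by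
    rintro x ⟨j, b, rfl⟩
    have h1 : Summable fun n => ‖(r n).1 (E.act (e j) b)‖ :=
      summable_norm_of_le_half_pow ‖b‖ (j + 1) fun n hn => by
        have h2 : (r n).1 (E.act (e j) b) = (star (p n) * u n).1 (E.act ((p n).1 (e j)) b) := by
          rw [← (p n).isAdj_star.map_act]; rfl
        rw [h2]
        have h3 : ‖star (p n) * u n‖ ≤ 1 := (norm_mul_le_left (hps1 n)).trans (hu1 n)
        refine ((star (p n) * u n).1.le_opNorm _).trans ((mul_le_of_le_one_left (norm_nonneg _)
          h3).trans ((norm_act_le _ _).trans ?_))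
        rw [mul_comm]
        gcongr
        exact hpe j n hn
    have h2 := h1.of_norm.hasSum.tendsto_sum_nat.cauchySeq
    simpa only [Adj.sum_apply] using h2
  obtain ⟨N, hNs, hNg, hN1, hN⟩ := exists_adj_strong_limit
    (T := fun n => ∑ i ∈ Finset.range n, r i)
    (fun n => by rw [star_sum]; exact Finset.sum_congr rfl fun i _ => hrs i)
    (fun n g => by rw [map_sum]; exact Finset.sum_congr rfl fun i _ => hrg i g) hbound he hrD
  have hN' : ∀ x, Tendsto (fun n => ∑ i ∈ Finset.range n, (r i).1 x) atTop (𝓝 (N.1 x)) :=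
    fun x => by simpa only [Adj.sum_apply] using hN x
  -- the compact perturbation
  set d : ℕ → Adj E := fun n => v n * (star (p n) * p n) * v n - r n with hd
  have hdK : ∀ n, d n ∈ compactIdeal E := fun n =>
    (compactIdeal E).toSubmodule.sub_mem (compactIdeal_mul_right (compactIdeal_mul_left _
      (compactIdeal_mul_left _ (hpK n))) _) (hrK n)
  have hds : ∀ n, star (d n) = d n := fun n => by
    simp only [hd, star_sub, hrs, star_mul, star_star, hvs, mul_assoc]
  have hdg : ∀ n g, conjAct E g (d n) = d n := fun n g => by
    simp only [hd, map_sub, hrg, conjAct_mul, conjAct_star, hpg, hvg]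
  have hdn : Summable d := (summable_norm_of_le_half_pow 2 0 fun n _ => by
    have h1 : d n = star (p n * v n - v n * p n) * (p n * v n)
        + star (p n) * v n * (p n * v n - v n * p n) := by
      simp only [hd, hr, hu, star_sub, star_mul, hvs]
      noncomm_ring
    rw [h1]
    have h2 : ‖p n * v n‖ ≤ 1 := (norm_mul_le_left (hp1 n)).trans (hv1 n)
    have h3 : ‖star (p n) * v n‖ ≤ 1 := (norm_mul_le_left (hps1 n)).trans (hv1 n)
    have h4 := norm_mul_le_right (x := star (p n * v n - v n * p n)) h2
    have h5 := norm_mul_le_left (x := p n * v n - v n * p n) h3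
    rw [norm_star] at h4
    linarith [norm_add_le (star (p n * v n - v n * p n) * (p n * v n))
      (star (p n) * v n * (p n * v n - v n * p n)), hpv n]).of_norm
  refine ⟨N, N + ∑' n, d n, ⟨hNs, hNg, hN1, fun j => ?_, fun j => ?_, fun j => ?_⟩, ?_, fun g => ?_,
    ?_, fun x => ?_⟩
  · refine mem_compacts_of_tendsto_sum (R := fun i => (star (p i) * (1 - u i) * p i * y j).1)
      (fun i => compactIdeal_mul_right (compactIdeal_mul_left _ (hpK i)) _)
      (summable_norm_of_le_half_pow 4 j fun n hn => ?_) fun x => ?_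
    · change ‖star (p n) * (1 - u n) * p n * y j‖ ≤ _
      -- Commute y_j past p_n, then use (1 - v²)y = (y - vy) + v(y - vy).
      have e1 : star (p n) * (1 - u n) * p n * y j
          = star (p n) * ((1 - u n) * (p n * y j - y j * p n))
            + star (p n) * ((y j - v n * y j) + v n * (y j - v n * y j)) * p n := by
        simp only [hu]; noncomm_ring
      rw [e1]
      have h1 := norm_mul_le_left (x := (1 - u n) * (p n * y j - y j * p n)) (hps1 n)
      have h2 : ‖(1 - u n) * (p n * y j - y j * p n)‖ ≤ 2 * (1 / 2) ^ n := by
        refine (norm_mul_le _ _).trans ?_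
        have h3 : ‖1 - u n‖ ≤ 2 := by
          have := norm_one_le_one (M := Adj E)
          linarith [norm_sub_le 1 (u n), hu1 n]
        exact mul_le_mul h3 (hpy n j hn) (norm_nonneg _) (by norm_num)
      have h3 := norm_mul_le_right
        (x := star (p n) * ((y j - v n * y j) + v n * (y j - v n * y j))) (hp1 n)
      have h4 := norm_mul_le_left (x := (y j - v n * y j) + v n * (y j - v n * y j)) (hps1 n)
      have h5 := norm_add_le (y j - v n * y j) (v n * (y j - v n * y j))
      have h6 := norm_mul_le_left (x := y j - v n * y j) (hv1 n)
      have h7 := hy n j hn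
      linarith [norm_add_le (star (p n) * ((1 - u n) * (p n * y j - y j * p n)))
        (star (p n) * ((y j - v n * y j) + v n * (y j - v n * y j)) * p n)]
    · set z := (y j).1 x with hz
      have h1 : Tendsto (fun n => z - (∑ i ∈ Finset.range n, r i).1 z - (star (q n) * q n).1 z)
          atTop (𝓝 (z - N.1 z - 0)) := by
        refine (tendsto_const_nhds.sub (hN z)).sub (squeeze_zero_norm (fun n => ?_)
          (tendsto_zero_iff_norm_tendsto_zero.1 (hq z)))
        refine ((star (q n)).1.le_opNorm _).trans (mul_le_of_le_one_left (norm_nonneg _) ?_)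
        exact (norm_star (q n)).trans_le (hq1 n)
      rw [sub_zero] at h1
      refine h1.congr fun n => ?_
      have h2 := congrArg (fun T : Adj E => T.1 z) (hremainder n)
      change z - (∑ i ∈ Finset.range n, r i).1 z = (star (q n) * q n).1 z +
        (∑ i ∈ Finset.range n, star (p i) * (1 - u i) * p i).1 z at h2
      rw [h2, add_sub_cancel_left, Adj.sum_apply]
      rfl
  · refine mem_compacts_of_tendsto_sum (R := fun i => (r i * m j - m j * r i).1)
      (fun i => (compactIdeal E).toSubmodule.sub_mem (compactIdeal_mul_right (hrK i) _)
        (compactIdeal_mul_left _ (hrK i)))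
      (summable_norm_of_le_half_pow 4 j fun n hn => ?_) fun x => ?_
    · change ‖r n * m j - m j * r n‖ ≤ _
      set c := v n * m j - m j * v n with hc
      have e1 : r n * m j - m j * r n = star (p n) * u n * (p n * m j - m j * p n)
          + (star (p n) * (v n * c + c * v n) * p n
            + (star (p n) * m j - m j * star (p n)) * (u n * p n)) := by
        -- Leibniz rule for [p* v² p, m]: every resulting term contains [p*, m], [v, m] or [p, m].
        simp only [hr, hu, hc]; noncomm_ring
      rw [e1]
      have h1 := norm_mul_le_left (x := p n * m j - m j * p n)
        ((norm_mul_le_left (hps1 n)).trans (hu1 n))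
      have h2 := norm_mul_le_right (x := star (p n) * (v n * c + c * v n)) (hp1 n)
      have h3 := norm_mul_le_left (x := v n * c + c * v n) (hps1 n)
      have h4 := norm_add_le (v n * c) (c * v n)
      have h5 := norm_mul_le_left (x := c) (hv1 n)
      have h6 := norm_mul_le_right (x := c) (hv1 n)
      have h7 := norm_mul_le_right (x := star (p n) * m j - m j * star (p n))
        ((norm_mul_le_left (hu1 n)).trans (hp1 n))
      have h8 := hm n j hn
      rw [← hc] at h8
      have h9 := norm_add_le (star (p n) * (v n * c + c * v n) * p n)
        ((star (p n) * m j - m j * star (p n)) * (u n * p n))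
      linarith [norm_add_le (star (p n) * u n * (p n * m j - m j * p n))
        (star (p n) * (v n * c + c * v n) * p n
          + (star (p n) * m j - m j * star (p n)) * (u n * p n)), hpm n j hn, hpm' n j hn]
    · have h1 := (hN' ((m j).1 x)).sub (((m j).1.continuous.tendsto _).comp (hN' x))
      refine h1.congr fun n => ?_
      change _ - (m j).1 (∑ i ∈ Finset.range n, (r i).1 x) = _
      rw [map_sum, ← Finset.sum_sub_distrib]
      rfl
  · refine mem_compacts_of_tendsto_sum (R := fun i => (r i).1 ∘L f j)
      (fun i => (hf j).mem_comp (hrK i))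
      (summable_norm_of_le_half_pow (2 * ‖f j‖ + 1) (j + 1) fun n hn => ?_)
      fun x => hN' (f j x)
    -- Only p_n u_n f_j is known to be small, so u_n is moved past p_n at the cost of a small
    -- commutator.
    have e1 : (r n).1 ∘L f j = (star (p n)).1 ∘L ((p n).1 ∘L (u n).1 ∘L f j
        + (u n * p n - p n * u n).1 ∘L f j) := by
      ext x
      change (star (p n)).1 ((u n).1 ((p n).1 (f j x))) = (star (p n)).1
        ((p n).1 ((u n).1 (f j x)) + ((u n).1 ((p n).1 (f j x)) - (p n).1 ((u n).1 (f j x))))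
      rw [add_sub_cancel]
    have h1 : ‖u n * p n - p n * u n‖ ≤ 2 * (1 / 2) ^ n := by
      have e2 : u n * p n - p n * u n
          = -(v n * (p n * v n - v n * p n) + (p n * v n - v n * p n) * v n) := by
        simp only [hu]; noncomm_ring
      rw [e2, norm_neg]
      have h5 := norm_mul_le_left (x := p n * v n - v n * p n) (hv1 n)
      have h6 := norm_mul_le_right (x := p n * v n - v n * p n) (hv1 n)
      linarith [norm_add_le (v n * (p n * v n - v n * p n)) ((p n * v n - v n * p n) * v n), hpv n]
    rw [e1]
    refine (ContinuousLinearMap.opNorm_comp_le _ _).trans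
      ((mul_le_of_le_one_left (norm_nonneg _) (hps1 n)).trans ((norm_add_le _ _).trans ?_))
    have h2 : ‖(u n * p n - p n * u n).1 ∘L f j‖ ≤ 2 * (1 / 2) ^ n * ‖f j‖ :=
      (ContinuousLinearMap.opNorm_comp_le _ _).trans (by gcongr; exact h1)
    linarith [hpf j n hn]
  · rw [star_add, hNs, tsum_star]
    simp_rw [hds]
  · rw [map_add, hNg, (conjAct E g).map_tsum hdn]
    simp_rw [hdg]
  · rw [add_sub_cancel_left]
    exact isClosed_compactIdeal.mem_of_tendsto hdn.hasSum.tendsto_sum_nat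
      (Eventually.of_forall fun n => sum_mem fun i _ => hdK i)
  · have h1 : Tendsto (fun n => (∑ i ∈ Finset.range n, d i).1 x) atTop (𝓝 ((∑' n, d n).1 x)) :=
      ((ContinuousLinearMap.apply k E x).continuous.tendsto _).comp
        ((continuous_subtype_val.tendsto _).comp hdn.hasSum.tendsto_sum_nat)
    refine hW.mem_of_tendsto ((hN x).add h1) (Eventually.of_forall fun n => ?_)
    change (∑ i ∈ Finset.range n, r i).1 x + (∑ i ∈ Finset.range n, d i).1 x ∈ W
    rw [Adj.sum_apply, Adj.sum_apply, ← Finset.sum_add_distrib]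
    refine W.sum_mem fun i _ => ?_
    have h2 : (r i).1 x + (d i).1 x = (v i).1 ((star (p i) * p i * v i).1 x) := by
      change (r i).1 x + ((v i * (star (p i) * p i) * v i).1 x - (r i).1 x) = _
      rw [add_sub_cancel]; rfl
    rw [h2]
    exact hvW i _

end HilbertModule

/-! ### Approximate units of ideals -/

section Unitization

variable {k : Type uk} {A : Type uA} [RCLike k] [NonUnitalNormedRing A] [StarRing A]
  [NormedSpace k A] [IsScalarTower k A A] [SMulCommClass k A A] [StarModule k A] [IsCStar A]

/-- The products xc and yc lie in A, where the C*-inequality is known, and (xc)*(xc) + (yc)*(yc) =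
c*(x*x + y*y)c. -/
theorem Unitization.norm_mul_inr_sq_le (x y : Unitization k A) (c : A) :
    ‖x * (c : Unitization k A)‖ ^ 2 ≤ ‖star x * x + star y * y‖ * ‖c‖ ^ 2 := by
  have hmem : ∀ z : Unitization k A, ∃ d : A, z * (c : Unitization k A) = (d : Unitization k A) :=
    fun z => ⟨z.fst • c + z.snd * c, by ext <;> simp⟩
  obtain ⟨a, ha⟩ := hmem x
  obtain ⟨b, hb⟩ := hmem y
  have e : ((star a * a + star b * b : A) : Unitization k A)
      = star (c : Unitization k A) * (star x * x + star y * y) * (c : Unitization k A) := by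
    rw [Unitization.inr_add, Unitization.inr_mul, Unitization.inr_mul, Unitization.inr_star,
      Unitization.inr_star, ← ha, ← hb, star_mul, star_mul]
    noncomm_ring
  have h := IsCStar.norm_sq_le a b
  rw [← Unitization.norm_inr (𝕜 := k) a, ← ha,
    ← Unitization.norm_inr (𝕜 := k) (star a * a + star b * b), e] at h
  refine h.trans ((norm_mul_le _ _).trans ?_)
  have h2 : ‖star (c : Unitization k A)‖ = ‖c‖ := by rw [norm_star, Unitization.norm_inr]
  rw [Unitization.norm_inr]
  calc _ ≤ ‖star (c : Unitization k A)‖ * ‖star x * x + star y * y‖ * ‖c‖ := by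
        gcongr; exact norm_mul_le _ _
    _ = _ := by rw [h2]; ring

/-- The norm is the maximum of the modulus of the scalar part and the norm of left multiplication on
A, so the inequality is checked on each. This makes the unital theory of `IsPosElt` available for A.
-/
instance Unitization.instIsCStar : IsCStar (Unitization k A) where
  norm_sq_le x y := by
    set X := star x * x + star y * y with hX
    have h : ‖x‖ ≤ √‖X‖ := by
      rw [Unitization.norm_def, Unitization.splitMul_apply, Prod.norm_def]
      refine max_le ?_ (ContinuousLinearMap.opNorm_le_bound _ (Real.sqrt_nonneg _) fun c => ?_)
      · refine Real.le_sqrt_of_sq_le ?_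
        have h1 : X.fst = ((‖x.fst‖ ^ 2 + ‖y.fst‖ ^ 2 : ℝ) : k) := by
          rw [hX]
          simp [RCLike.conj_mul]
        have h2 : ‖X.fst‖ ≤ ‖X‖ := by
          rw [Unitization.norm_def X, Unitization.splitMul_apply, Prod.norm_def]
          exact le_max_left _ _
        refine le_trans ?_ h2
        rw [h1, RCLike.norm_ofReal, abs_of_nonneg (by positivity)]
        exact le_add_of_nonneg_right (sq_nonneg _)
      · have h1 := Unitization.norm_mul_inr_sq_le x y c
        have h2 : x * (c : Unitization k A) = ((x.fst • c + x.snd * c : A) : Unitization k A) := by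
          ext <;> simp
        rw [h2, Unitization.norm_inr] at h1
        refine le_of_sq_le_sq ?_ (by positivity)
        rw [mul_pow, Real.sq_sqrt (norm_nonneg X)]
        exact h1
    calc ‖x‖ ^ 2 ≤ √‖X‖ ^ 2 := by gcongr
      _ = _ := Real.sq_sqrt (norm_nonneg X)

/-- Approximate units in closed `*`-subalgebras of a C*-algebra that need not be unital. -/
theorem exists_approx_unit_of_closed (k : Type uk) {A : Type uA} [RCLike k]
    [NonUnitalNormedRing A] [StarRing A] [NormedSpace k A] [IsScalarTower k A A]
    [SMulCommClass k A A] [StarModule k A] [IsCStar A] [CompleteSpace A]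
    (J : NonUnitalSubalgebra k A) (hJ : IsClosed (J : Set A)) (hstar : ∀ x ∈ J, star x ∈ J)
    (s : Finset A) (hs : ∀ x ∈ s, x ∈ J) {ε : ℝ} (hε : 0 < ε) :
    ∃ e ∈ J, star e = e ∧ ‖e‖ ≤ 1 ∧ ∀ x ∈ s, ‖x - e * x‖ ≤ ε := by
  classical
  let : NormedAlgebra ℝ (Unitization k A) := NormedAlgebra.restrictScalars ℝ k (Unitization k A)
  have hsm : ∀ (c : ℝ) (x : Unitization k A), c • x = (c : k) • x := fun _ _ => rfl
  have : StarModule ℝ (Unitization k A) := ⟨fun c x => by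
    rw [hsm, hsm, star_smul, RCLike.star_def, RCLike.conj_ofReal]; rfl⟩
  let I : NonUnitalSubalgebra ℝ (Unitization k A) :=
    { carrier := (fun a : A => (a : Unitization k A)) '' J
      zero_mem' := ⟨0, J.zero_mem, Unitization.inr_zero k⟩
      add_mem' := by
        rintro _ _ ⟨a, ha, rfl⟩ ⟨b, hb, rfl⟩
        exact ⟨a + b, J.add_mem ha hb, Unitization.inr_add k a b⟩
      mul_mem' := by
        rintro _ _ ⟨a, ha, rfl⟩ ⟨b, hb, rfl⟩
        exact ⟨a * b, J.mul_mem ha hb, Unitization.inr_mul k a b⟩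
      smul_mem' := by
        rintro c _ ⟨a, ha, rfl⟩
        exact ⟨(c : k) • a, J.toSubmodule.smul_mem _ ha, Unitization.inr_smul k (c : k) a⟩ }
  have hiso : Isometry (fun a : A => (a : Unitization k A)) := Unitization.isometry_inr
  have hI : IsClosed (I : Set (Unitization k A)) := hiso.isClosedEmbedding.isClosedMap _ hJ
  obtain ⟨_, ⟨e, he, rfl⟩, hes, he1, hex⟩ := exists_approx_unit I hI
    (by rintro _ ⟨a, ha, rfl⟩; exact ⟨star a, hstar a ha, Unitization.inr_star a⟩)
    (s.image fun a : A => (a : Unitization k A))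
    (by
      intro x hx
      obtain ⟨a, ha, rfl⟩ := Finset.mem_image.1 hx
      exact ⟨a, hs a ha, rfl⟩) hε
  refine ⟨e, he, ?_, ?_, fun x hx => ?_⟩
  · apply Unitization.inr_injective (R := k)
    rw [Unitization.inr_star]; exact hes
  · rwa [Unitization.norm_inr] at he1
  · have h := hex _ (Finset.mem_image.2 ⟨x, hx, rfl⟩)
    rwa [← Unitization.inr_mul, ← Unitization.inr_sub, Unitization.norm_inr] at h

end Unitization

namespace InvariantIdeal

variable {k : Type uk} {G : Type uG} {A : Type uA} [RCLike k] [Group G] [TopologicalSpace G]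
  [IsTopologicalGroup G] [CompactSpace G] [NonUnitalNormedRing A] [StarRing A] [NormedSpace k A]
  [IsScalarTower k A A] [SMulCommClass k A A] [StarModule k A] [CompleteSpace A] [IsCStar A]
  [DistribMulAction G A] [IsGAlgebra k G A]

/-- An invariant ideal has invariant approximate units that are quasicentral in the algebra. -/
theorem exists_quasicentral (J : InvariantIdeal k G A) (s m : Finset A)
    (hs : ∀ x ∈ s, x ∈ J.toNonUnitalStarSubalgebra) {ε : ℝ} (hε : 0 < ε) :
    ∃ e ∈ J.toNonUnitalStarSubalgebra, star e = e ∧ ‖e‖ ≤ 1 ∧ (∀ g : G, g • e = e) ∧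
      (∀ x ∈ s, ‖x - e * x‖ ≤ ε) ∧ ∀ a ∈ m, ‖e * a - a * e‖ ≤ ε := by
  let : NormedSpace ℝ A := NormedSpace.restrictScalars ℝ k A
  have hsm : ∀ (c : ℝ) (x : A), c • x = (c : k) • x := fun _ _ => rfl
  have : IsScalarTower ℝ A A := ⟨fun c x y => smul_mul_assoc (c : k) x y⟩
  have : SMulCommClass ℝ A A := ⟨fun c x y => (mul_smul_comm (c : k) x y).symm⟩
  have : StarModule ℝ A := ⟨fun c x => by
    rw [hsm, hsm, star_smul, RCLike.star_def, RCLike.conj_ofReal]; rfl⟩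
  let I : NonUnitalSubalgebra ℝ A :=
    { carrier := J.carrier
      zero_mem' := J.zero_mem'
      add_mem' := J.add_mem'
      mul_mem' := J.mul_mem'
      smul_mem' := fun c _ hx => J.smul_mem' (c : k) hx }
  have hI : IsClosed (I : Set A) := J.isClosed
  let α : G → A →L[ℝ] A := fun g => LinearMap.mkContinuous
    { toFun := fun x => g • x
      map_add' := smul_add g
      map_smul' := fun c x => IsGAlgebra.smul_comm g (c : k) x } 1 fun x => by
    rw [one_mul]; exact IsGAlgebra.norm_smul_le k g x
  obtain ⟨e, ⟨h1, h2, h3, h4⟩, h5, h6⟩ := _root_.exists_quasicentral I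
    (fun a x hx => J.mul_mem_left a x hx) (fun a x hx => J.mul_mem_right a x hx)
    (convex_invariant_contractions I α) (fun e he => he.1) (fun e he => ⟨he.2.1, he.2.2.1⟩)
    (fun s hs ε hε => exists_invariant_approx_unit I hI α (fun x => one_smul G x)
      (fun g h x => mul_smul g h x) (fun g x y => IsGAlgebra.smul_mul k g x y)
      (fun g x => IsGAlgebra.smul_star k g x) (fun g x => IsGAlgebra.norm_smul_le k g x)
      (fun g x hx => J.g_smul_mem g x hx) (fun x _ => IsGAlgebra.continuous_smul k x)
      (fun s hs ε hε => exists_approx_unit_of_closed k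
        J.toNonUnitalStarSubalgebra.toNonUnitalSubalgebra J.isClosed
        (fun x hx => J.star_mem' hx) s hs hε) s hs hε) s m hs hε
  exact ⟨e, h1, h2, h3, h4, h5, h6⟩

/-- A diagonal choice, with the tolerances 2⁻ⁿ that `exists_technical_operator` expects. -/
theorem exists_approx_unit_sequence (J : InvariantIdeal k G A) (x : ℕ → J.Alg) (a : ℕ → A) :
    ∃ e : ℕ → J.Alg, (∀ n, star (e n) = e n) ∧ (∀ n, ‖e n‖ ≤ 1) ∧ (∀ n (g : G), g • e n = e n) ∧
      (∀ n, ∀ j ≤ n, ‖x j - e n * x j‖ ≤ (1 / 2) ^ n) ∧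
      ∀ n, ∀ j ≤ n, ‖(e n : A) * a j - a j * e n‖ ≤ (1 / 2) ^ n := by
  classical
  have h := fun n : ℕ => J.exists_quasicentral
    ((Finset.range (n + 1)).image fun j => (x j : A)) ((Finset.range (n + 1)).image a)
    (by
      intro y hy
      obtain ⟨j, -, rfl⟩ := Finset.mem_image.1 hy
      exact (x j).2) (ε := (1 / 2) ^ n) (by positivity)
  choose e heJ hes he1 heg hex hea using h
  exact ⟨fun n => ⟨e n, heJ n⟩, fun n => Subtype.ext (hes n), he1, fun n g => Subtype.ext (heg n g),
    fun n j hj => hex n _ (Finset.mem_image.2 ⟨j, Finset.mem_range.2 (by omega), rfl⟩),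
    fun n j hj => hea n _ (Finset.mem_image.2 ⟨j, Finset.mem_range.2 (by omega), rfl⟩)⟩

end InvariantIdeal

/-! ### Lifting morphisms from the ideal to the algebra -/

namespace RepCat

open HilbertModule

section Rep

variable {k : Type uk} {G : Type uG} {A : Type uA} {B : Type uB} [RCLike k] [Group G]
    [TopologicalSpace G] [NonUnitalNormedRing A] [StarRing A] [NormedSpace k A] [SMul G A]
    [NonUnitalNormedRing B] [StarRing B] [NormedSpace k B] [DistribMulAction G B]
    [StarModule k B] [IsCStar B] [IsScalarTower k B B] [SMulCommClass k B B] [CompleteSpace B]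

/-- The action of `a` as an adjointable operator. -/
def rep (X : RepCat.{uk, uG, uA, uB, uE} k G A B) (a : A) : Adj X.E :=
  ⟨X.φ a, X.φ (star a), X.isAdj a⟩

variable (X : RepCat.{uk, uG, uA, uB, uE} k G A B)

theorem star_rep (a : A) : star (X.rep a) = X.rep (star a) := Adj.star_eq (X.isAdj a)

theorem rep_mul (a b : A) : X.rep (a * b) = X.rep a * X.rep b := Subtype.ext (map_mul X.φ a b)

theorem rep_sub (a b : A) : X.rep (a - b) = X.rep a - X.rep b := Subtype.ext (map_sub X.φ a b)

theorem norm_rep_le [IsScalarTower k A A] [SMulCommClass k A A] [CompleteSpace A] [CStarRing A]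
    (a : A) : ‖X.rep a‖ ≤ ‖a‖ := norm_hom_le X.φ X.isAdj a

theorem continuous_rep [IsScalarTower k A A] [SMulCommClass k A A] [CompleteSpace A]
    [CStarRing A] : Continuous X.rep := by
  refine (LipschitzWith.of_dist_le_mul (K := 1) fun a b => ?_).continuous
  rw [dist_eq_norm, dist_eq_norm, ← rep_sub, NNReal.coe_one, one_mul]
  exact X.norm_rep_le _

theorem conjAct_rep [IsGAlgebra k G B] (g : G) (a : A) (h : g • a = a) :
    conjAct X.E g (X.rep a) = X.rep a :=
  Adj.ext_iff_apply.2 fun x => by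
    rw [conjAct_apply]
    have := X.equivariant g a (g⁻¹ • x)
    rw [h, smul_inv_smul] at this
    exact this.symm

end Rep

variable {k : Type uk} {G : Type uG} {A : Type uA} {B : Type uB} [RCLike k]
    [Group G] [TopologicalSpace G] [IsTopologicalGroup G] [CompactSpace G]
    [NonUnitalNormedRing A] [StarRing A] [NormedSpace k A] [IsScalarTower k A A]
    [SMulCommClass k A A] [StarModule k A] [CompleteSpace A] [IsCStar A]
    [TopologicalSpace.SeparableSpace A] [DistribMulAction G A] [IsGAlgebra k G A]
    [NonUnitalNormedRing B] [StarRing B] [NormedSpace k B] [IsScalarTower k B B]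
    [SMulCommClass k B B] [StarModule k B] [CompleteSpace B] [IsCStar B]
    [DistribMulAction G B] [IsGAlgebra k G B]
    (J : InvariantIdeal k G A)

theorem _root_.InvariantIdeal.exists_denseRange (J : InvariantIdeal k G A) :
    ∃ x : ℕ → J.Alg, DenseRange x := by
  have := UniformSpace.secondCountable_of_separable A
  exact ⟨TopologicalSpace.denseSeq J.Alg, TopologicalSpace.denseRange_denseSeq J.Alg⟩

instance : CompleteSpace J.Alg := J.isClosed.completeSpace_coe

instance : CStarRing J.Alg := ⟨fun x => CStarRing.norm_mul_self_le (x : A)⟩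

/-- Modulo `D(J, J; B)`, every morphism of `Rep(J; B)` between restricted objects is the restriction
of a morphism whose norm is not larger. -/
theorem exists_lift (X Y : RepCat.{uk, uG, uA, uB, uE} k G A B)
    (h : restrictObj J X ⟶ restrictObj J Y) :
    ∃ h' : X ⟶ Y, ‖h'‖ ≤ ‖h‖ ∧ h - restrictMap J h' ∈
      (RepCat.D (⊤ : NonUnitalStarSubalgebra k J.Alg)).hom (restrictObj J X) (restrictObj J Y) := by
  obtain ⟨x, hx⟩ := J.exists_denseRange
  set a := TopologicalSpace.denseSeq A
  have ha : DenseRange a := TopologicalSpace.denseRange_denseSeq A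
  obtain ⟨e, hes, he1, heg, hex, hea⟩ := J.exists_approx_unit_sequence x a
  let T : X.E →L[k] Y.E := op (X := restrictObj J X) (Y := restrictObj J Y) h
  obtain ⟨⟨T', hT'⟩, hTg, hTJ⟩ : (∃ T', IsAdj T T') ∧ IsInvariant T ∧
      ∀ x : J.Alg, T ∘L X.φ x - Y.φ x ∘L T ∈ compacts X.E Y.E := op_mem h
  let f : A → X.E →L[k] Y.E := fun a => T ∘L X.φ a - Y.φ a ∘L T
  have hfadj : ∀ a, IsAdj (f a) (X.φ (star a) ∘L T' - T' ∘L Y.φ (star a)) := fun a =>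
    ((X.isAdj a).comp hT').sub (hT'.comp (Y.isAdj a))
  -- y[T, b] = [T, yb] - [T, y]b, and both y and yb lie in the ideal J.
  have hef : ∀ (y : J.Alg) (b : A), (Y.rep y).1 ∘L f b ∈ compacts X.E Y.E := by
    intro y b
    have h1 := Submodule.sub_mem _ (hTJ ⟨y * b, J.mul_mem_right b y y.2⟩)
      ((X.isAdj b).mem_comp (hTJ y))
    convert h1 using 1
    ext z
    change Y.φ y (T (X.φ b z) - Y.φ b (T z)) = (T (X.φ (y * b) z) - Y.φ (y * b) (T z)) -
      (T (X.φ y (X.φ b z)) - Y.φ y (T (X.φ b z)))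
    rw [map_mul, map_mul, map_sub]
    change _ = (T (X.φ y (X.φ b z)) - Y.φ y (Y.φ b (T z))) - _
    abel
  -- Dense sequences suffice: the three compactness properties of N are closed conditions and extend
  -- to all of J and A by continuity. No range condition is needed, so `W` is everything.
  obtain ⟨N, -, ⟨hNs, hNg, hN1, hNx, hNa, hNf⟩, -⟩ := exists_technical_operator (E := Y.E)
    (v := fun n => Y.rep (e n : A))
    (fun n => by rw [star_rep]; exact congrArg Y.rep (congrArg Subtype.val (hes n)))
    (fun n g => Y.conjAct_rep g _ (congrArg Subtype.val (heg n g)))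
    (fun n => (Y.norm_rep_le _).trans (he1 n))
    (fun j => Y.rep (x j : A)) (fun j => Y.rep (a j))
    (f := fun j => f (a j)) (fun j => hfadj (a j))
    (fun n j hj => by
      rw [← rep_mul, ← rep_sub]; exact (Y.norm_rep_le _).trans (hex n j hj))
    (fun n j hj => by
      rw [← rep_mul, ← rep_mul, ← rep_sub]; exact (Y.norm_rep_le _).trans (hea n j hj))
    (fun n j => hef (e n) (a j)) ⊤ isClosed_univ (fun _ _ => trivial)
  have hrc : Continuous Y.rep := Y.continuous_rep
  have hNx' : ∀ y : J.Alg, Y.rep y - N * Y.rep y ∈ compactIdeal Y.E := fun y =>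
    hx.induction_on y (isClosed_compactIdeal.preimage (by fun_prop)) hNx
  have hNx'' : ∀ y : J.Alg, Y.rep y - Y.rep y * N ∈ compactIdeal Y.E := fun y => by
    have := compactIdeal_star (hNx' (star y))
    rw [star_sub, star_mul, star_rep, hNs] at this
    change Y.rep (star (star (y : A))) - Y.rep (star (star (y : A))) * N ∈ _ at this
    rwa [star_star] at this
  have hNa' : ∀ b, N * Y.rep b - Y.rep b * N ∈ compactIdeal Y.E := fun b =>
    ha.induction_on b (isClosed_compactIdeal.preimage (by fun_prop)) hNa
  have hfc : Continuous f := by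
    have h1 : Continuous fun b => X.φ b :=
      continuous_subtype_val.comp (X.continuous_rep)
    have h2 : Continuous fun b => Y.φ b := continuous_subtype_val.comp hrc
    fun_prop
  have hNf' : ∀ b, N.1 ∘L f b ∈ compacts X.E Y.E := fun b =>
    ha.induction_on b ((Submodule.isClosed_topologicalClosure _).preimage (by fun_prop)) hNf
  have hmem : N.1 ∘L T ∈ homs X Y := by
    refine ⟨⟨_, hT'.comp N.isAdj_star⟩, fun g z => ?_, fun b => ?_⟩
    · change N.1 (T (g • z)) = g • N.1 (T z)
      rw [hTg, conjAct_eq_iff.1 hNg]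
    -- [NT, b] = N[T, b] + [N, b]T.
    · have h1 := Submodule.add_mem _ (hNf' b) (hT'.mem_comp (hNa' b))
      convert h1 using 1
      ext z
      change N.1 (T (X.φ b z)) - Y.φ b (N.1 (T z)) = N.1 (T (X.φ b z) - Y.φ b (T z)) +
        (N.1 (Y.φ b (T z)) - Y.φ b (N.1 (T z)))
      rw [map_sub]; abel
  refine ⟨⟨N.1 ∘L T, hmem⟩, ?_, fun y _ => ⟨?_, ?_⟩⟩
  · exact (ContinuousLinearMap.opNorm_comp_le _ _).trans
      (mul_le_of_le_one_left (norm_nonneg _) hN1)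
  · change (T - N.1 ∘L T) ∘L X.φ y ∈ compacts X.E Y.E
    -- (1 - N)Ty = (1 - N)[T, y] + (1 - N)yT.
    have h1 := Submodule.add_mem _ ((1 - N).mem_compacts_mul_left (hTJ y)) (hT'.mem_comp (hNx' y))
    convert h1 using 1
    ext z
    change T (X.φ y z) - N.1 (T (X.φ y z)) = ((T (X.φ y z) - Y.φ y (T z)) -
      N.1 (T (X.φ y z) - Y.φ y (T z))) + (Y.φ y (T z) - N.1 (Y.φ y (T z)))
    rw [map_sub]; abel
  · change Y.φ y ∘L (T - N.1 ∘L T) ∈ compacts X.E Y.E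
    have h1 := hT'.mem_comp (hNx'' y)
    convert h1 using 1
    ext z
    change Y.φ y (T z - N.1 (T z)) = Y.φ y (T z) - Y.φ y (N.1 (T z))
    rw [map_sub]

end RepCat

/-! ### Closed submodules of Hilbert modules -/

section DenseSpan

variable {k V : Type*} [RCLike k] [NormedAddCommGroup V] [NormedSpace k V]

theorem Submodule.mem_of_dense_span {p : Submodule k V} (hp : IsClosed (p : Set V)) {D : Set V}
    (hD : Dense (Submodule.span k D : Set V)) (h : D ⊆ p) (x : V) : x ∈ p :=
  closure_minimal (Submodule.span_le.2 h) hp (hD x)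

theorem Submodule.dense_span_subtype {W : Submodule k V} {D : Set V} (hD : D ⊆ W)
    (h : W ≤ (Submodule.span k D).topologicalClosure) :
    Dense (Submodule.span k {w : W | (w : V) ∈ D} : Set W) := by
  refine Subtype.dense_iff.2 ?_
  have h1 : Subtype.val '' (Submodule.span k {w : W | (w : V) ∈ D} : Set W)
      = (Submodule.span k D : Set V) := by
    have h2 : (Submodule.span k {w : W | (w : V) ∈ D}).map W.subtype = Submodule.span k D := by
      rw [Submodule.map_span]
      congr 1
      ext z
      exact ⟨fun ⟨w, hw, e⟩ => e ▸ hw, fun hz => ⟨⟨z, hD hz⟩, hz, rfl⟩⟩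
    rw [← h2]; rfl
  have h3 : (W : Set V) ⊆ closure (Submodule.span k D : Set V) := h
  rw [← h1] at h3
  exact h3

end DenseSpan

namespace HilbertModule

variable {k : Type uk} {G : Type uG} {B : Type uB} [RCLike k] [Group G]
    [TopologicalSpace G] [NonUnitalNormedRing B] [StarRing B] [NormedSpace k B]
    [DistribMulAction G B]

/-- A closed invariant submodule of a Hilbert module, as a Hilbert module. -/
def ofSubmodule (E : HilbertModule.{uk, uG, uB, uE} k G B) (W : Submodule k E)
    (hW : IsClosed (W : Set E)) (hb : ∀ x ∈ W, ∀ b, E.act x b ∈ W)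
    (hg : ∀ (g : G), ∀ x ∈ W, g • x ∈ W)
    (hc : ∃ s : Set W, s.Countable ∧ Dense (Submodule.span k
      {z : W | ∃ x ∈ s, ∃ b : B, z = ⟨E.act x b, hb x x.2 b⟩} : Set W)) :
    HilbertModule.{uk, uG, uB, uE} k G B where
  carrier := W
  completeSpace := hW.completeSpace_coe
  distribMulAction :=
    { smul := fun g x => ⟨g • (x : E), hg g x x.2⟩
      one_smul := fun x => Subtype.ext (one_smul G (x : E))
      mul_smul := fun g h x => Subtype.ext (mul_smul g h (x : E))
      smul_zero := fun g => Subtype.ext (smul_zero g)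
      smul_add := fun g x y => Subtype.ext (smul_add g (x : E) y) }
  act := LinearMap.mk₂ k (fun x b => ⟨E.act x b, hb x x.2 b⟩)
    (fun x y b => Subtype.ext (LinearMap.map_add₂ E.act (x : E) y b))
    (fun c x b => Subtype.ext (LinearMap.map_smul₂ E.act c (x : E) b))
    (fun x b c => Subtype.ext (map_add (E.act x) b c))
    (fun c x b => Subtype.ext (map_smul (E.act x) c b))
  act_mul x b c := Subtype.ext (E.act_mul x b c)
  inner x y := E.inner x y
  inner_add x y z := E.inner_add x y z
  inner_smul x c y := E.inner_smul x c y
  inner_act x y b := E.inner_act x y b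
  star_inner x y := E.star_inner x y
  inner_self x := E.inner_self x
  norm_sq x := E.norm_sq x
  g_smul_comm g c x := Subtype.ext (E.g_smul_comm g c x)
  g_smul_act g x b := Subtype.ext (E.g_smul_act g x b)
  g_smul_inner g x y := E.g_smul_inner g x y
  continuous_g_smul x := (E.continuous_g_smul x).subtype_mk _
  countablyGenerated := hc

/-- `ι` is isometric, compatible with the actions of `B` and `G`, and operators with range in `W`
factor through it. -/
structure IsInclusion {E' E : HilbertModule.{uk, uG, uB, uE} k G B} (ι : E' →L[k] E)
    (W : Submodule k E) : Prop where
  inner_map : ∀ x y, E.inner (ι x) (ι y) = E'.inner x y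
  map_g_smul : ∀ (g : G) x, ι (g • x) = g • ι x
  map_act : ∀ x b, ι (E'.act x b) = E.act (ι x) b
  exists_lift : ∀ {F : HilbertModule.{uk, uG, uB, uE} k G B} (T : F →L[k] E), (∀ x, T x ∈ W) →
    ∃ T' : F →L[k] E', ∀ x, ι (T' x) = T x
  dense : ∀ D : Set E, D ⊆ W → W ≤ (Submodule.span k D).topologicalClosure →
    Dense (Submodule.span k {w : E' | ι w ∈ D} : Set E')

/-- Later arguments use only the properties in `IsInclusion`, so the construction on the subtype
need not be unfolded. -/
theorem exists_isInclusion (E : HilbertModule.{uk, uG, uB, uE} k G B) (W : Submodule k E)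
    (hW : IsClosed (W : Set E)) (hb : ∀ x ∈ W, ∀ b, E.act x b ∈ W)
    (hg : ∀ (g : G), ∀ x ∈ W, g • x ∈ W)
    (hc : ∃ s : Set W, s.Countable ∧ Dense (Submodule.span k
      {z : W | ∃ x ∈ s, ∃ b : B, z = ⟨E.act x b, hb x x.2 b⟩} : Set W)) :
    ∃ (E' : HilbertModule.{uk, uG, uB, uE} k G B) (ι : E' →L[k] E), IsInclusion ι W :=
  ⟨ofSubmodule E W hW hb hg hc, W.subtypeL,
    { inner_map := fun _ _ => rfl
      map_g_smul := fun _ _ => rfl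
      map_act := fun _ _ => rfl
      exists_lift := fun T hT => ⟨T.codRestrict W hT, fun _ => rfl⟩
      dense := fun _ hD h => Submodule.dense_span_subtype hD h }⟩

namespace IsInclusion

variable {E' E : HilbertModule.{uk, uG, uB, uE} k G B} {ι : E' →L[k] E} {W : Submodule k E}

theorem norm_map (h : IsInclusion ι W) (x : E') : ‖ι x‖ = ‖x‖ := by
  have h1 : ‖ι x‖ ^ 2 = ‖x‖ ^ 2 := by rw [E.norm_sq, E'.norm_sq, h.inner_map]
  exact (pow_left_inj₀ (norm_nonneg _) (norm_nonneg _) two_ne_zero).1 h1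

theorem injective (h : IsInclusion ι W) : Function.Injective ι := fun x y hxy => by
  have h1 := h.norm_map (x - y)
  rw [map_sub, hxy, sub_self, norm_zero] at h1
  exact sub_eq_zero.1 (norm_eq_zero.1 h1.symm)

variable [IsScalarTower k B B] [SMulCommClass k B B] [CompleteSpace B] [IsCStar B]
  [StarModule k B] [IsGAlgebra k G B] [IsTopologicalGroup G] [CompactSpace G]

/-- A compact operator with range in a submodule is compact as an operator to the submodule. -/
theorem mem_compacts (h : IsInclusion ι W) {T : Adj E} (hT : T ∈ compactIdeal E) {S : E →L[k] E'}
    (hS : ∀ x, ι (S x) = T.1 x) : S ∈ compacts E E' := by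
  refine Metric.mem_closure_iff.2 fun ε hε => ?_
  -- Rank one approximants of T need not have range in `W`. Instead S is approximated by Se, which
  -- is compact into E' because e is compact and S is B-linear; the error is that of Te, as ι is
  -- isometric.
  obtain ⟨e, heK, hes, -, -, het, -⟩ := exists_compact_quasicentral {star T} ∅
    (by simpa using compactIdeal_star hT) (half_pos hε)
  have h1 : ‖T - T * e‖ ≤ ε / 2 := by
    have := het (star T) (Finset.mem_singleton_self _)
    rw [← norm_star] at this
    simpa [hes] using this
  have hSact : ∀ y b, S (E.act y b) = E'.act (S y) b := fun y b => h.injective (by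
    rw [h.map_act, hS, hS, T.isAdj_star.map_act])
  have h2 : S ∘L e.1 ∈ compacts E E' := comp_mem_compacts heK S hSact
  obtain ⟨R, hR, hRd⟩ := Metric.mem_closure_iff.1 h2 (ε / 2) (half_pos hε)
  refine ⟨R, hR, (dist_triangle _ (S ∘L e.1) _).trans_lt ?_⟩
  have h3 : dist S (S ∘L e.1) ≤ ε / 2 := by
    rw [dist_eq_norm]
    refine ContinuousLinearMap.opNorm_le_bound _ (by positivity) fun x => ?_
    have h4 : ι ((S - S ∘L e.1) x) = (T - T * e).1 x := by
      change ι (S x - S (e.1 x)) = T.1 x - T.1 (e.1 x)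
      rw [map_sub, hS, hS]
    rw [← h.norm_map, h4]
    exact ((T - T * e).1.le_opNorm x).trans (by gcongr; exact h1)
  linarith

end IsInclusion

theorem isAdj_of_dense [IsScalarTower k B B] [SMulCommClass k B B] [CompleteSpace B] [IsCStar B]
    [StarModule k B] {E F : HilbertModule.{uk, uG, uB, uE} k G B}
    {S : E →L[k] F} {T : F →L[k] E} {D : Set E} {D' : Set F}
    (hD : Dense (Submodule.span k D : Set E)) (hD' : Dense (Submodule.span k D' : Set F))
    (h : ∀ x ∈ D, ∀ y ∈ D', F.inner (S x) y = E.inner x (T y)) : IsAdj S T := by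
  have key : ∀ {E F : HilbertModule.{uk, uG, uB, uE} k G B} {S : E →L[k] F} {D : Set E} (y : F)
      (t : E), Dense (Submodule.span k D : Set E) → (∀ x ∈ D, F.inner y (S x) = E.inner t x) →
      ∀ x, F.inner y (S x) = E.inner t x := by
    intro E F S D y t hD h x
    let p : Submodule k E :=
      { carrier := {x | F.inner y (S x) = E.inner t x}
        zero_mem' := by
          change F.inner y (S 0) = E.inner t 0
          rw [map_zero, inner_zero, inner_zero]
        add_mem' := fun {a b} ha hb => by
          change F.inner y (S (a + b)) = E.inner t (a + b)
          rw [map_add, F.inner_add, E.inner_add, ha, hb]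
        smul_mem' := fun c a ha => by
          change F.inner y (S (c • a)) = E.inner t (c • a)
          rw [map_smul, F.inner_smul, E.inner_smul, ha] }
    have hp : IsClosed (p : Set E) := isClosed_eq
      ((continuous_inner_right F y).comp S.continuous) (continuous_inner_right E t)
    exact Submodule.mem_of_dense_span hp hD h x
  intro x y
  have h1 : ∀ y ∈ D', ∀ x, F.inner (S x) y = E.inner x (T y) := fun y hy x => by
    have := key (S := S) y (T y) hD (fun x hx => by
      rw [← F.star_inner, h x hx y hy, E.star_inner]) x
    rw [← F.star_inner, this, E.star_inner]
  exact (key (S := T) x (S x) hD' (fun y hy => (h1 y hy x).symm) y).symm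

end HilbertModule

/-! ### The essential submodule of a representation -/

namespace RepCat

open HilbertModule Filter Topology

variable {k : Type uk} {G : Type uG} {A : Type uA} {B : Type uB} [RCLike k]
    [Group G] [TopologicalSpace G] [IsTopologicalGroup G] [CompactSpace G]
    [NonUnitalNormedRing A] [StarRing A] [NormedSpace k A] [IsScalarTower k A A]
    [SMulCommClass k A A] [StarModule k A] [CompleteSpace A] [IsCStar A]
    [TopologicalSpace.SeparableSpace A] [DistribMulAction G A] [IsGAlgebra k G A]
    [NonUnitalNormedRing B] [StarRing B] [NormedSpace k B] [IsScalarTower k B B]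
    [SMulCommClass k B B] [StarModule k B] [CompleteSpace B] [IsCStar B]
    [DistribMulAction G B] [IsGAlgebra k G B]
    {J : InvariantIdeal k G A}

/-- The vectors `φ(x) z`. -/
def essentialVectors (Y : RepCat.{uk, uG, uA, uB, uE} k G J.Alg B) : Set Y.E :=
  {w | ∃ (x : J.Alg) (z : Y.E), w = Y.φ x z}

/-- The closed span of the vectors `φ(x) z`. -/
def essential (Y : RepCat.{uk, uG, uA, uB, uE} k G J.Alg B) : Submodule k Y.E :=
  (Submodule.span k Y.essentialVectors).topologicalClosure

variable (Y : RepCat.{uk, uG, uA, uB, uE} k G J.Alg B)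

theorem isClosed_essential : IsClosed (Y.essential : Set Y.E) :=
  Submodule.isClosed_topologicalClosure _

theorem essentialVectors_subset : Y.essentialVectors ⊆ Y.essential :=
  Submodule.subset_span.trans (Submodule.le_topologicalClosure _)

theorem rep_mem_essential (x : J.Alg) (z : Y.E) : Y.φ x z ∈ Y.essential :=
  Y.essentialVectors_subset ⟨x, z, rfl⟩

theorem map_mem_essential (L : Y.E →L[k] Y.E) (h : ∀ x z, L (Y.φ x z) ∈ Y.essential) {w : Y.E}
    (hw : w ∈ Y.essential) : L w ∈ Y.essential := by
  have h1 : Y.essential ≤ Y.essential.comap (L : Y.E →ₗ[k] Y.E) :=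
    Submodule.topologicalClosure_minimal _
      (Submodule.span_le.2 (by rintro _ ⟨x, z, rfl⟩; exact h x z))
      (Y.isClosed_essential.preimage L.continuous)
  exact h1 hw

theorem act_mem_essential (w : Y.E) (hw : w ∈ Y.essential) (b : B) :
    Y.E.act w b ∈ Y.essential := by
  let L : Y.E →L[k] Y.E := LinearMap.mkContinuous (Y.E.act.flip b) ‖b‖ fun x => by
    rw [mul_comm]; exact norm_act_le x b
  exact Y.map_mem_essential L (fun x z => by
    change Y.E.act (Y.φ x z) b ∈ _
    rw [← (Y.isAdj x).map_act]
    exact Y.rep_mem_essential x _) hw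

theorem g_smul_mem_essential (g : G) (w : Y.E) (hw : w ∈ Y.essential) :
    g • w ∈ Y.essential :=
  Y.map_mem_essential (gOp Y.E g) (fun x z => by
    rw [gOp_apply, ← Y.equivariant]
    exact Y.rep_mem_essential _ _) hw

theorem essential_le_of_dense {x : ℕ → J.Alg} (hx : DenseRange x) {D : Set Y.E}
    (hD : ∀ j z, Y.φ (x j) z ∈ (Submodule.span k D).topologicalClosure) :
    Y.essential ≤ (Submodule.span k D).topologicalClosure := by
  refine Submodule.topologicalClosure_minimal _ (Submodule.span_le.2 ?_)
    (Submodule.isClosed_topologicalClosure _)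
  rintro _ ⟨y, z, rfl⟩
  have hc : Continuous fun y => Y.φ y z := by
    have : Continuous fun y => Y.φ y := continuous_subtype_val.comp Y.continuous_rep
    fun_prop
  exact hx.induction_on (p := fun y => Y.φ y z ∈ (Submodule.span k D).topologicalClosure) y
    ((Submodule.isClosed_topologicalClosure _).preimage hc) fun j => hD j z

/-- Countable generation is the point to check: for x_i dense in J and e_j generating E, the vectors
φ(x_i)e_j generate. -/
theorem exists_essential_inclusion :
    ∃ (E' : HilbertModule.{uk, uG, uB, uE} k G B) (ι : E' →L[k] Y.E),
      IsInclusion ι Y.essential := by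
  refine exists_isInclusion Y.E Y.essential Y.isClosed_essential Y.act_mem_essential
    Y.g_smul_mem_essential ?_
  obtain ⟨x, hx⟩ := J.exists_denseRange
  obtain ⟨e, he⟩ := exists_generating_sequence Y.E
  refine ⟨Set.range fun i : ℕ × ℕ =>
      (⟨Y.φ (x i.1) (e i.2), Y.rep_mem_essential _ _⟩ : Y.essential),
    Set.countable_range _, ?_⟩
  let D : Set Y.E := {z | ∃ i j, ∃ b : B, z = Y.E.act (Y.φ (x i) (e j)) b}
  have hD : D ⊆ Y.essential := by
    rintro _ ⟨i, j, b, rfl⟩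
    exact Y.act_mem_essential _ (Y.rep_mem_essential _ _) b
  have h := Submodule.dense_span_subtype hD (Y.essential_le_of_dense hx fun i z =>
    Submodule.mem_of_dense_span (p := (Submodule.span k D).topologicalClosure.comap
      (Y.φ (x i)).toLinearMap)
      ((Submodule.isClosed_topologicalClosure _).preimage (Y.φ (x i)).continuous) he (by
        rintro _ ⟨j, b, rfl⟩
        change Y.φ (x i) (Y.E.act (e j) b) ∈ (Submodule.span k D).topologicalClosure
        rw [(Y.isAdj (x i)).map_act]
        exact Submodule.le_topologicalClosure _ (Submodule.subset_span ⟨i, j, b, rfl⟩)) z)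
  refine h.mono (Submodule.span_mono ?_)
  rintro w ⟨i, j, b, hw⟩
  exact ⟨_, ⟨(i, j), rfl⟩, b, Subtype.ext hw⟩

end RepCat

/-! ### Extension of representations of an ideal -/

namespace RepCat

open HilbertModule Filter Topology

variable {k : Type uk} {G : Type uG} {A : Type uA} {B : Type uB} [RCLike k]
    [Group G] [TopologicalSpace G] [IsTopologicalGroup G] [CompactSpace G]
    [NonUnitalNormedRing A] [StarRing A] [NormedSpace k A] [IsScalarTower k A A]
    [SMulCommClass k A A] [StarModule k A] [CompleteSpace A] [IsCStar A]
    [TopologicalSpace.SeparableSpace A] [DistribMulAction G A] [IsGAlgebra k G A]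
    [NonUnitalNormedRing B] [StarRing B] [NormedSpace k B] [IsScalarTower k B B]
    [SMulCommClass k B B] [StarModule k B] [CompleteSpace B] [IsCStar B]
    [DistribMulAction G B] [IsGAlgebra k G B]
    {J : InvariantIdeal k G A}

theorem _root_.InvariantIdeal.exists_approx_unit_tendsto (J : InvariantIdeal k G A) :
    ∃ e : ℕ → J.Alg, (∀ n, ‖e n‖ ≤ 1) ∧ ∀ x, Tendsto (fun n => e n * x) atTop (𝓝 x) := by
  obtain ⟨x, hx⟩ := J.exists_denseRange
  obtain ⟨e, -, he1, -, hex, -⟩ := J.exists_approx_unit_sequence x 0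
  refine ⟨e, he1, fun y => Metric.tendsto_atTop.2 fun ε hε => ?_⟩
  obtain ⟨j, hj⟩ := hx.exists_dist_lt y (show 0 < ε / 3 by positivity)
  obtain ⟨n, hn⟩ := exists_pow_lt_of_lt_one (show 0 < ε / 3 by positivity)
    (show (1 / 2 : ℝ) < 1 by norm_num)
  refine ⟨max n j, fun m hm => ?_⟩
  have h1 : dist (e m * y) (e m * x j) ≤ dist y (x j) := by
    rw [dist_eq_norm, dist_eq_norm, ← mul_sub]
    exact (norm_mul_le _ _).trans (mul_le_of_le_one_left (norm_nonneg _) (he1 m))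
  have h2 : dist (e m * x j) (x j) < ε / 3 := by
    rw [dist_comm, dist_eq_norm]
    exact ((hex m j (le_of_max_le_right hm)).trans
      (pow_le_pow_of_le_one (by norm_num) (by norm_num) (le_of_max_le_left hm))).trans_lt hn
  have h3 := dist_triangle4 (e m * y) (e m * x j) (x j) y
  rw [dist_comm (x j) y] at h3
  linarith

variable (Y : RepCat.{uk, uG, uA, uB, uE} k G J.Alg B)

theorem map_mul_apply (x y : J.Alg) (z : Y.E) : Y.φ (x * y) z = Y.φ x (Y.φ y z) := by
  rw [map_mul]; rfl

/-- T is the strong limit of φ(ae_n) for an approximate unit (e_n) of J: the norms are at most ‖a‖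
and φ(ae_n)φ(x)z tends to φ(ax)z. Defining T as a limit avoids checking that φ(x)z ↦ φ(ax)z is well
defined. -/
theorem exists_extension_apply {E' : HilbertModule.{uk, uG, uB, uE} k G B} {ι : E' →L[k] Y.E}
    (hι : IsInclusion ι Y.essential) (a : A) :
    ∃ T : E' →L[k] E', ∀ (x : J.Alg) (z : Y.E) (w : E'), ι w = Y.φ x z →
      ι (T w) = Y.φ ⟨a * x, J.mul_mem_left a x x.2⟩ z := by
  obtain ⟨e, he1, hex⟩ := J.exists_approx_unit_tendsto
  let ae : ℕ → J.Alg := fun n => ⟨a * e n, J.mul_mem_left a (e n) (e n).2⟩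
  choose T hT using fun n => hι.exists_lift (Y.φ (ae n) ∘L ι) fun w => Y.rep_mem_essential _ _
  have hTn : ∀ n, ‖T n‖ ≤ ‖a‖ := fun n =>
    ContinuousLinearMap.opNorm_le_bound _ (norm_nonneg _) fun w => by
      rw [← hι.norm_map, hT, ← hι.norm_map w]
      refine ((Y.φ (ae n)).le_opNorm _).trans ?_
      exact mul_le_mul_of_nonneg_right ((Y.norm_rep_le (ae n)).trans
        ((norm_mul_le a (e n : A)).trans (mul_le_of_le_one_right (norm_nonneg _) (he1 n))))
        (norm_nonneg _)
  have hlim : ∀ (x : J.Alg) (z : Y.E) (w : E'), ι w = Y.φ x z →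
      Tendsto (fun n => ι (T n w)) atTop (𝓝 (Y.φ ⟨a * x, J.mul_mem_left a x x.2⟩ z)) := by
    intro x z w hw
    have hc : Continuous fun y : J.Alg => Y.φ ⟨a * y, J.mul_mem_left a y y.2⟩ z := by
      have h1 : Continuous fun y => Y.φ y := continuous_subtype_val.comp Y.continuous_rep
      have h2 : Continuous fun y : J.Alg =>
          (⟨a * y, J.mul_mem_left a y y.2⟩ : J.Alg) := by
        fun_prop
      exact (h1.comp h2).clm_apply continuous_const
    refine ((hc.tendsto x).comp (hex x)).congr fun n => ?_
    rw [hT]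
    change _ = Y.φ (ae n) (ι w)
    rw [hw, ← map_mul_apply]
    exact congrArg (fun y => Y.φ y z) (Subtype.ext (mul_assoc a (e n : A) x).symm)
  have hiso : Isometry ι := AddMonoidHomClass.isometry_of_norm _ hι.norm_map
  obtain ⟨S, -, hS⟩ := exists_strong_limit hTn (hι.dense _ Y.essentialVectors_subset le_rfl)
    (by
      rintro w ⟨x, z, hw⟩
      exact hiso.isUniformInducing.cauchy_map_iff.1 (hlim x z w hw).cauchySeq)
  exact ⟨S, fun x z w hw => tendsto_nhds_unique ((ι.continuous.tendsto _).comp (hS w))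
    (hlim x z w hw)⟩

/-- A representation of `J` extends to a representation of `A` on its essential submodule. -/
theorem exists_extension :
    ∃ (X : RepCat.{uk, uG, uA, uB, uE} k G A B) (ι : X.E →L[k] Y.E),
      IsInclusion ι Y.essential ∧ ∀ (x : J.Alg) w, ι (X.φ x w) = Y.φ x (ι w) := by
  obtain ⟨E', ι, hι⟩ := Y.exists_essential_inclusion
  choose T hT using Y.exists_extension_apply hι
  have hD := hι.dense _ Y.essentialVectors_subset le_rfl
  -- Operators on E' are determined on the vectors φ(x)z, so the algebraic laws for T reduce to
  -- identities between products ax in J.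
  have hext : ∀ {S S' : E' →L[k] E'},
      (∀ (x : J.Alg) (z : Y.E) (w : E'), ι w = Y.φ x z → ι (S w) = ι (S' w)) → S = S' :=
    fun {S S'} h => ContinuousLinearMap.ext_on hD fun w hw => by
      obtain ⟨x, z, hw⟩ := hw
      exact hι.injective (h x z w hw)
  let φ : A →ₙₐ[k] (E' →L[k] E') :=
    { toFun := T
      map_smul' := fun c a => hext fun x z w hw => by
        change _ = ι (c • T a w)
        rw [map_smul, hT _ x z w hw, hT _ x z w hw]
        exact (congrArg (fun y => Y.φ y z) (Subtype.ext (smul_mul_assoc c a (x : A)) :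
          _ = c • (⟨a * x, _⟩ : J.Alg))).trans (by rw [map_smul]; rfl)
      map_zero' := hext fun x z w hw => by
        change _ = ι 0
        rw [map_zero, hT _ x z w hw]
        exact (congrArg (fun y => Y.φ y z) (Subtype.ext (zero_mul (x : A)) :
          _ = (0 : J.Alg))).trans (by rw [map_zero]; rfl)
      map_add' := fun a b => hext fun x z w hw => by
        change _ = ι (T a w + T b w)
        rw [map_add, hT _ x z w hw, hT _ x z w hw, hT _ x z w hw]
        exact (congrArg (fun y => Y.φ y z) (Subtype.ext (add_mul a b (x : A)) :
          _ = (⟨a * x, _⟩ + ⟨b * x, _⟩ : J.Alg))).trans (by rw [map_add]; rfl)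
      map_mul' := fun a b => hext fun x z w hw => by
        change _ = ι (T a (T b w))
        rw [hT _ x z w hw, hT a _ z _ (hT b x z w hw)]
        exact congrArg (fun y => Y.φ y z) (Subtype.ext (mul_assoc a b (x : A))) }
  refine ⟨⟨E', φ, fun a => isAdj_of_dense hD hD ?_, fun g a w => ?_⟩, ι, hι, fun y w => ?_⟩
  · rintro w ⟨x, z, hw⟩ w' ⟨x', z', hw'⟩
    change E'.inner (T a w) w' = E'.inner w (T (star a) w')
    rw [← hι.inner_map, ← hι.inner_map, hT a x z w hw, hT _ x' z' w' hw', hw, hw', Y.isAdj,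
      Y.isAdj, ← map_mul_apply, ← map_mul_apply]
    refine congrArg (fun y => Y.E.inner z (Y.φ y z')) (Subtype.ext ?_)
    change star (a * (x : A)) * x' = star (x : A) * (star a * x')
    rw [star_mul, mul_assoc]
  · change T (g • a) (g • w) = g • T a w
    have h : T (g • a) ∘L gOp E' g = gOp E' g ∘L T a := hext fun x z w hw => by
      change ι (T (g • a) (g • w)) = ι (g • T a w)
      have h1 : ι (g • w) = Y.φ (g • x) (g • z) := by
        rw [hι.map_g_smul, hw, Y.equivariant]
      rw [hι.map_g_smul, hT a x z w hw, hT _ _ _ _ h1, ← Y.equivariant]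
      exact congrArg (fun y => Y.φ y (g • z))
        (Subtype.ext (IsGAlgebra.smul_mul k g a (x : A)).symm)
    exact congrArg (fun L : E' →L[k] E' => L w) h
  · have h : ι ∘L T (y : A) = Y.φ y ∘L ι := ContinuousLinearMap.ext_on hD fun w hw => by
      obtain ⟨x, z, hw⟩ := hw
      change ι (T y w) = Y.φ y (ι w)
      rw [hT _ x z w hw, hw, ← map_mul_apply]
      rfl
    exact congrArg (fun L : E' →L[k] Y.E => L w) h

end RepCat

/-! ### Every object of the quotient is unitarily isomorphic to a restricted one -/

namespace HilbertModule.IsInclusion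

variable {k : Type uk} {G : Type uG} {B : Type uB} [RCLike k] [Group G]
    [TopologicalSpace G] [NonUnitalNormedRing B] [StarRing B] [NormedSpace k B]
    [DistribMulAction G B] [IsScalarTower k B B] [SMulCommClass k B B] [CompleteSpace B]
    [IsCStar B] [StarModule k B] {E' E : HilbertModule.{uk, uG, uB, uE} k G B} {ι : E' →L[k] E}
    {W : Submodule k E}

/-- ι itself need not be adjointable, but its composite with the adjoint of an operator with range
in `W` is. -/
theorem isAdj_lift (h : IsInclusion ι W) {T : Adj E} {S : E →L[k] E'}
    (hS : ∀ x, ι (S x) = T.1 x) : IsAdj S ((star T).1 ∘L ι) := fun x y => by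
  rw [← h.inner_map, hS]
  exact T.inner_star x (ι y)

theorem comp_mem_compacts [IsGAlgebra k G B] [IsTopologicalGroup G] [CompactSpace G]
    (h : IsInclusion ι W) {T : Adj E} (hT : T ∈ compactIdeal E) {S : E →L[k] E'}
    (hS : ∀ x, ι (S x) = (star T).1 x) : T.1 ∘L ι ∈ compacts E' E := by
  have h1 := h.isAdj_lift hS
  rw [star_star] at h1
  exact compacts_adj h1 (h.mem_compacts (compactIdeal_star hT) hS)

end HilbertModule.IsInclusion

namespace RepCat

open HilbertModule Filter Topology

variable {k : Type uk} {G : Type uG} {A : Type uA} {B : Type uB} [RCLike k]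
    [Group G] [TopologicalSpace G] [IsTopologicalGroup G] [CompactSpace G]
    [NonUnitalNormedRing A] [StarRing A] [NormedSpace k A] [IsScalarTower k A A]
    [SMulCommClass k A A] [StarModule k A] [CompleteSpace A] [IsCStar A]
    [TopologicalSpace.SeparableSpace A] [DistribMulAction G A] [IsGAlgebra k G A]
    [NonUnitalNormedRing B] [StarRing B] [NormedSpace k B] [IsScalarTower k B B]
    [SMulCommClass k B B] [StarModule k B] [CompleteSpace B] [IsCStar B]
    [DistribMulAction G B] [IsGAlgebra k G B]
    {J : InvariantIdeal k G A} (Y : RepCat.{uk, uG, uA, uB, uE} k G J.Alg B)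

/-- An invariant self-adjoint operator with range in the essential submodule that is the identity
modulo `D(J, J; B)`. -/
theorem exists_essential_unit :
    ∃ N : Adj Y.E, star N = N ∧ IsInvariant N.1 ∧ (∀ x, N.1 x ∈ Y.essential) ∧
      ∀ x : J.Alg, Y.rep x - N * Y.rep x ∈ compactIdeal Y.E := by
  obtain ⟨x, hx⟩ := J.exists_denseRange
  obtain ⟨e, hes, he1, heg, hex, -⟩ := J.exists_approx_unit_sequence x 0
  -- Only N' has range in the essential submodule. It comes without a norm bound, which is not
  -- needed here; the m_j and f_j are trivial.
  obtain ⟨N, N', ⟨-, -, -, hN, -, -⟩, hs, hg, hK, hW⟩ := exists_technical_operator (E := Y.E)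
    (F := Y.E) (v := fun n => Y.rep (e n)) (fun n => by rw [star_rep, hes])
    (fun n g => Y.conjAct_rep g _ (heg n g)) (fun n => (Y.norm_rep_le _).trans (he1 n))
    (fun j => Y.rep (x j)) 0 (f := fun _ => 0) (f' := fun _ => 0) (fun _ => IsAdj.zero)
    (fun n j hj => by rw [← rep_mul, ← rep_sub]; exact (Y.norm_rep_le _).trans (hex n j hj))
    (fun n j _ => by simp) (fun n j => by simp) Y.essential Y.isClosed_essential
    (fun n z => Y.rep_mem_essential _ z)
  refine ⟨N', hs, conjAct_eq_iff.1 hg, hW, fun y => ?_⟩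
  have hrc : Continuous Y.rep := Y.continuous_rep
  refine hx.induction_on (p := fun y => Y.rep y - N' * Y.rep y ∈ compactIdeal Y.E) y
    (isClosed_compactIdeal.preimage (by fun_prop)) fun j => ?_
  have := sub_mem (hN j) (compactIdeal_mul_right hK (Y.rep (x j)))
  convert this using 1
  rw [sub_mul]; abel

/-- Compactness is known only for operators out of Y.E. The operator φ(xe_n*) on X.E factors as the
lift of φ(x) to Y.E → X.E after φ(e_n*)ι, and xe_n* tends to x. -/
theorem comp_mem_compacts_of_lift {Y : RepCat.{uk, uG, uA, uB, uE} k G J.Alg B}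
    {X : RepCat.{uk, uG, uA, uB, uE} k G A B} {ι : X.E →L[k] Y.E} (hι : IsInclusion ι Y.essential)
    (hφ : ∀ (x : J.Alg) w, ι (X.φ x w) = Y.φ x (ι w)) (P : X.E →L[k] X.E)
    (hP : ∀ (x : J.Alg) (R : Y.E →L[k] X.E), (∀ z, ι (R z) = Y.φ x z) →
      P ∘L R ∈ compacts Y.E X.E) (x : J.Alg) : P ∘L X.φ x ∈ compacts X.E X.E := by
  obtain ⟨e, -, he⟩ := J.exists_approx_unit_tendsto
  have hlim : Tendsto (fun n => x * star (e n)) atTop (𝓝 x) := by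
    have := (continuous_star.tendsto _).comp (he (star x))
    rw [star_star] at this
    refine this.congr fun n => ?_
    change star (e n * star x) = _
    rw [star_mul, star_star]
  have hc : Continuous fun y : J.Alg => P ∘L X.φ (y : A) := by
    have h1 : Continuous fun a => X.φ a := continuous_subtype_val.comp X.continuous_rep
    exact (ContinuousLinearMap.compL k X.E X.E X.E P).continuous.comp
      (h1.comp continuous_subtype_val)
  have hcl : IsClosed (compacts X.E X.E : Set (X.E →L[k] X.E)) :=
    Submodule.isClosed_topologicalClosure _
  refine hcl.mem_of_tendsto ((hc.tendsto x).comp hlim) (Eventually.of_forall fun n => ?_)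
  obtain ⟨R, hR⟩ := hι.exists_lift (Y.φ x) (Y.rep_mem_essential x)
  obtain ⟨R', hR'⟩ := hι.exists_lift (Y.φ (star (star (e n)))) (Y.rep_mem_essential _)
  have h2 : IsAdj (Y.φ (star (e n)) ∘L ι) R' := fun y z => by
    rw [← hι.inner_map, hR']
    exact Y.isAdj _ _ _
  have h3 := h2.mem_comp (hP x R hR)
  have h4 : X.φ (x * star (e n) : J.Alg) = R ∘L Y.φ (star (e n)) ∘L ι := by
    ext z
    refine hι.injective ?_
    change _ = ι (R (Y.φ (star (e n)) (ι z)))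
    rw [hR, hφ, map_mul_apply]
  change P ∘L X.φ (x * star (e n) : J.Alg) ∈ compacts X.E X.E
  rw [h4]
  exact h3

set_option maxHeartbeats 400000 in
/-- Modulo `D(J, J; B)`, every object of `Rep(J; B)` is unitarily isomorphic to a restriction. -/
theorem exists_restrict_unitary :
    ∃ (X : RepCat.{uk, uG, uA, uB, uE} k G A B) (w : restrictObj J X ⟶ Y),
      w ≫ NormedStarHoms.adj w - 𝟙 (restrictObj J X) ∈
        (RepCat.D (⊤ : NonUnitalStarSubalgebra k J.Alg)).hom _ _ ∧
      NormedStarHoms.adj w ≫ w - 𝟙 Y ∈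
        (RepCat.D (⊤ : NonUnitalStarSubalgebra k J.Alg)).hom _ _ := by
  obtain ⟨X, ι, hι, hφ⟩ := Y.exists_extension
  obtain ⟨N, hNs, hNg, hNW, hN⟩ := Y.exists_essential_unit
  have hN' : ∀ x : J.Alg, Y.rep x - Y.rep x * N ∈ compactIdeal Y.E := fun x => by
    have := compactIdeal_star (hN (star x))
    rwa [star_sub, star_mul, star_rep, hNs, star_star] at this
  have hNN : ∀ x : J.Alg, N * N * Y.rep x - Y.rep x ∈ compactIdeal Y.E := fun x => by
    have := neg_mem (add_mem (hN x) (compactIdeal_mul_left N (hN x)))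
    convert this using 1
    rw [mul_sub, mul_assoc]; abel
  have hNN' : ∀ x : J.Alg, Y.rep x * (N * N) - Y.rep x ∈ compactIdeal Y.E := fun x => by
    have := neg_mem (add_mem (hN' x) (compactIdeal_mul_right (hN' x) N))
    convert this using 1
    rw [sub_mul, mul_assoc]; abel
  -- L is N with codomain the essential submodule. It is the adjoint of the candidate unitary Nι, so
  -- one composite is NιL = N² and the other is LNι.
  obtain ⟨L, hL⟩ := hι.exists_lift N.1 hNW
  have hVL : IsAdj (N.1 ∘L ι) L := by
    have := hι.isAdj_lift hL
    rw [hNs] at this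
    exact this.symm
  have hmem : N.1 ∘L ι ∈ homs (restrictObj J X) Y := by
    refine ⟨⟨L, hVL⟩, fun g z => ?_, fun x => ?_⟩
    · exact (congrArg N.1 (hι.map_g_smul g z)).trans (hNg g (ι z))
    · have hC : N * Y.rep x - Y.rep x * N ∈ compactIdeal Y.E := by
        have := sub_mem (hN' x) (hN x)
        rwa [sub_sub_sub_cancel_left] at this
      have h1 := hι.comp_mem_compacts (S := X.φ (star x : J.Alg) ∘L L - L ∘L Y.φ (star x)) hC
        fun z => by
          rw [star_sub, star_mul, star_mul, hNs, star_rep]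
          change ι (X.φ (star x : J.Alg) (L z) - L (Y.φ (star x) z)) =
            Y.φ (star x) (N.1 z) - N.1 (Y.φ (star x) z)
          rw [map_sub, hφ, hL, hL]
      change (N.1 ∘L ι) ∘L X.φ x - Y.φ x ∘L N.1 ∘L ι ∈ compacts X.E Y.E
      convert h1 using 1
      ext z
      change N.1 (ι (X.φ x z)) - Y.φ x (N.1 (ι z)) = N.1 (Y.φ x (ι z)) - Y.φ x (N.1 (ι z))
      rw [hφ]
  let w : restrictObj J X ⟶ Y := ⟨N.1 ∘L ι, hmem⟩
  let w' : Y ⟶ restrictObj J X := ⟨L, adj_mem_homs hmem hVL⟩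
  have hw : NormedStarHoms.adj w = w' := adj_eq hVL
  -- The defect on X.E; it satisfies ιP = (N² - 1)ι, so its compactness properties follow from those
  -- of (N² - 1)φ(x) on Y.E.
  let P : X.E →L[k] X.E := L ∘L N.1 ∘L ι - ContinuousLinearMap.id k X.E
  have hPs : IsAdj P P := (hVL.comp hVL.symm).sub fun _ _ => rfl
  have hιP : ∀ z, ι (P z) = N.1 (N.1 (ι z)) - ι z := fun z => by
    change ι (L (N.1 (ι z)) - z) = _
    rw [map_sub, hL]
  have hP := comp_mem_compacts_of_lift hι hφ P fun x R hR => hι.mem_compacts (hNN x) fun z => by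
    change ι (P (R z)) = N.1 (N.1 (Y.φ x z)) - Y.φ x z
    rw [hιP, hR]
  refine ⟨X, w, ?_, ?_⟩ <;> rw [hw]
  · refine fun x _ => ⟨hP x, ?_⟩
    have h1 := hP (star x)
    have h2 := X.isAdj (star x : J.Alg)
    have h3 := compacts_adj (h2.comp hPs) h1
    change X.φ (star (star (x : A))) ∘L P ∈ compacts X.E X.E at h3
    rwa [star_star] at h3
  · refine fun x _ => ⟨?_, ?_⟩
    · change (N.1 ∘L ι ∘L L - ContinuousLinearMap.id k Y.E) ∘L Y.φ x ∈ compacts Y.E Y.E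
      convert mem_compactIdeal.1 (hNN x) using 1
      ext z
      change N.1 (ι (L (Y.φ x z))) - Y.φ x z = N.1 (N.1 (Y.φ x z)) - Y.φ x z
      rw [hL]
    · change Y.φ x ∘L (N.1 ∘L ι ∘L L - ContinuousLinearMap.id k Y.E) ∈ compacts Y.E Y.E
      convert mem_compactIdeal.1 (hNN' x) using 1
      ext z
      change Y.φ x (N.1 (ι (L z)) - z) = Y.φ x (N.1 (N.1 z)) - Y.φ x z
      rw [hL, map_sub]

end RepCat

/-! ### Passage to the quotient categories -/

theorem CStarIdeal.cls_eq_iff {k : Type uk} [RCLike k] {C : Type u} [Category.{v} C]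
    [NormedStarHoms C] [NormedStarCategory k C] (I : CStarIdeal k C) {X Y : C} {f g : X ⟶ Y} :
    I.cls f = I.cls g ↔ f - g ∈ I.hom X Y :=
  Submodule.Quotient.eq (I.hom X Y)

theorem CStarIdeal.norm_cls_le {k : Type uk} [RCLike k] {C : Type u} [Category.{v} C]
    [NormedStarHoms C] [NormedStarCategory k C] (I : CStarIdeal k C) {X Y : C} (f : X ⟶ Y) :
    ‖I.cls f‖ ≤ ‖f‖ :=
  Submodule.Quotient.norm_mk_le (I.hom X Y) f

theorem CStarIdeal.exists_norm_lt {k : Type uk} [RCLike k] {C : Type u} [Category.{v} C]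
    [NormedStarHoms C] [NormedStarCategory k C] (I : CStarIdeal k C) {X Y : I.Quot} (f : X ⟶ Y)
    {ε : ℝ} (hε : 0 < ε) : ∃ f' : X.as ⟶ Y.as, I.cls f' = f ∧ ‖f'‖ < ‖f‖ + ε :=
  Submodule.Quotient.norm_mk_lt (S := I.hom X.as Y.as) f hε

/-- A criterion for the functor induced on quotients to be an equivalence. -/
theorem CStarIdeal.induced_isCStarEquivalence {k : Type uk} [RCLike k] {C : Type u}
    [Category.{v} C] [NormedStarHoms C] [NormedStarCategory k C] {D : Type u'} [Category.{v'} D]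
    [NormedStarHoms D] [NormedStarCategory k D] {I : CStarIdeal k C} {I' : CStarIdeal k D}
    (F : StarFunctor k C D)
    (h : ∀ (X Y : C) (f : X ⟶ Y), f ∈ I.hom X Y → F.map f ∈ I'.hom (F.obj X) (F.obj Y))
    (hinj : ∀ (X Y : C) (f : X ⟶ Y), F.map f ∈ I'.hom (F.obj X) (F.obj Y) → f ∈ I.hom X Y)
    (hlift : ∀ (X Y : C) (f : F.obj X ⟶ F.obj Y), ∃ f' : X ⟶ Y, ‖f'‖ ≤ ‖f‖ ∧
      f - F.map f' ∈ I'.hom (F.obj X) (F.obj Y))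
    (hnorm : ∀ {X Y : C} (f : X ⟶ Y), ‖F.map f‖ ≤ ‖f‖)
    (hunit : ∀ Y : D, ∃ (X : C) (w : F.obj X ⟶ Y),
      w ≫ NormedStarHoms.adj w - 𝟙 (F.obj X) ∈ I'.hom _ _ ∧
      NormedStarHoms.adj w ≫ w - 𝟙 Y ∈ I'.hom _ _) :
    (CStarIdeal.induced F h).IsCStarEquivalence := by
  have hmap : ∀ {X Y : C} (f : X ⟶ Y), (CStarIdeal.induced F h).map (I.cls f) = I'.cls (F.map f) :=
    fun _ => rfl
  have hsub : ∀ {X Y : C} (f g : X ⟶ Y), F.map (f - g) = F.map f - F.map g := fun f g => by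
    have := F.map_add (f - g) g
    rw [sub_add_cancel] at this
    rw [this, add_sub_cancel_right]
  have hb : ∀ X Y : I.Quot,
      Function.Injective fun f : X ⟶ Y => (CStarIdeal.induced F h).map f := by
    intro X Y f g hfg
    obtain ⟨f, rfl⟩ := I.cls_surjective f
    obtain ⟨g, rfl⟩ := I.cls_surjective g
    have h1 := (I'.cls_eq_iff (f := F.map f) (g := F.map g)).1 hfg
    rw [← hsub] at h1
    exact I.cls_eq_iff.2 (hinj _ _ _ h1)
  refine ⟨fun X Y => ⟨hb X Y, fun f => ?_⟩, fun {X Y} f => le_antisymm ?_ ?_, fun Y => ?_⟩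
  · obtain ⟨f, rfl⟩ := I'.cls_surjective f
    obtain ⟨f', -, hf'⟩ := hlift X.as Y.as f
    exact ⟨I.cls f', (I'.cls_eq_iff.2 hf').symm⟩
  · refine le_of_forall_pos_lt_add fun ε hε => ?_
    obtain ⟨f', rfl, hf'⟩ := I.exists_norm_lt f hε
    exact ((I'.norm_cls_le (F.map f')).trans (hnorm f')).trans_lt hf'
  · refine le_of_forall_pos_lt_add fun ε hε => ?_
    obtain ⟨f', h1, h2⟩ := I'.exists_norm_lt ((CStarIdeal.induced F h).map f) hε
    -- A nearly optimal representative in the target lifts without increase of norm, and by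
    -- injectivity its lift represents f.
    obtain ⟨f'', h3, h4⟩ := hlift X.as Y.as f'
    have h5 : I.cls f'' = f := hb X Y ((I'.cls_eq_iff.2 h4).symm.trans h1)
    rw [← h5] at h2 ⊢
    exact ((I.norm_cls_le f'').trans h3).trans_lt h2
  · obtain ⟨X, w, h1, h2⟩ := hunit Y.as
    exact ⟨⟨X⟩, I'.cls w, I'.cls_eq_iff.2 h1, I'.cls_eq_iff.2 h2⟩

theorem mainTheorem8 {k : Type uk} {G : Type uG} {A : Type uA} {B : Type uB} [RCLike k]
    -- a second countable compact group
    [Group G] [TopologicalSpace G] [IsTopologicalGroup G] [CompactSpace G] [T2Space G]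
    [SecondCountableTopology G]
    -- a separable C*-algebra `A` over `k` with an action of `G`
    [NonUnitalNormedRing A] [StarRing A] [NormedSpace k A] [IsScalarTower k A A]
    [SMulCommClass k A A] [StarModule k A] [CompleteSpace A] [IsCStar A]
    [TopologicalSpace.SeparableSpace A] [DistribMulAction G A] [IsGAlgebra k G A]
    -- a C*-algebra `B` over `k` with an action of `G`
    [NonUnitalNormedRing B] [StarRing B] [NormedSpace k B] [IsScalarTower k B B]
    [SMulCommClass k B B] [StarModule k B] [CompleteSpace B] [IsCStar B]
    [DistribMulAction G B] [IsGAlgebra k G B]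
    (J : InvariantIdeal k G A) :
    ∃ h : ∀ (X Y : RepCat.{uk, uG, uA, uB, uE} k G A B) (f : X ⟶ Y),
        f ∈ (RepCat.D J.toNonUnitalStarSubalgebra).hom X Y →
        (RepCat.restrict J).map f ∈
          (RepCat.D (⊤ : NonUnitalStarSubalgebra k J.Alg)).hom
            ((RepCat.restrict J).obj X) ((RepCat.restrict J).obj Y),
      (CStarIdeal.induced (RepCat.restrict J) h).IsCStarEquivalence := by
  -- Both ideals test the same operator against the same elements of J, which gives well-definedness
  -- here and injectivity below.
  refine ⟨fun X Y f hf x _ => hf x x.2, ?_⟩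
  exact CStarIdeal.induced_isCStarEquivalence _ _
    (fun X Y f hf x hx => hf ⟨x, hx⟩ trivial) (fun X Y => RepCat.exists_lift J X Y)
    (fun f => le_rfl) fun Y => Y.exists_restrict_unitary
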